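/- Let $q>2$ be a prime power. Consider an incidence structure $(\mathcal P,\mathcal B)$ of one of the following types, where elements of $\mathcal B$ are called circles and are subsets of the point set $\mathcal P$. An oval in a plane of $\mathrm{PG}(3,q)$ is a set of $q+1$ points of the plane, no three on a line; an oval plane of a point set $\mathcal Q\subseteq \mathrm{PG}(3,q)$ is a plane $\pi$ such that $\pi\cap\mathcal Q$ is an oval in $\pi$. 1. ($\rho=0$, ovoidal Möbius plane) $\mathcal P=\mathcal Q$ is an ovoid of $\mathrm{PG}(3,q)$, i.e. a set of $q^2+1$ points, no three on a line, and the circles are the sets $\pi\cap\mathcal Q$ with $\pi$ an oval plane. 2. ($\rho=1$, $q$ odd, ovoidal Laguerre plane) $\mathcal Q$ is an oval cone in $\mathrm{PG}(3,q)$, i.e. the union of the lines joining a point $R$ to the points of an oval $\mathcal O$ in a plane not containing $R$; $\mathcal P=\mathcal Q\setminus\{R\}$, and the circles are the sets $\pi\cap\mathcal Q$ with $\pi$ an oval plane. 3. ($\rho=1$, $q$ even, extended Laguerre plane) $\mathcal Q$, $R$, $\mathcal O$ are as in 2, $N$ is the nucleus of $\mathcal O$ (the point $N$ of the plane of $\mathcal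 O$ such that the tangent lines to $\mathcal O$ in that plane are exactly the lines of that plane through $N$), $\mathcal Q_+=\mathcal Q\cup\langle R,N\rangle$, $\mathcal P=\mathcal Q_+\setminus\{R\}$, and the circles are the sets $\pi\cap\mathcal Q_+$ with $\pi$ an oval plane of $\mathcal Q$. 4. ($\rho=2$, ovoidal Minkowski plane) $\mathcal P=\mathcal Q$ is a hyperbolic quadric of $\mathrm{PG}(3,q)$, i.e. the union of all lines meeting each of three given pairwise disjoint lines, and the circles are the sets $\pi\cap\mathcal Q$ with $\pi$ an oval plane. 5. ($\rho=2$, the Minkowski plane $\mathrm{CM}(2,q,\varphi)$ for a field automorphism $\varphi$ of $\mathbb F_q$) $\mathcal P=\mathrm{PG}(1,q)\times\mathrm{PG}(1,q)$, and the circles are the graphs $\{(x,f_M(x)) : x\in \mathrm{PG}(1,q)\}$ for $M\in\mathrm{PGL}(2,q)$, where $f_M(x)=Mx$ if $M\in\mathrm{PSL}(2,q)$ and $f_M(x)=Mx^{\varphi}$ otherwise. Let $\mathcal F\subseteq\mathcal B$ be an intersecting family, i.e. any two elements of $\mathcal F$ have non-empty intersection, and let $P\in\mathcal P$ be a point. Put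 $S=\{c\in\mathcal F : P\in c\}$, $T=\mathcal F\setminus S$, and $$\lambda=\begin{cases} q(q^2-1) & \text{if } q \text{ is odd},\\ q(q-2+\rho)\bigl(q+(1-\rho)(2-\rho)\bigr) & \text{if } q \text{ is even}.\end{cases}$$ Then $$|S|\,|T|\le\left(\frac{q}{q+\rho-2}\right)^2\lambda\left(1-\frac{|S|}{q(q+1-\rho)}\right)\left(1-\frac{|T|}{q^2(q-1)}\right).$$ -/

import Mathlib

open scoped LinearAlgebra.Projectivization MatrixGroups

universe u

namespace CircleGeometry

/-- An incidence structure: a set of points together with a set of blocks, each block being a set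
of points. -/
structure IncidenceStructure where
  Point : Type u
  blocks : Set (Set Point)

section Projective

variable (K : Type u) [Field K]

/-- The points of the projective space `PG(3, K)`; its lines and planes are the subspaces of `K ^ 4`
of (vector space) dimension `2` and `3`. -/
abbrev PG3 : Type u := ℙ K (Fin 4 → K)

/-- The lines, planes, ... of `PG(3, K)`. -/
abbrev Flat : Type u := Submodule K (Fin 4 → K)

variable {K}

/-- The set of projective points lying on a subspace. -/
def pointsOf (W : Flat K) : Set (PG3 K) := {X | X.submodule ≤ W}

def IsLine (l : Flat K) : Prop := Module.finrank K l = 2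

def IsPlane (p : Flat K) : Prop := Module.finrank K p = 3

/-- No three points of `s` lie on a common line. -/
def NoThreeCollinear (s : Set (PG3 K)) : Prop :=
  ∀ l : Flat K, IsLine l → (s ∩ pointsOf l).ncard ≤ 2

/-- An ovoid: a set of `q ^ 2 + 1` points of `PG(3, q)`, no three on a line. -/
def IsOvoid (s : Set (PG3 K)) : Prop :=
  s.ncard = Nat.card K ^ 2 + 1 ∧ NoThreeCollinear s

/-- `s` is an oval in the plane `p`: a set of `q + 1` points of `p`, no three on a line. -/
def IsOvalIn (p : Flat K) (s : Set (PG3 K)) : Prop :=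
  IsPlane p ∧ s ⊆ pointsOf p ∧ s.ncard = Nat.card K + 1 ∧ NoThreeCollinear s

/-- The line (subspace) spanned by two points. -/
def span₂ (X Y : PG3 K) : Flat K := X.submodule ⊔ Y.submodule

/-- The cone with vertex `R` and base `O`: the union of the lines through `R` meeting `O`. -/
def cone (R : PG3 K) (O : Set (PG3 K)) : Set (PG3 K) :=
  {X | ∃ Y ∈ O, X ∈ pointsOf (span₂ R Y)}

/-- `N` is a nucleus of `O` in the plane `p`: a point of `p` such that the lines of `p` tangent
to `O` (meeting `O` in exactly one point) are exactly the lines of `p` through `N`. -/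
def IsNucleus (p : Flat K) (O : Set (PG3 K)) (N : PG3 K) : Prop :=
  N ∈ pointsOf p ∧
    ∀ l : Flat K, IsLine l → l ≤ p → ((O ∩ pointsOf l).ncard = 1 ↔ N ∈ pointsOf l)

/-- The union of all lines that meet each of the lines `l₀`, `l₁`, `l₂`. When these three lines are
pairwise disjoint, this is a hyperbolic quadric, and every hyperbolic quadric is of this form. -/
def transversalUnion (l₀ l₁ l₂ : Flat K) : Set (PG3 K) :=
  {X | ∃ m : Flat K, IsLine m ∧ m ⊓ l₀ ≠ ⊥ ∧ m ⊓ l₁ ≠ ⊥ ∧ m ⊓ l₂ ≠ ⊥ ∧ X ∈ pointsOf m}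

/-- A hyperbolic quadric of `PG(3, K)`. -/
def IsHyperbolicQuadric (Q : Set (PG3 K)) : Prop :=
  ∃ l₀ l₁ l₂ : Flat K, IsLine l₀ ∧ IsLine l₁ ∧ IsLine l₂ ∧
    Disjoint l₀ l₁ ∧ Disjoint l₀ l₂ ∧ Disjoint l₁ l₂ ∧ Q = transversalUnion l₀ l₁ l₂

/-- An oval plane of `Q`: a plane that intersects `Q` in an oval. -/
def IsOvalPlane (Q : Set (PG3 K)) (p : Flat K) : Prop := IsOvalIn p (pointsOf p ∩ Q)

/-- The incidence structure with point set `pts`, whose blocks are the intersections of `pts` with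
the oval planes of `Q`. -/
def sections (Q pts : Set (PG3 K)) : IncidenceStructure.{u} where
  Point := pts
  blocks := {c | ∃ p : Flat K, IsOvalPlane Q p ∧ c = {x : pts | (x : PG3 K) ∈ pointsOf p}}

end Projective

section Minkowski

variable {K : Type u} [Field K]

/-- The coordinatewise application of a field automorphism, as a semilinear map. -/
def coordMap (φ : K ≃+* K) : (Fin 2 → K) →ₛₗ[(φ : K →+* K)] (Fin 2 → K) where
  toFun v i := φ (v i)
  map_add' v w := by ext i; simp
  map_smul' a v := by ext i; simp

theorem coordMap_injective (φ : K ≃+* K) : Function.Injective (coordMap φ) := by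
  intro v w h
  ext i
  exact φ.injective (congrFun h i)

/-- The action `x ↦ x ^ φ` of a field automorphism on the projective line `PG(1, K)`. -/
def autAct (φ : K ≃+* K) (x : ℙ K (Fin 2 → K)) : ℙ K (Fin 2 → K) :=
  Projectivization.map (coordMap φ) (coordMap_injective φ) x

/-- `PSL(2, K)` as a subgroup of `PGL(2, K)`. -/
def pslSubgroup (K : Type u) [Field K] : Subgroup PGL(2, K) :=
  (Matrix.ProjectiveSpecialLinearGroup.toPGL (n := Fin 2) (R := K)).range

open Classical in
/-- The map `f_M` on the projective line: `x ↦ M x` if `M ∈ PSL(2, K)`, and `x ↦ M x ^ φ`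
otherwise. -/
noncomputable def twistedMap (φ : K ≃+* K) (M : PGL(2, K)) (x : ℙ K (Fin 2 → K)) :
    ℙ K (Fin 2 → K) :=
  if M ∈ pslSubgroup K then M • x else M • autAct φ x

/-- The Minkowski plane `CM(2, q, φ)`: the points are the pairs of points of the projective line,
the circles are the graphs of the maps `f_M`, `M ∈ PGL(2, K)`. -/
def minkowskiPlane (φ : K ≃+* K) : IncidenceStructure.{u} where
  Point := ℙ K (Fin 2 → K) × ℙ K (Fin 2 → K)
  blocks := {c | ∃ M : PGL(2, K), c = {x | x.2 = twistedMap φ M x.1}}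

end Minkowski

/-- `KnownGeometry K ρ D` says that `D` is one of the known circle geometries with `ρ` parallel
relations over the finite field `K`: an ovoidal one (plane sections of an ovoid, an oval cone or a
hyperbolic quadric) or one of the Minkowski planes `CM(2, q, φ)`; when `q` is even, Laguerre planes
are replaced by extended Laguerre planes. -/
inductive KnownGeometry (K : Type u) [Field K] : ℕ → IncidenceStructure.{u} → Prop
  | moebius (Q : Set (PG3 K)) (hQ : IsOvoid Q) : KnownGeometry K 0 (sections Q Q)
  | laguerre (hq : Odd (Nat.card K)) (p : Flat K) (O : Set (PG3 K)) (hO : IsOvalIn p O)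
      (R : PG3 K) (hR : R ∉ pointsOf p) :
      KnownGeometry K 1 (sections (cone R O) (cone R O \ {R}))
  | extendedLaguerre (hq : Even (Nat.card K)) (p : Flat K) (O : Set (PG3 K)) (hO : IsOvalIn p O)
      (R : PG3 K) (hR : R ∉ pointsOf p) (N : PG3 K) (hN : IsNucleus p O N) :
      KnownGeometry K 1 (sections (cone R O) ((cone R O ∪ pointsOf (span₂ R N)) \ {R}))
  | minkowski (Q : Set (PG3 K)) (hQ : IsHyperbolicQuadric Q) : KnownGeometry K 2 (sections Q Q)
  | twistedMinkowski (φ : K ≃+* K) : KnownGeometry K 2 (minkowskiPlane φ)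

/-- An intersecting family: a set of blocks, any two of which intersect. -/
def IsIntersectingFamily (D : IncidenceStructure.{u}) (F : Set (Set D.Point)) : Prop :=
  F ⊆ D.blocks ∧ ∀ c ∈ F, ∀ d ∈ F, (c ∩ d).Nonempty

/-- The constant `λ`, as a function of `q` and `ρ`. -/
noncomputable def lam (q ρ : ℕ) : ℝ :=
  if Odd q then (q : ℝ) * ((q : ℝ) ^ 2 - 1)
  else (q : ℝ) * ((q : ℝ) - 2 + (ρ : ℝ)) * ((q : ℝ) + (1 - (ρ : ℝ)) * (2 - (ρ : ℝ)))

end CircleGeometry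

/-! Let C be the set of circles through `P` and D the set of circles missing `P`. Every member of
`S` meets every member of `T`, so the pair spans a complete bipartite subgraph of the meeting graph
between C and D. This graph is biregular, and a Hoffman-type argument (`card_mul_card_le_of_meets`)
bounds |S||T| through the norm of its adjacency matrix on vectors of sum zero.

Distinct circles share at most two points, so twice the meeting indicator is the number of common
points plus one for tangent pairs (`weight`). Hence λ bounds the Gram matrix of the doubled
adjacency matrix. By `sum_weight_mul` this Gram matrix is built from the identity, the all-one
matrix, the relation of touching in `P`, and the number `bitangent` of circles off `P` tangent to
two given circles. Touching in `P` is an equivalence relation with classes of size q, so its form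
lies between 0 and q times the squared norm.

To find `bitangent`, take y on c and off d and count the circles that touch c in y and are tangent
to d. This number has the parity of q + 1 - ρ, and it is one on average over all c through y. If q +
1 - ρ is odd, it is always one. If q is odd and ρ is even, it is at most two, hence 0 or 2; which of
the two occurs is governed by a division of the circles into two types that tangency respects
(`IsTyping`). The spectral bounds are `spectral_of_odd` and `spectral_of_type`.

It remains to supply the geometry. On a cone, circles become linear functionals on the base plane,
evaluated on an arc. In the extended Laguerre plane the arc is a hyperoval: two circles share no or
two points, and the Gram matrix is a combination of I and J (`IsArc.familyBound`). In Minkowski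
planes the types are membership and non-membership in PSL(2, q), and the hyperbolic quadric is the
case of the trivial automorphism, through the Segre embedding. For an ovoid, every plane with at
least two of its points is oval (`IsCap.cnt_plane_eq`); when q is odd, Segre's lemma of tangents
yields a symmetric form B, and the type of the plane conjugate to u is the square class of B(u, u).
No classification of ovoids as quadrics is needed. -/

namespace CircleGeometry

/-! ### The Hoffman-type bound for cross-intersecting families. -/

section Core

variable {ι α : Type*}

open scoped Classical in
/-- A Hoffman-type bound for two cross-intersecting families `S ⊆ C` and `T ⊆ D`. -/
theorem card_mul_card_le_of_meets [DecidableEq ι] (meets : ι → ι → Prop) (C D S T : Finset ι)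
    (hSC : S ⊆ C) (hTD : T ⊆ D) (hST : ∀ c ∈ S, ∀ d ∈ T, meets c d) (X Y m m' L : ℝ)
    (hX : (C.card : ℝ) = X) (hY : (D.card : ℝ) = Y) (hX0 : 0 < X) (hY0 : 0 < Y) (hmX : m < X)
    (hL : 0 ≤ L)
    (hcol : ∀ d ∈ D, ((C.filter fun c => meets c d).card : ℝ) = m)
    (hrow : ∀ c ∈ C, ((D.filter fun d => meets c d).card : ℝ) = m')
    (hspec : ∀ f : ι → ℝ, ∑ c ∈ C, f c = 0 →
      4 * ∑ d ∈ D, (∑ c ∈ C.filter fun c => meets c d, f c) ^ 2 ≤ L * ∑ c ∈ C, f c ^ 2) :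
    (S.card : ℝ) * T.card ≤
      (X / (X - m)) ^ 2 * (L / 4) * (1 - S.card / X) * (1 - T.card / Y) := by
  set s : ℝ := (S.card : ℝ) with hs
  set t : ℝ := (T.card : ℝ) with ht
  have hsX : s ≤ X := by rw [← hX, hs]; exact_mod_cast Finset.card_le_card hSC
  have htY : t ≤ Y := by rw [← hY, ht]; exact_mod_cast Finset.card_le_card hTD
  have hs0 : 0 ≤ s := by positivity
  have ht0 : 0 ≤ t := by positivity
  -- The indicator function of `S` minus its mean over `C`; `g` below is its image under the meeting
  -- matrix.
  set f : ι → ℝ := fun c => (if c ∈ S then 1 else 0) - s / X with hf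
  have hsum : ∀ A : Finset ι, ∑ c ∈ A, f c = ((A ∩ S).card : ℝ) - A.card * (s / X) := by
    intro A
    simp [hf, Finset.sum_sub_distrib, Finset.sum_ite_mem]
  have hf0 : ∑ c ∈ C, f c = 0 := by
    rw [hsum, Finset.inter_eq_right.mpr hSC, hX]
    field_simp
    simp [hs]
  have hfsq : ∑ c ∈ C, f c ^ 2 = s * (1 - s / X) := by
    have h2 : ∀ c ∈ C, f c ^ 2 = (1 - 2 * (s / X)) * f c + (s / X) * (1 - s / X) := by
      intro c _
      by_cases hc : c ∈ S <;> simp [hf, hc] <;> ring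
    rw [Finset.sum_congr rfl h2, Finset.sum_add_distrib, ← Finset.mul_sum, hf0]
    simp only [Finset.sum_const, nsmul_eq_mul, hX]
    field_simp
    ring
  set g : ι → ℝ := fun d => ∑ c ∈ C.filter fun c => meets c d, f c with hg
  have hgT : ∀ d ∈ T, g d = s * (1 - m / X) := by
    intro d hd
    simp only [hg]
    rw [hsum, hcol d (hTD hd)]
    have : (C.filter fun c => meets c d) ∩ S = S := by
      apply Finset.inter_eq_right.mpr
      intro c hc
      exact Finset.mem_filter.mpr ⟨hSC hc, hST c hc d hd⟩
    rw [this]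
    field_simp
    ring
  -- The constant degree `m'` on the side of `C` transports sum zero from `f` to `g`.
  have hg0 : ∑ d ∈ D, g d = 0 := by
    simp only [hg, Finset.sum_filter]
    rw [Finset.sum_comm]
    have : ∀ c ∈ C, ∑ d ∈ D, (if meets c d then f c else 0) = m' * f c := by
      intro c hc
      rw [← Finset.sum_filter, Finset.sum_const, nsmul_eq_mul, hrow c hc]
    rw [Finset.sum_congr rfl this, ← Finset.mul_sum, hf0, mul_zero]
  have hgsq := hspec f hf0
  rw [hfsq] at hgsq
  change 4 * ∑ d ∈ D, g d ^ 2 ≤ _ at hgsq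
  -- On `T` the function `g` is a known constant and its total is zero, so its sum over `D \ T` is
  -- known too; Cauchy–Schwarz there bounds the sum of squares from below.
  have hlow : t * (s * (1 - m / X)) ^ 2 ≤ (∑ d ∈ D, g d ^ 2) * (1 - t / Y) := by
    set G := s * (1 - m / X) with hG
    have hT1 : ∑ d ∈ T, g d = t * G := by
      rw [Finset.sum_congr rfl hgT]; simp [ht]
    have hT2 : ∑ d ∈ T, g d ^ 2 = t * G ^ 2 := by
      rw [Finset.sum_congr rfl fun d hd => by rw [hgT d hd]]; simp [ht]
    have hD1 : ∑ d ∈ D \ T, g d = - (t * G) := by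
      have := Finset.sum_sdiff (f := g) hTD
      linarith
    have hD2 : ∑ d ∈ D \ T, g d ^ 2 + t * G ^ 2 = ∑ d ∈ D, g d ^ 2 := by
      rw [← hT2]; exact Finset.sum_sdiff hTD
    have hcard : ((D \ T).card : ℝ) = Y - t := by
      rw [Finset.card_sdiff_of_subset hTD, Nat.cast_sub (Finset.card_le_card hTD), hY]
    have hcs := sq_sum_le_card_mul_sum_sq (s := D \ T) (f := g)
    rw [hD1, hcard] at hcs
    rw [← hD2]
    have h3 : (1 - t / Y) * Y = Y - t := by field_simp
    have h4 : t * G ^ 2 * Y ≤ ((∑ d ∈ D \ T, g d ^ 2 + t * G ^ 2) * (1 - t / Y)) * Y := by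
      rw [mul_assoc _ (1 - t / Y), h3]
      nlinarith
    exact le_of_mul_le_mul_right h4 hY0
  have h5 : 0 ≤ 1 - t / Y := by rw [sub_nonneg, div_le_one hY0]; exact htY
  have h6 : 0 ≤ 1 - s / X := by rw [sub_nonneg, div_le_one hX0]; exact hsX
  -- The estimates carry a common factor `s`, which is cancelled below.
  rcases hs0.eq_or_lt with h0 | h0
  · rw [← h0]; simp only [zero_mul]; simp; positivity
  have hXm : 0 < X - m := by linarith
  have h7 : s * (t * s * (1 - m / X) ^ 2) ≤ s * (L / 4 * (1 - s / X) * (1 - t / Y)) := by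
    calc s * (t * s * (1 - m / X) ^ 2) = t * (s * (1 - m / X)) ^ 2 := by ring
      _ ≤ _ := hlow
      _ ≤ (L * (s * (1 - s / X)) / 4) * (1 - t / Y) :=
        mul_le_mul_of_nonneg_right (by linarith) h5
      _ = _ := by ring
  have h8 := le_of_mul_le_mul_left h7 h0
  have h9 : 1 - m / X = (X - m) / X := by field_simp
  rw [h9] at h8
  calc s * t = (X / (X - m)) ^ 2 * (t * s * ((X - m) / X) ^ 2) := by field_simp
    _ ≤ (X / (X - m)) ^ 2 * (L / 4 * (1 - s / X) * (1 - t / Y)) :=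
        mul_le_mul_of_nonneg_left h8 (by positivity)
    _ = _ := by ring

end Core

end CircleGeometry

namespace CircleGeometry

/-! ### Finite circle planes: axioms, touching, elementary counts. -/

section CirclePlane

open Finset
open scoped Classical

/-- A finite circle geometry of order `q` with `ρ` parallel relations; `inc c x` says that the point
`x` lies on the circle `c`, and `par x y` that the points `x` and `y` are equal or parallel. -/
structure IsCirclePlane {α ι : Type*} [Fintype α] [Fintype ι] (q ρ : ℕ) (inc : ι → α → Prop)
    (par : α → α → Prop) : Prop where
  two_lt : 2 < q
  rho_le : ρ ≤ 2
  refl : ∀ x, par x x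
  symm : ∀ {x y}, par x y → par y x
  card_circle : ∀ c, #{x | inc c x} = q + 1
  eq_of_par : ∀ {c x y}, inc c x → inc c y → par x y → x = y
  exists_circle : ∀ {x y z}, ¬ par x y → ¬ par x z → ¬ par y z → ∃ c, inc c x ∧ inc c y ∧ inc c z
  unique_circle : ∀ {c d x y z}, x ≠ y → x ≠ z → y ≠ z → inc c x → inc c y → inc c z →
    inc d x → inc d y → inc d z → c = d
  card_par : ∀ {c x}, ¬ inc c x → #{y | inc c y ∧ par x y} = ρ
  -- This count and the next one take the place of the number of points and the sizes of the
  -- parallel classes.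
  card_not_par : ∀ x, #{y | ¬ par x y} = q ^ 2
  card_not_par₂ : ∀ {x y}, ¬ par x y → #{z | ¬ par x z ∧ ¬ par y z} = (q - 1) * (q + 1 - ρ)

variable {α ι : Type*} {q ρ : ℕ} {inc : ι → α → Prop} {par : α → α → Prop}

/-- The circles `c` and `d` touch in `x`, or are equal and contain `x`. -/
def Touch (inc : ι → α → Prop) (x : α) (c d : ι) : Prop :=
  inc c x ∧ inc d x ∧ (c = d ∨ ∀ z, inc c z → inc d z → z = x)

/-- The number of common points of two circles. -/
noncomputable def common [Fintype α] (inc : ι → α → Prop) (c d : ι) : ℕ := #{z | inc c z ∧ inc d z}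

theorem common_comm [Fintype α] (c d : ι) : common inc c d = common inc d c := by
  simp only [common, and_comm]

theorem Touch.symm {x : α} {c d : ι} (h : Touch inc x c d) : Touch inc x d c :=
  ⟨h.2.1, h.1, h.2.2.imp Eq.symm fun h z hd hc => h z hc hd⟩

theorem touch_self {x : α} {c : ι} (h : inc c x) : Touch inc x c c := ⟨h, h, Or.inl rfl⟩

theorem Touch.common_eq_one [Fintype α] {x : α} {c d : ι} (h : Touch inc x c d) (hne : c ≠ d) :
    common inc c d = 1 := by
  rw [common, card_eq_one]
  refine ⟨x, ?_⟩
  ext z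
  simp only [mem_filter, mem_univ, true_and, mem_singleton]
  constructor
  · rintro ⟨h1, h2⟩
    exact (h.2.2.resolve_left hne) z h1 h2
  · rintro rfl
    exact ⟨h.1, h.2.1⟩

theorem exists_touch_of_common [Fintype α] {c d : ι} (h : common inc c d = 1) :
    ∃ x, Touch inc x c d ∧ ∀ z, inc c z → inc d z → z = x := by
  rw [common, card_eq_one] at h
  obtain ⟨x, hx⟩ := h
  have h1 : ∀ z, (inc c z ∧ inc d z) ↔ z = x := by
    intro z
    simpa using congrArg (z ∈ ·) hx
  have hx' := (h1 x).2 rfl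
  exact ⟨x, ⟨hx'.1, hx'.2, Or.inr fun z hc hd => (h1 z).1 ⟨hc, hd⟩⟩,
    fun z hc hd => (h1 z).1 ⟨hc, hd⟩⟩

theorem touch_of_common [Fintype α] {x : α} {c d : ι} (h : common inc c d = 1) (hc : inc c x) (hd : inc d x) :
    Touch inc x c d := by
  obtain ⟨y, hy, hy'⟩ := exists_touch_of_common h
  exact hy' x hc hd ▸ hy

/-- A sum of numbers at most two is congruent modulo two to the number of ones. -/
theorem sum_mod_two {β : Type*} (s : Finset β) (f : β → ℕ) (hf : ∀ b ∈ s, f b ≤ 2) :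
    (∑ b ∈ s, f b) % 2 = #{b ∈ s | f b = 1} % 2 := by
  have : ∑ b ∈ s, f b = #{b ∈ s | f b = 1} + 2 * #{b ∈ s | f b = 2} := by
    rw [card_filter, card_filter, mul_sum, ← sum_add_distrib]
    refine sum_congr rfl fun b hb => ?_
    have := hf b hb
    interval_cases f b <;> simp
  omega

namespace IsCirclePlane

variable [Fintype α] [Fintype ι]

theorem card_sub (h : IsCirclePlane q ρ inc par) {c : ι} {y : α} (hy : ¬ inc c y) :
    #{z | inc c z ∧ ¬ par y z} = q + 1 - ρ := by
  have h1 := h.card_par hy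
  have h2 := h.card_circle c
  rw [← card_filter_add_card_filter_not (s := {z | inc c z}) (fun z => par y z), filter_filter,
    filter_filter] at h2
  omega

theorem card_erase (h : IsCirclePlane q ρ inc par) {c : ι} {x : α} (hx : inc c x) :
    #{z | inc c z ∧ z ≠ x} = q := by
  have : ({z | inc c z ∧ z ≠ x} : Finset α) = ({z | inc c z} : Finset α).erase x := by
    ext; simp [and_comm]
  rw [this, card_erase_of_mem (by simpa using hx), h.card_circle]; simp

theorem not_par (h : IsCirclePlane q ρ inc par) {c : ι} {x y : α} (hx : inc c x) (hy : inc c y)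
    (hne : x ≠ y) : ¬ par x y := fun hp => hne (h.eq_of_par hx hy hp)

theorem ne_of_not_par (h : IsCirclePlane q ρ inc par) {x y : α} (hp : ¬ par x y) : x ≠ y := by
  rintro rfl
  exact hp (h.refl x)

/-- The number of circles through two nonparallel points. -/
theorem card_through₂ (h : IsCirclePlane q ρ inc par) {x y : α} (hxy : ¬ par x y) :
    #{c | inc c x ∧ inc c y} = q + 1 - ρ := by
  have h2 := h.two_lt
  -- Flags (c, z) with z parallel to neither point: three points determine a circle, and each circle
  -- through `x` and `y` carries q - 1 such z.
  have key := card_mul_eq_card_mul (s := ({c | inc c x ∧ inc c y} : Finset ι))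
    (t := ({z | ¬ par x z ∧ ¬ par y z} : Finset α)) inc (m := q - 1) (n := 1) ?_ ?_
  · rw [h.card_not_par₂ hxy, mul_one, mul_comm] at key
    exact Nat.eq_of_mul_eq_mul_left (by omega) key
  · intro c hc
    simp only [mem_filter, mem_univ, true_and] at hc
    have : bipartiteAbove inc ({z | ¬ par x z ∧ ¬ par y z} : Finset α) c
        = (({z | inc c z ∧ z ≠ x} : Finset α)).erase y := by
      ext z
      simp only [mem_bipartiteAbove, mem_filter, mem_univ, true_and, mem_erase]
      constructor
      · rintro ⟨⟨h1, h2⟩, h3⟩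
        exact ⟨(h.ne_of_not_par h2).symm, h3, (h.ne_of_not_par h1).symm⟩
      · rintro ⟨h1, h2, h3⟩
        exact ⟨⟨h.not_par hc.1 h2 h3.symm, h.not_par hc.2 h2 h1.symm⟩, h2⟩
    rw [this, card_erase_of_mem, h.card_erase hc.1]
    simp only [mem_filter, mem_univ, true_and]
    exact ⟨hc.2, (h.ne_of_not_par hxy).symm⟩
  · intro z hz
    simp only [mem_filter, mem_univ, true_and] at hz
    obtain ⟨c, hc⟩ := h.exists_circle hxy hz.1 hz.2
    rw [card_eq_one]
    refine ⟨c, ?_⟩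
    ext d
    simp only [mem_bipartiteBelow, mem_filter, mem_univ, true_and, mem_singleton]
    constructor
    · rintro ⟨⟨h1, h2⟩, h3⟩
      exact h.unique_circle (h.ne_of_not_par hxy) (h.ne_of_not_par hz.1) (h.ne_of_not_par hz.2)
        h1 h2 h3 hc.1 hc.2.1 hc.2.2
    · rintro rfl
      exact ⟨⟨hc.1, hc.2.1⟩, hc.2.2⟩

/-- The number of circles through a point. -/
theorem card_through (h : IsCirclePlane q ρ inc par) (x : α) :
    #{c | inc c x} = q * (q + 1 - ρ) := by
  have h2 := h.two_lt
  have key := card_mul_eq_card_mul (s := ({c | inc c x} : Finset ι))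
    (t := ({z | ¬ par x z} : Finset α)) inc (m := q) (n := q + 1 - ρ) ?_ ?_
  · rw [h.card_not_par x] at key
    refine Nat.eq_of_mul_eq_mul_right (by omega : 0 < q) ?_
    rw [key]; ring
  · intro c hc
    simp only [mem_filter, mem_univ, true_and] at hc
    rw [← h.card_erase hc]
    congr 1
    ext z
    simp only [mem_bipartiteAbove, mem_filter, mem_univ, true_and]
    constructor
    · rintro ⟨h1, h2⟩
      exact ⟨h2, (h.ne_of_not_par h1).symm⟩
    · rintro ⟨h1, h2⟩
      exact ⟨h.not_par hc h1 h2.symm, h1⟩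
  · intro z hz
    simp only [mem_filter, mem_univ, true_and] at hz
    rw [← h.card_through₂ hz]
    congr 1
    ext d
    simp [mem_bipartiteBelow]

theorem common_le (h : IsCirclePlane q ρ inc par) {c d : ι} (hne : c ≠ d) :
    common inc c d ≤ 2 := by
  by_contra! hlt
  obtain ⟨x, y, z, hx, hy, hz, h1, h2, h3⟩ := two_lt_card_iff.1 hlt
  simp only [mem_filter, mem_univ, true_and] at hx hy hz
  exact hne (h.unique_circle h1 h2 h3 hx.1 hy.1 hz.1 hx.2 hy.2 hz.2)

theorem common_self (h : IsCirclePlane q ρ inc par) (c : ι) : common inc c c = q + 1 := by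
  simp only [common, and_self, h.card_circle]

theorem common_eq_one_iff (h : IsCirclePlane q ρ inc par) {x : α} {c d : ι} (hc : inc c x)
    (hd : inc d x) : common inc c d = 1 ↔ Touch inc x c d ∧ c ≠ d := by
  constructor
  · intro h1
    refine ⟨touch_of_common h1 hc hd, ?_⟩
    rintro rfl
    have := h.two_lt
    rw [h.common_self] at h1
    omega
  · rintro ⟨h1, h2⟩
    exact h1.common_eq_one h2

/-- The tangent circle at `x` to `c` through `y`. -/
theorem existsUnique_touch_of_not_inc (h : IsCirclePlane q ρ inc par) {c : ι} {x y : α}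
    (hx : inc c x) (hy : ¬ inc c y) (hxy : ¬ par x y) : ∃! d, inc d y ∧ Touch inc x c d := by
  have hq := h.two_lt
  have hρ := h.rho_le
  set A : Finset ι := {d | inc d x ∧ inc d y} with hA
  set B : Finset α := {z | inc c z ∧ ¬ par y z ∧ z ≠ x} with hB
  have hBc : #B = q - ρ := by
    have h1 := h.card_sub hy
    have : B = ({z | inc c z ∧ ¬ par y z} : Finset α).erase x := by
      ext z; simp [hB]; tauto
    rw [this, card_erase_of_mem, h1]
    · omega
    · simp only [mem_filter, mem_univ, true_and]
      exact ⟨hx, fun hp => hxy (h.symm hp)⟩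
  -- The circles through `x` and `y` that meet `c` again. They correspond to the q - ρ points of
  -- `B`, so exactly one of the q + 1 - ρ circles through `x` and `y` remains, and that one touches
  -- `c`.
  set B' : Finset ι := {d ∈ A | ∃ z ∈ B, inc d z} with hB'
  have key := card_mul_eq_card_mul (s := B') (t := B) inc (m := 1) (n := 1) ?_ ?_
  · have h1 : #(A \ B') = 1 := by
      rw [hBc, mul_one, mul_one] at key
      rw [card_sdiff_of_subset (filter_subset _ _), h.card_through₂ hxy, key]
      omega
    obtain ⟨d, hd⟩ := card_eq_one.1 h1
    have hmem : ∀ e, e ∈ A \ B' ↔ inc e y ∧ Touch inc x c e := by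
      intro e
      simp only [hA, hB', hB, mem_sdiff, mem_filter, mem_univ, true_and, not_and, not_exists]
      constructor
      · rintro ⟨⟨h1, h2⟩, h3⟩
        refine ⟨h2, hx, h1, Or.inr fun z hz hez => ?_⟩
        by_contra hne
        refine h3 ⟨h1, h2⟩ z ⟨hz, ?_, hne⟩ hez
        refine h.not_par h2 hez ?_
        rintro rfl
        exact hy hz
      · rintro ⟨h1, h2, h3, h4⟩
        refine ⟨⟨h3, h1⟩, fun _ z hz hez => ?_⟩
        rcases h4 with rfl | h4
        · exact hy h1
        · exact hz.2.2 (h4 z hz.1 hez)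
    refine ⟨d, (hmem d).1 (by simp [hd]), fun e he => ?_⟩
    have := (hmem e).2 he
    rwa [hd, mem_singleton] at this
  · intro d hd
    simp only [hB', hA, mem_filter, mem_univ, true_and] at hd
    obtain ⟨⟨h1, h2⟩, z, hz, hdz⟩ := hd
    rw [card_eq_one]
    refine ⟨z, ?_⟩
    ext z'
    simp only [hB, mem_filter, mem_univ, true_and] at hz
    simp only [mem_bipartiteAbove, hB, mem_filter, mem_univ, true_and, mem_singleton]
    constructor
    · rintro ⟨⟨h3, h4, h5⟩, h6⟩
      by_contra hne
      have := h.unique_circle h5 hne hz.2.2.symm h3 hx hz.1 h6 h1 hdz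
      exact hy (this ▸ h2)
    · rintro rfl
      exact ⟨hz, hdz⟩
  · intro z hz
    have hz' := hz
    simp only [hB, mem_filter, mem_univ, true_and] at hz
    have hxz := h.not_par hx hz.1 hz.2.2.symm
    obtain ⟨d, hd⟩ := h.exists_circle hxy hxz hz.2.1
    rw [card_eq_one]
    refine ⟨d, ?_⟩
    ext e
    simp only [mem_bipartiteBelow, hB', hA, mem_filter, mem_univ, true_and, mem_singleton]
    constructor
    · rintro ⟨⟨⟨h1, h2⟩, -⟩, h3⟩
      exact h.unique_circle (h.ne_of_not_par hxy) (h.ne_of_not_par hxz) (h.ne_of_not_par hz.2.1)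
        h1 h2 h3 hd.1 hd.2.1 hd.2.2
    · rintro rfl
      exact ⟨⟨⟨hd.1, hd.2.1⟩, z, hz', hd.2.2⟩, hd.2.2⟩

theorem existsUnique_touch (h : IsCirclePlane q ρ inc par) {c : ι} {x y : α}
    (hx : inc c x) (hxy : ¬ par x y) : ∃! d, inc d y ∧ Touch inc x c d := by
  by_cases hy : inc c y
  · refine ⟨c, ⟨hy, touch_self hx⟩, ?_⟩
    rintro d ⟨h1, -, -, h2⟩
    rcases h2 with rfl | h2
    · rfl
    · exact absurd (h2 y hy h1).symm (h.ne_of_not_par hxy)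
  · exact h.existsUnique_touch_of_not_inc hx hy hxy

/-- If `c` and `e` were different and shared another point z, both would be circles through z
touching `d` in `x`, against uniqueness. -/
theorem touch_trans (h : IsCirclePlane q ρ inc par) {x : α} {c d e : ι}
    (h1 : Touch inc x c d) (h2 : Touch inc x d e) : Touch inc x c e := by
  refine ⟨h1.1, h2.2.1, ?_⟩
  by_contra! hne
  obtain ⟨hne, z, hc, he, hz⟩ := hne
  exact hne ((h.existsUnique_touch h1.2.1 (h.not_par h1.1 hc hz.symm)).unique
    ⟨hc, h1.symm⟩ ⟨he, h2⟩)

/-- The number of circles touching a circle in a given point. -/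
theorem card_touch (h : IsCirclePlane q ρ inc par) {c : ι} {x : α} (hx : inc c x) :
    #{d | Touch inc x c d} = q := by
  have h2 := h.two_lt
  -- Each of the q² points not parallel to `x` lies on exactly one circle of the touching class, and
  -- each such circle has q of these points.
  have key := card_mul_eq_card_mul (s := ({d | Touch inc x c d} : Finset ι))
    (t := ({z | ¬ par x z} : Finset α)) inc (m := q) (n := 1) ?_ ?_
  · rw [h.card_not_par x] at key
    refine Nat.eq_of_mul_eq_mul_right (by omega : 0 < q) ?_
    rw [key]; ring
  · intro d hd
    simp only [mem_filter, mem_univ, true_and] at hd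
    rw [← h.card_erase hd.2.1]
    congr 1
    ext z
    simp only [mem_bipartiteAbove, mem_filter, mem_univ, true_and]
    constructor
    · rintro ⟨h1, h2⟩
      exact ⟨h2, (h.ne_of_not_par h1).symm⟩
    · rintro ⟨h1, h2⟩
      exact ⟨h.not_par hd.2.1 h1 h2.symm, h1⟩
  · intro z hz
    simp only [mem_filter, mem_univ, true_and] at hz
    obtain ⟨d, hd, hd'⟩ := h.existsUnique_touch hx hz
    rw [card_eq_one]
    refine ⟨d, ?_⟩
    ext e
    simp only [mem_bipartiteBelow, mem_filter, mem_univ, true_and, mem_singleton]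
    constructor
    · rintro ⟨h1, h2⟩
      exact hd' e ⟨h2, h1⟩
    · rintro rfl
      exact ⟨hd.2, hd.1⟩

/-- The number of circles through `y` tangent to a circle that does not contain `y`. -/
theorem card_tangent (h : IsCirclePlane q ρ inc par) {c : ι} {y : α} (hy : ¬ inc c y) :
    #{d | inc d y ∧ common inc d c = 1} = q + 1 - ρ := by
  -- The point of contact is a bijection from the tangents through `y` to the points of `c` not
  -- parallel to `y`.
  have key := card_mul_eq_card_mul (s := ({d | inc d y ∧ common inc d c = 1} : Finset ι))
    (t := ({z | inc c z ∧ ¬ par y z} : Finset α)) (fun d z => inc d z) (m := 1) (n := 1) ?_ ?_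
  · rw [h.card_sub hy] at key
    omega
  · intro d hd
    simp only [mem_filter, mem_univ, true_and] at hd
    rw [← hd.2, common]
    congr 1
    ext z
    simp only [mem_bipartiteAbove, mem_filter, mem_univ, true_and]
    constructor
    · rintro ⟨h1, h2⟩
      exact ⟨h2, h1.1⟩
    · rintro ⟨h1, h2⟩
      refine ⟨⟨h2, h.not_par hd.1 h1 ?_⟩, h1⟩
      rintro rfl
      exact hy h2
  · intro z hz
    simp only [mem_filter, mem_univ, true_and] at hz
    obtain ⟨d, hd, hd'⟩ := h.existsUnique_touch hz.1 fun hp => hz.2 (h.symm hp)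
    rw [card_eq_one]
    refine ⟨d, ?_⟩
    ext e
    simp only [mem_bipartiteBelow, mem_filter, mem_univ, true_and, mem_singleton]
    constructor
    · rintro ⟨⟨h1, h2⟩, h3⟩
      exact hd' e ⟨h1, (touch_of_common h2 h3 hz.1).symm⟩
    · rintro rfl
      refine ⟨⟨hd.1, hd.2.symm.common_eq_one ?_⟩, hd.2.2.1⟩
      rintro rfl
      exact hy hd.1

end IsCirclePlane

end CirclePlane

end CircleGeometry

namespace CircleGeometry

/-! ### Tangents to a circle within one touching class. -/

section Tangency

open Finset
open scoped Classical

namespace IsCirclePlane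

variable {α ι : Type*} [Fintype α] [Fintype ι] {q ρ : ℕ} {inc : ι → α → Prop} {par : α → α → Prop}

theorem touch_class_eq (h : IsCirclePlane q ρ inc par) {x : α} {c d : ι} (hcd : Touch inc x c d)
    (e : ι) : Touch inc x c e ↔ Touch inc x d e :=
  ⟨fun h1 => h.touch_trans hcd.symm h1, fun h1 => h.touch_trans hcd h1⟩

/-- The circles touching `c` in `y` partition the points not parallel to `y`. -/
theorem card_touch_tangent_mod_two (h : IsCirclePlane q ρ inc par) {c d : ι} {y : α}
    (hc : inc c y) (hd : ¬ inc d y) :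
    #{e | Touch inc y c e ∧ common inc e d = 1} % 2 = (q + 1 - ρ) % 2 := by
  have h1 : ∑ e ∈ ({e | Touch inc y c e} : Finset ι), common inc e d = q + 1 - ρ := by
    have key := sum_card_bipartiteAbove_eq_sum_card_bipartiteBelow
      (s := ({e | Touch inc y c e} : Finset ι)) (t := ({z | inc d z ∧ ¬ par y z} : Finset α)) inc
    have h2 : ∀ z ∈ ({z | inc d z ∧ ¬ par y z} : Finset α),
        #(bipartiteBelow inc ({e | Touch inc y c e} : Finset ι) z) = 1 := by
      intro z hz
      simp only [mem_filter, mem_univ, true_and] at hz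
      obtain ⟨e, he, he'⟩ := h.existsUnique_touch hc hz.2
      rw [card_eq_one]
      refine ⟨e, ?_⟩
      ext e'
      simp only [mem_bipartiteBelow, mem_filter, mem_univ, true_and, mem_singleton]
      constructor
      · rintro ⟨h1, h2⟩
        exact he' e' ⟨h2, h1⟩
      · rintro rfl
        exact ⟨he.2, he.1⟩
    rw [sum_congr rfl h2, sum_const, h.card_sub hd, smul_eq_mul, mul_one] at key
    rw [← key]
    refine sum_congr rfl fun e he => ?_
    simp only [mem_filter, mem_univ, true_and] at he
    rw [common]
    congr 1
    ext z
    simp only [mem_bipartiteAbove, mem_filter, mem_univ, true_and]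
    constructor
    · rintro ⟨h1, h2⟩
      refine ⟨⟨h2, h.not_par he.2.1 h1 ?_⟩, h1⟩
      rintro rfl
      exact hd h2
    · rintro ⟨h1, h2⟩
      exact ⟨h2, h1.1⟩
  -- Each member of the class meets `d` in at most two points, so only the tangents contribute to
  -- the parity.
  rw [← h1, sum_mod_two, filter_filter]
  intro e he
  simp only [mem_filter, mem_univ, true_and] at he
  refine h.common_le ?_
  rintro rfl
  exact hd he.2.1

/-- Each of the q + 1 - ρ tangents to `d` through `y` is counted once for each of the q members of
its touching class. Since the total is also the number of circles through `y`, the average count is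
one. -/
theorem sum_card_touch_tangent (h : IsCirclePlane q ρ inc par) {d : ι} {y : α} (hd : ¬ inc d y) :
    ∑ c ∈ ({c | inc c y} : Finset ι), #{e | Touch inc y c e ∧ common inc e d = 1}
      = q * (q + 1 - ρ) := by
  have key := sum_card_bipartiteAbove_eq_sum_card_bipartiteBelow
    (s := ({c | inc c y} : Finset ι)) (t := ({e | inc e y ∧ common inc e d = 1} : Finset ι))
    (fun c e => Touch inc y c e)
  have h2 : ∀ e ∈ ({e | inc e y ∧ common inc e d = 1} : Finset ι),
      #(bipartiteBelow (fun c e => Touch inc y c e) ({c | inc c y} : Finset ι) e) = q := by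
    intro e he
    simp only [mem_filter, mem_univ, true_and] at he
    rw [← h.card_touch he.1]
    congr 1
    ext c
    simp only [mem_bipartiteBelow, mem_filter, mem_univ, true_and]
    exact ⟨fun h1 => h1.2.symm, fun h1 => ⟨h1.2.1, h1.symm⟩⟩
  rw [sum_congr rfl h2, sum_const, h.card_tangent hd, smul_eq_mul, mul_comm] at key
  rw [← key]
  refine sum_congr rfl fun c hc => ?_
  congr 1
  ext e
  simp only [mem_bipartiteAbove, mem_filter, mem_univ, true_and]
  exact ⟨fun h1 => ⟨⟨h1.1.2.1, h1.2⟩, h1.1⟩, fun h1 => ⟨h1.2, h1.1.2⟩⟩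

/-- Odd parity makes every count at least one, and the average is one. -/
theorem card_touch_tangent_of_odd (h : IsCirclePlane q ρ inc par) (hr : Odd (q + 1 - ρ)) {c d : ι}
    {y : α} (hc : inc c y) (hd : ¬ inc d y) :
    #{e | Touch inc y c e ∧ common inc e d = 1} = 1 := by
  have h1 : ∀ c ∈ ({c | inc c y} : Finset ι),
      1 ≤ #{e | Touch inc y c e ∧ common inc e d = 1} := by
    intro c hc
    simp only [mem_filter, mem_univ, true_and] at hc
    have := h.card_touch_tangent_mod_two hc hd
    rw [Nat.odd_iff] at hr
    omega
  have h2 := h.sum_card_touch_tangent hd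
  rw [← h.card_through y, card_eq_sum_ones] at h2
  exact ((sum_eq_sum_iff_of_le h1).1 h2.symm c (by simpa using hc)).symm

/-- Let e be one such tangent, with contact point z. For a point Q of e other than y and z, with few
exceptions, q + 1 - 2ρ points of d are parallel to neither y nor Q. The circles through y and Q
partition these points; their number is even, so the number of tangents to d among these circles is
even. As e is one of them, there is another. The circles so obtained lie outside the class of e and
differ for different Q. With at most ρ(ρ - 1) exceptions, at least q - 1 - ρ(ρ - 1) of the q + 1 - ρ
tangents through y lie outside the class, which leaves at most two when ρ is 0 or 2. -/
theorem card_touch_tangent_le_two (h : IsCirclePlane q ρ inc par) (hq : Odd q) (hρ : Even ρ)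
    {c d : ι} {y : α} (hc : inc c y) (hd : ¬ inc d y) :
    #{e | Touch inc y c e ∧ common inc e d = 1} ≤ 2 := by
  rcases Finset.eq_empty_or_nonempty ({e | Touch inc y c e ∧ common inc e d = 1} : Finset ι)
    with h0 | ⟨e, he⟩
  · simp [h0]
  simp only [mem_filter, mem_univ, true_and] at he
  have hρ2 := h.rho_le
  have hq2 := h.two_lt
  simp only [h.touch_class_eq he.1]
  obtain ⟨hce, hed⟩ := he
  obtain ⟨z, hz, hz'⟩ := exists_touch_of_common hed
  have hey : inc e y := hce.2.1
  have hzy : z ≠ y := by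
    rintro rfl
    exact hd hz.2.1
  set R : Finset ι := {f | inc f y ∧ common inc f d = 1} with hR
  set W : Finset α := {w | inc d w ∧ par y w} with hW
  have hWc : #W = ρ := h.card_par hd
  set E : Finset α := ({w | inc e w} : Finset α) \ {y, z} with hE
  have hEc : #E = q - 1 := by
    rw [hE, card_sdiff_of_subset, h.card_circle, card_pair hzy.symm]
    · omega
    · intro w hw
      simp only [mem_insert, mem_singleton] at hw
      rcases hw with rfl | rfl
      · simpa using hey
      · simpa using hz.1
  -- The exceptional points: some point of `d` is parallel to both `y` and `Q`, so the two sets of ρ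
  -- points of `d` parallel to `y` and to `Q` overlap.
  set B : Finset α := {Q ∈ E | ∃ w ∈ W, par w Q} with hB
  set G : Finset α := {Q ∈ E | ¬ ∃ w ∈ W, par w Q} with hG
  have hBG : #B + #G = q - 1 := by
    rw [← hEc]
    exact card_filter_add_card_filter_not _
  have hBc : #B ≤ ρ * (ρ - 1) := by
    have hsub : B ⊆ W.biUnion fun w => ({Q | inc e Q ∧ par w Q} : Finset α).erase y := by
      intro Q hQ
      simp only [hB, hE, mem_filter, mem_sdiff, mem_univ, true_and, mem_insert,
        mem_singleton, not_or] at hQ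
      obtain ⟨⟨h1, h2⟩, w, hw, hwQ⟩ := hQ
      exact mem_biUnion.2 ⟨w, hw, by simp [h1, h2.1, hwQ]⟩
    refine (card_le_card hsub).trans ((card_biUnion_le_card_mul _ _ (ρ - 1) ?_).trans_eq ?_)
    · intro w hw
      simp only [hW, mem_filter, mem_univ, true_and] at hw
      have hew : ¬ inc e w := by
        intro hew
        have := h.eq_of_par hey hew hw.2
        subst this
        exact hd hw.1
      rw [card_erase_of_mem, h.card_par hew]
      simpa using ⟨hey, h.symm hw.2⟩
    · rw [hWc]
  have hGR : #G ≤ #{f ∈ R | ¬ Touch inc y e f} := by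
    have hex : ∀ Q ∈ G, ∃ f, f ∈ R ∧ ¬ Touch inc y e f ∧ inc f Q := by
      intro Q hQ
      simp only [hG, hE, mem_filter, mem_sdiff, mem_univ, true_and, mem_insert,
        mem_singleton, not_or, not_exists, not_and] at hQ
      obtain ⟨⟨heQ, hQy, hQz⟩, hQW⟩ := hQ
      have hdQ : ¬ inc d Q := fun hdQ => hQz (hz' Q heQ hdQ)
      have hyQ : ¬ par y Q := h.not_par hey heQ (Ne.symm hQy)
      set V : Finset α := {v | inc d v ∧ ¬ par y v ∧ ¬ par Q v} with hV
      have hVc : #V + 2 * ρ = q + 1 := by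
        have h1 := h.card_sub hd
        have h2 := h.card_par hdQ
        rw [← card_filter_add_card_filter_not (s := {z | inc d z ∧ ¬ par y z})
          (fun z => par Q z), filter_filter, filter_filter] at h1
        have h3 : #{a | (inc d a ∧ ¬ par y a) ∧ par Q a} = ρ := by
          rw [← h2]
          congr 1
          ext a
          simp only [mem_filter, mem_univ, true_and]
          constructor
          · rintro ⟨⟨h1, h2⟩, h3⟩
            exact ⟨h1, h3⟩
          · rintro ⟨h1, h3⟩
            refine ⟨⟨h1, fun h4 => hQW a ?_ (h.symm h3)⟩, h3⟩
            simpa [hW] using ⟨h1, h4⟩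
        rw [h3] at h1
        simp only [hV, ← and_assoc]
        omega
      have hsum : ∑ f ∈ ({f | inc f y ∧ inc f Q} : Finset ι), common inc f d = #V := by
        have key := sum_card_bipartiteAbove_eq_sum_card_bipartiteBelow
          (s := ({f | inc f y ∧ inc f Q} : Finset ι)) (t := V) inc
        have h2 : ∀ v ∈ V,
            #(bipartiteBelow inc ({f | inc f y ∧ inc f Q} : Finset ι) v) = 1 := by
          intro v hv
          simp only [hV, mem_filter, mem_univ, true_and] at hv
          obtain ⟨f, hf⟩ := h.exists_circle hyQ hv.2.1 hv.2.2
          rw [card_eq_one]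
          refine ⟨f, ?_⟩
          ext f'
          simp only [mem_bipartiteBelow, mem_filter, mem_univ, true_and, mem_singleton]
          constructor
          · rintro ⟨⟨h1, h2⟩, h3⟩
            exact h.unique_circle (Ne.symm hQy) (h.ne_of_not_par hv.2.1)
              (h.ne_of_not_par hv.2.2) h1 h2 h3 hf.1 hf.2.1 hf.2.2
          · rintro rfl
            exact ⟨⟨hf.1, hf.2.1⟩, hf.2.2⟩
        rw [sum_congr rfl h2, ← card_eq_sum_ones] at key
        rw [← key]
        refine sum_congr rfl fun f hf => ?_
        simp only [mem_filter, mem_univ, true_and] at hf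
        rw [common]
        congr 1
        ext v
        simp only [hV, mem_bipartiteAbove, mem_filter, mem_univ, true_and]
        constructor
        · rintro ⟨h1, h2⟩
          refine ⟨⟨h2, h.not_par hf.1 h1 ?_, h.not_par hf.2 h1 ?_⟩, h1⟩
          · rintro rfl
            exact hd h2
          · rintro rfl
            exact hdQ h2
        · rintro ⟨h1, h2⟩
          exact ⟨h2, h1.1⟩
      have hmod := sum_mod_two ({f | inc f y ∧ inc f Q} : Finset ι) (fun f => common inc f d) ?_
      · rw [hsum, filter_filter] at hmod
        have heven : #{f | (inc f y ∧ inc f Q) ∧ common inc f d = 1} % 2 = 0 := by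
          obtain ⟨a, ha⟩ := hq
          omega
        have hemem : e ∈ ({f | (inc f y ∧ inc f Q) ∧ common inc f d = 1} : Finset ι) := by
          simpa using ⟨⟨hey, heQ⟩, hed⟩
        have hpos : 0 < #{f | (inc f y ∧ inc f Q) ∧ common inc f d = 1} := card_pos.2 ⟨e, hemem⟩
        obtain ⟨f, hf, hfe⟩ := exists_mem_ne
          (show 1 < #{f | (inc f y ∧ inc f Q) ∧ common inc f d = 1} by omega) e
        simp only [mem_filter, mem_univ, true_and] at hf
        refine ⟨f, by simpa [hR] using ⟨hf.1.1, hf.2⟩, ?_, hf.1.2⟩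
        rintro ⟨-, -, h1 | h1⟩
        · exact hfe h1.symm
        · exact hQy (h1 Q heQ hf.1.2)
      · intro f hf
        simp only [mem_filter, mem_univ, true_and] at hf
        refine h.common_le ?_
        rintro rfl
        exact hd hf.1
    have : Nonempty ι := ⟨e⟩
    choose! F hF1 hF2 hF3 using hex
    refine card_le_card_of_injOn F (fun Q hQ => ?_) fun Q hQ Q' hQ' heq => ?_
    · simpa using ⟨hF1 Q hQ, hF2 Q hQ⟩
    · by_contra hne
      have hQm := hQ
      have hQm' := hQ'
      simp only [hG, hE, coe_filter, mem_sdiff, mem_filter, mem_univ, true_and, mem_insert,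
        mem_singleton, not_or, Set.mem_ofPred_eq] at hQ hQ'
      have hfy : inc (F Q) y := by
        have := hF1 Q hQm
        simp only [hR, mem_filter, mem_univ, true_and] at this
        exact this.1
      have h4 := hF3 Q' hQm'
      rw [← heq] at h4
      have h5 := h.unique_circle (Ne.symm hQ.1.2.1) (Ne.symm hQ'.1.2.1) hne hey hQ.1.1 hQ'.1.1
        hfy (hF3 Q hQm) h4
      exact hF2 Q hQm (h5 ▸ touch_self hey)
  have hRc : #R = q + 1 - ρ := h.card_tangent hd
  rw [← card_filter_add_card_filter_not (fun f => Touch inc y e f)] at hRc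
  have hRt : ({f ∈ R | Touch inc y e f} : Finset ι)
      = ({f | Touch inc y e f ∧ common inc f d = 1} : Finset ι) := by
    ext f
    simp only [hR, mem_filter, mem_univ, true_and]
    exact ⟨fun h1 => ⟨h1.2, h1.1.2⟩, fun h1 => ⟨⟨h1.1.2.1, h1.2⟩, h1.1⟩⟩
  rw [hRt] at hRc
  interval_cases ρ
  · omega
  · simp at hρ
  · omega

end IsCirclePlane

end Tangency

end CircleGeometry

namespace CircleGeometry

/-! ### Counting circles tangent to two circles; types of circles. -/

section Counts

open Finset
open scoped Classical

namespace IsCirclePlane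

variable {α ι : Type*} [Fintype α] [Fintype ι] {q ρ : ℕ} {inc : ι → α → Prop} {par : α → α → Prop}

/-- The number of circles that avoid `P` and are tangent to `c` and to `d`. -/
noncomputable def bitangent (inc : ι → α → Prop) (P : α) (c d : ι) : ℕ :=
  #{e | ¬ inc e P ∧ common inc e c = 1 ∧ common inc e d = 1}

theorem card_not_through (h : IsCirclePlane q ρ inc par) (P : α) :
    #{d | ¬ inc d P} = q ^ 2 * (q - 1) := by
  have h2 := h.two_lt
  have hρ := h.rho_le
  have key := card_mul_eq_card_mul (s := ({d | ¬ inc d P} : Finset ι))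
    (t := ({z | ¬ par P z} : Finset α)) inc (m := q + 1 - ρ) (n := (q - 1) * (q + 1 - ρ)) ?_ ?_
  · rw [h.card_not_par P] at key
    refine Nat.eq_of_mul_eq_mul_right (by omega : 0 < q + 1 - ρ) ?_
    rw [key]; ring
  · intro d hd
    simp only [mem_filter, mem_univ, true_and] at hd
    rw [← h.card_sub hd]
    congr 1
    ext z
    simp only [mem_bipartiteAbove, mem_filter, mem_univ, true_and, and_comm]
  · intro z hz
    simp only [mem_filter, mem_univ, true_and] at hz
    have h1 := h.card_through z
    rw [← card_filter_add_card_filter_not (s := {c | inc c z}) (fun c => inc c P), filter_filter,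
      filter_filter, h.card_through₂ (fun hp => hz (h.symm hp))] at h1
    have h3 : bipartiteBelow inc ({d | ¬ inc d P} : Finset ι) z
        = ({c | inc c z ∧ ¬ inc c P} : Finset ι) := by
      ext z
      simp only [mem_bipartiteBelow, mem_filter, mem_univ, true_and, and_comm]
    rw [h3, tsub_mul, one_mul]
    omega

theorem card_through_not (h : IsCirclePlane q ρ inc par) {x P : α} (hx : ¬ par x P) :
    #{d | inc d x ∧ ¬ inc d P} = (q - 1) * (q + 1 - ρ) := by
  have h1 := h.card_through x
  rw [← card_filter_add_card_filter_not (s := {c | inc c x}) (fun c => inc c P), filter_filter,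
      filter_filter, h.card_through₂ hx] at h1
  rw [tsub_mul, one_mul]
  omega

theorem card_through₂_not (h : IsCirclePlane q ρ inc par) {x y P : α} (hxy : ¬ par x y)
    (hx : ¬ par x P) (hy : ¬ par y P) : #{d | inc d x ∧ inc d y ∧ ¬ inc d P} = q - ρ := by
  have h1 := h.card_through₂ hxy
  obtain ⟨c, hc⟩ := h.exists_circle hxy hx hy
  have h2 : #{d | (inc d x ∧ inc d y) ∧ inc d P} = 1 := by
    rw [card_eq_one]
    refine ⟨c, ?_⟩
    ext d
    simp only [mem_filter, mem_univ, true_and, mem_singleton]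
    constructor
    · rintro ⟨⟨h1, h2⟩, h3⟩
      exact h.unique_circle (h.ne_of_not_par hxy) (h.ne_of_not_par hx) (h.ne_of_not_par hy)
        h1 h2 h3 hc.1 hc.2.1 hc.2.2
    · rintro rfl
      exact ⟨⟨hc.1, hc.2.1⟩, hc.2.2⟩
  rw [← card_filter_add_card_filter_not (s := {c | inc c x ∧ inc c y}) (fun c => inc c P),
      filter_filter, filter_filter, h2] at h1
  simp only [and_assoc] at h1
  omega

theorem card_touch_ne (h : IsCirclePlane q ρ inc par) {c : ι} {x : α} (hx : inc c x) :
    #{d | Touch inc x c d ∧ d ≠ c} = q - 1 := by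
  have h1 : ({d | Touch inc x c d ∧ d ≠ c} : Finset ι)
      = ({d | Touch inc x c d} : Finset ι).erase c := by
    ext d; simp [and_comm]
  rw [h1, card_erase_of_mem (by simpa using touch_self hx), h.card_touch hx]

/-- The tangents are sorted by their point of contact with `c`, which differs from `P` because they
avoid `P`. -/
theorem bitangent_eq_sum (h : IsCirclePlane q ρ inc par) {P : α} {c : ι} (hc : inc c P) (d : ι) :
    bitangent inc P c d = ∑ y ∈ ({y | inc c y ∧ y ≠ P} : Finset α),
      #{e | Touch inc y c e ∧ e ≠ c ∧ common inc e d = 1} := by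
  have key := sum_card_bipartiteAbove_eq_sum_card_bipartiteBelow
    (s := ({y | inc c y ∧ y ≠ P} : Finset α))
    (t := ({e | ¬ inc e P ∧ common inc e c = 1 ∧ common inc e d = 1} : Finset ι))
    (fun y e => inc e y)
  have h2 : ∀ e ∈ ({e | ¬ inc e P ∧ common inc e c = 1 ∧ common inc e d = 1} : Finset ι),
      #(bipartiteBelow (fun y e => inc e y) ({y | inc c y ∧ y ≠ P} : Finset α) e) = 1 := by
    intro e he
    simp only [mem_filter, mem_univ, true_and] at he
    rw [← he.2.1, common]
    congr 1
    ext y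
    simp only [mem_bipartiteBelow, mem_filter, mem_univ, true_and]
    constructor
    · rintro ⟨⟨h1, h2⟩, h3⟩
      exact ⟨h3, h1⟩
    · rintro ⟨h1, h2⟩
      refine ⟨⟨h2, ?_⟩, h1⟩
      rintro rfl
      exact he.1 h1
  rw [sum_congr rfl h2, ← card_eq_sum_ones] at key
  rw [bitangent, ← key]
  refine sum_congr rfl fun y hy => ?_
  simp only [mem_filter, mem_univ, true_and] at hy
  congr 1
  ext e
  simp only [mem_bipartiteAbove, mem_filter, mem_univ, true_and]
  constructor
  · rintro ⟨⟨h1, h2, h3⟩, h4⟩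
    obtain ⟨h5, h6⟩ := (h.common_eq_one_iff h4 hy.1).1 h2
    exact ⟨h5.symm, h6, h3⟩
  · rintro ⟨h1, h2, h3⟩
    exact ⟨⟨fun h4 => hy.2 ((h1.2.2.resolve_left (Ne.symm h2)) P hc h4).symm,
      h1.symm.common_eq_one h2, h3⟩, h1.2.1⟩

theorem bitangent_self (h : IsCirclePlane q ρ inc par) {P : α} {c : ι} (hc : inc c P) :
    bitangent inc P c c = q * (q - 1) := by
  rw [h.bitangent_eq_sum hc, sum_congr rfl (g := fun _ => q - 1), sum_const, h.card_erase hc,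
    smul_eq_mul]
  intro y hy
  simp only [mem_filter, mem_univ, true_and] at hy
  rw [← h.card_touch_ne hy.1]
  congr 1
  ext e
  simp only [mem_filter, mem_univ, true_and]
  exact ⟨fun h1 => ⟨h1.1, h1.2.1⟩, fun h1 => ⟨h1.1, h1.2, h1.1.symm.common_eq_one h1.2⟩⟩

theorem card_touch_ne_tangent {c d : ι} {y : α} (hc : inc c y) :
    #{e | Touch inc y c e ∧ e ≠ c ∧ common inc e d = 1} + (if common inc c d = 1 then 1 else 0)
      = #{e | Touch inc y c e ∧ common inc e d = 1} := by
  have h1 : ({e | Touch inc y c e ∧ e ≠ c ∧ common inc e d = 1} : Finset ι)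
      = ({e | Touch inc y c e ∧ common inc e d = 1} : Finset ι).erase c := by
    ext e; simp; tauto
  rw [h1]
  split_ifs with h2
  · exact card_erase_add_one (by simpa using ⟨touch_self hc, h2⟩)
  · rw [erase_eq_of_notMem (by simp [h2])]; rfl

/-- If the number of tangents in each touching class is constant, so is `bitangent`. -/
theorem bitangent_of_touch (h : IsCirclePlane q ρ inc par) {P : α} {c d : ι}
    (hcd : Touch inc P c d) (hne : c ≠ d) (k : ℕ)
    (hk : ∀ y, inc c y → ¬ inc d y → #{e | Touch inc y c e ∧ common inc e d = 1} = k + 1) :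
    bitangent inc P c d = q * k := by
  rw [h.bitangent_eq_sum hcd.1, sum_congr rfl (g := fun _ => k), sum_const, h.card_erase hcd.1,
    smul_eq_mul]
  intro y hy
  simp only [mem_filter, mem_univ, true_and] at hy
  -- Here `c` itself is tangent to `d` and is among the k + 1 circles of its class; it must not be
  -- counted.
  have h1 := card_touch_ne_tangent (d := d) hy.1
  rw [if_pos (hcd.common_eq_one hne), hk y hy.1] at h1
  · omega
  · intro hdy
    exact hy.2 (hcd.2.2.resolve_left hne y hy.1 hdy)

/-- The second common point of `c` and `d` contributes nothing, since a circle touching both there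
would make them touch each other. Each of the q - 1 other points contributes `k`, because `c` is not
tangent to `d`. -/
theorem bitangent_of_not_touch (h : IsCirclePlane q ρ inc par) {P : α} {c d : ι}
    (hc : inc c P) (hd : inc d P) (hcd : ¬ Touch inc P c d) (k : ℕ)
    (hk : ∀ y, inc c y → ¬ inc d y → #{e | Touch inc y c e ∧ common inc e d = 1} = k) :
    bitangent inc P c d = (q - 1) * k := by
  have hne : c ≠ d := by
    rintro rfl
    exact hcd (touch_self hc)
  obtain ⟨z, hz, hz', hzP⟩ : ∃ z, inc c z ∧ inc d z ∧ z ≠ P := by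
    by_contra! h1
    exact hcd ⟨hc, hd, Or.inr h1⟩
  have h0 : common inc c d ≠ 1 := fun h1 => hcd (touch_of_common h1 hc hd)
  have hzmem : z ∈ ({y | inc c y ∧ y ≠ P} : Finset α) := by simpa using ⟨hz, hzP⟩
  rw [h.bitangent_eq_sum hc, ← add_sum_erase _ _ hzmem]
  have h1 : #{e | Touch inc z c e ∧ e ≠ c ∧ common inc e d = 1} = 0 := by
    rw [card_eq_zero, filter_eq_empty_iff]
    rintro e - ⟨h1, h2, h3⟩
    have h4 := h.touch_trans h1 (touch_of_common h3 h1.2.1 hz')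
    exact h0 (h4.common_eq_one hne)
  rw [h1, sum_congr rfl (g := fun _ => k), sum_const, card_erase_of_mem hzmem, h.card_erase hc,
    smul_eq_mul, zero_add]
  intro y hy
  simp only [mem_erase, mem_filter, mem_univ, true_and] at hy
  have h2 := card_touch_ne_tangent (d := d) hy.2.1
  rw [if_neg h0, hk y hy.2.1] at h2
  · omega
  · intro hdy
    exact hne (h.unique_circle hzP.symm hy.2.2.symm hy.1.symm hc hz hy.2.1 hd hz' hdy)

/-- The value is q(q - 1) on the diagonal and q - 1 for pairs that do not touch; it is 0 for
distinct touching pairs, where `c` is the only tangent to `d` in each of its classes. -/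
theorem bitangent_of_odd (h : IsCirclePlane q ρ inc par) (hr : Odd (q + 1 - ρ)) {P : α} {c d : ι}
    (hc : inc c P) (hd : inc d P) :
    (bitangent inc P c d : ℝ) = q * (q - 1) * (if c = d then 1 else 0)
      + (q - 1) * (1 - (if Touch inc P c d then 1 else 0)) := by
  have hq := h.two_lt
  have hq1 : ((q - 1 : ℕ) : ℝ) = (q : ℝ) - 1 := by rw [Nat.cast_sub (by omega)]; simp
  by_cases hcd : c = d
  · subst hcd
    rw [h.bitangent_self hc, if_pos rfl, if_pos (touch_self hc)]
    push_cast [hq1]; ring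
  by_cases ht : Touch inc P c d
  · rw [h.bitangent_of_touch ht hcd 0 fun y hy hy' => h.card_touch_tangent_of_odd hr hy hy',
      if_neg hcd, if_pos ht]
    simp
  · rw [h.bitangent_of_not_touch hc hd ht 1 fun y hy hy' => h.card_touch_tangent_of_odd hr hy hy',
      if_neg hcd, if_neg ht]
    push_cast [hq1]; ring

end IsCirclePlane

/-- A division of the circles into two nonempty types such that tangent circles have the same
type. -/
structure IsTyping {α ι : Type*} [Fintype α] (inc : ι → α → Prop) (ty : ι → Prop) : Prop where
  tangent : ∀ c d, common inc c d = 1 → (ty c ↔ ty d)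
  exists_type : ∃ c, ty c
  exists_not_type : ∃ c, ¬ ty c

theorem IsTyping.not {α ι : Type*} [Fintype α] {inc : ι → α → Prop} {ty : ι → Prop}
    (ht : IsTyping inc ty) :
    IsTyping inc fun c => ¬ ty c :=
  ⟨fun c d hcd => not_congr (ht.tangent c d hcd), ht.exists_not_type, by
    simpa using ht.exists_type⟩

theorem IsTyping.touch {α ι : Type*} [Fintype α] {inc : ι → α → Prop} {ty : ι → Prop}
    (ht : IsTyping inc ty) {x : α} {c d : ι}
    (hcd : Touch inc x c d) : ty c ↔ ty d := by
  by_cases hne : c = d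
  · rw [hne]
  · exact ht.tangent c d (hcd.common_eq_one hne)

namespace IsCirclePlane

variable {α ι : Type*} [Fintype α] [Fintype ι] {q ρ : ℕ} {inc : ι → α → Prop} {par : α → α → Prop}
  {ty : ι → Prop}

/-- If a circle of the given type passes through `y`, a circle touching it in another point has the
same type and misses `y`. -/
theorem exists_type_not_inc (h : IsCirclePlane q ρ inc par) (ht : IsTyping inc ty) (y : α) :
    ∃ d, ty d ∧ ¬ inc d y := by
  obtain ⟨c, hc⟩ := ht.exists_type
  have hq := h.two_lt
  by_cases hcy : inc c y
  · obtain ⟨z, hz⟩ := card_pos.1 (show 0 < #{z | inc c z ∧ z ≠ y} by rw [h.card_erase hcy]; omega)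
    simp only [mem_filter, mem_univ, true_and] at hz
    obtain ⟨d, hd⟩ := card_pos.1 (show 0 < #{d | Touch inc z c d ∧ d ≠ c} by
      rw [h.card_touch_ne hz.1]; omega)
    simp only [mem_filter, mem_univ, true_and] at hd
    refine ⟨d, (ht.touch hd.1).1 hc, fun hdy => ?_⟩
    exact hz.2 (hd.1.2.2.resolve_left hd.2.symm y hcy hdy).symm
  · exact ⟨c, hc, hcy⟩

theorem card_touch_tangent_eq (h : IsCirclePlane q ρ inc par) (hq : Odd q) (hρ : Even ρ)
    {c d : ι} {y : α} (hc : inc c y) (hd : ¬ inc d y) :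
    #{e | Touch inc y c e ∧ common inc e d = 1} = 0 ∨
      #{e | Touch inc y c e ∧ common inc e d = 1} = 2 := by
  have h1 := h.card_touch_tangent_mod_two hc hd
  have h2 := h.card_touch_tangent_le_two hq hρ hc hd
  have h3 := h.rho_le
  have h4 := h.two_lt
  obtain ⟨a, ha⟩ := hq
  obtain ⟨b, hb⟩ := hρ
  omega

/-- All counts are 0 or 2 with average one, so the nonzero ones belong to exactly half of the
circles through `y`. A nonzero count links `c` to `d` by two tangencies, so these circles have the
type of `d`. -/
theorem card_type_ge (h : IsCirclePlane q ρ inc par) (hq : Odd q) (hρ : Even ρ)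
    (ht : IsTyping inc ty) {d : ι} {y : α} (hd : ¬ inc d y) (hdt : ty d) :
    2 * #{c | inc c y ∧ #{e | Touch inc y c e ∧ common inc e d = 1} ≠ 0} = q * (q + 1 - ρ) ∧
    ({c | inc c y ∧ #{e | Touch inc y c e ∧ common inc e d = 1} ≠ 0} : Finset ι) ⊆
      ({c | inc c y ∧ ty c} : Finset ι) := by
  constructor
  · rw [← h.sum_card_touch_tangent hd, ← filter_filter, card_filter, mul_sum]
    refine sum_congr rfl fun c hc => ?_
    simp only [mem_filter, mem_univ, true_and] at hc
    rcases h.card_touch_tangent_eq hq hρ hc hd with h1 | h1 <;> simp [h1]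
  · intro c hc
    simp only [mem_filter, mem_univ, true_and] at hc ⊢
    refine ⟨hc.1, ?_⟩
    obtain ⟨e, he⟩ := card_pos.1 (Nat.pos_of_ne_zero hc.2)
    simp only [mem_filter, mem_univ, true_and] at he
    rw [ht.touch he.1, ht.tangent e d he.2]
    exact hdt

/-- Half of the circles through a point have a given type. -/
theorem card_type (h : IsCirclePlane q ρ inc par) (hq : Odd q) (hρ : Even ρ)
    (ht : IsTyping inc ty) (y : α) : 2 * #{c | inc c y ∧ ty c} = q * (q + 1 - ρ) := by
  -- Each of the two types accounts for at least half of the circles through `y`, hence for exactly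
  -- half.
  obtain ⟨d, hd, hdy⟩ := h.exists_type_not_inc ht y
  obtain ⟨d', hd', hdy'⟩ := h.exists_type_not_inc ht.not y
  obtain ⟨h1, h2⟩ := h.card_type_ge hq hρ ht hdy hd
  obtain ⟨h3, h4⟩ := h.card_type_ge hq hρ ht.not hdy' hd'
  have h5 := h.card_through y
  rw [← card_filter_add_card_filter_not (s := {c | inc c y}) (fun c => ty c), filter_filter,
    filter_filter] at h5
  have h6 := card_le_card h2
  have h7 : #{c | inc c y ∧ #{e | Touch inc y c e ∧ common inc e d' = 1} ≠ 0}
      ≤ #{c | inc c y ∧ ¬ ty c} := by convert card_le_card h4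
  have h8 : #{c | inc c y ∧ ty c} + #{c | inc c y ∧ ¬ ty c} = q * (q + 1 - ρ) := by convert h5
  omega

/-- The circles with nonzero count lie among those with the type of `d`, and both sets make up half
of the circles through `y`; so they coincide. -/
theorem card_touch_tangent_of_type (h : IsCirclePlane q ρ inc par) (hq : Odd q) (hρ : Even ρ)
    (ht : IsTyping inc ty) {c d : ι} {y : α} (hc : inc c y) (hd : ¬ inc d y) :
    #{e | Touch inc y c e ∧ common inc e d = 1} = if ty c ↔ ty d then 2 else 0 := by
  wlog hdt : ty d generalizing ty
  · rw [this ht.not hdt]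
    simp only [not_iff_not]
  obtain ⟨h1, h2⟩ := h.card_type_ge hq hρ ht hd hdt
  have h3 := eq_of_subset_of_card_le h2 (by have := h.card_type hq hρ ht y; omega)
  have h4 : c ∈ ({c | inc c y ∧ #{e | Touch inc y c e ∧ common inc e d = 1} ≠ 0} : Finset ι) ↔
    c ∈ ({c | inc c y ∧ ty c} : Finset ι) := by rw [h3]
  simp only [mem_filter, mem_univ, true_and, hc] at h4
  simp only [hdt, iff_true]
  split_ifs with h5
  · exact (h.card_touch_tangent_eq hq hρ hc hd).resolve_left (h4.2 h5)
  · by_contra h6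
    exact h5 (h4.1 h6)

/-- The right side encodes four values: q(q - 1) for equal circles, q for distinct touching ones,
2(q - 1) for circles of one type that do not touch, and 0 for different types. -/
theorem bitangent_of_type (h : IsCirclePlane q ρ inc par) (hq : Odd q) (hρ : Even ρ)
    (ht : IsTyping inc ty) {P : α} {c d : ι} (hc : inc c P) (hd : inc d P) :
    (bitangent inc P c d : ℝ) = q * (q - 2) * (if c = d then 1 else 0)
      - (q - 2) * (if Touch inc P c d then 1 else 0) + 2 * (q - 1) * (if ty c ↔ ty d then 1 else 0)
      := by
  have hq2 := h.two_lt
  have hq1 : ((q - 1 : ℕ) : ℝ) = (q : ℝ) - 1 := by rw [Nat.cast_sub (by omega)]; simp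
  by_cases hcd : c = d
  · subst hcd
    rw [h.bitangent_self hc, if_pos rfl, if_pos (touch_self hc), if_pos Iff.rfl]
    push_cast [hq1]; ring
  by_cases htt : Touch inc P c d
  · rw [h.bitangent_of_touch htt hcd 1, if_neg hcd, if_pos htt, if_pos (ht.touch htt)]
    · push_cast; ring
    · intro y hy hy'
      rw [h.card_touch_tangent_of_type hq hρ ht hy hy', if_pos (ht.touch htt)]
  · rw [h.bitangent_of_not_touch hc hd htt _ fun y hy hy' =>
      h.card_touch_tangent_of_type hq hρ ht hy hy', if_neg hcd, if_neg htt]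
    split_ifs <;> push_cast [hq1] <;> ring

end IsCirclePlane

end Counts

end CircleGeometry

namespace CircleGeometry

/-! ### The Gram matrix of the doubled meeting matrix. -/

section Spectral

open Finset
open scoped Classical

namespace IsCirclePlane

variable {α ι : Type*} [Fintype α] [Fintype ι] {q ρ : ℕ} {inc : ι → α → Prop} {par : α → α → Prop}
  {ty : ι → Prop}

omit [Fintype ι] in
theorem sum_common_eq {P : α} (A : Finset ι) (hA : ∀ d ∈ A, ¬ inc d P) (c : ι) (g : ι → ℝ) :
    ∑ d ∈ A, g d * common inc d c =
      ∑ x ∈ ({x | inc c x ∧ x ≠ P} : Finset α), ∑ d ∈ A with inc d x, g d := by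
  simp only [sum_filter (s := A)]
  rw [sum_comm]
  refine sum_congr rfl fun d hd => ?_
  rw [← sum_filter, sum_const, nsmul_eq_mul, mul_comm, common]
  congr 3
  ext x
  simp only [mem_filter, mem_univ, true_and]
  constructor
  · rintro ⟨h1, h2⟩
    refine ⟨⟨h2, ?_⟩, h1⟩
    rintro rfl
    exact hA d hd h1
  · rintro ⟨⟨h1, h2⟩, h3⟩
    exact ⟨h3, h1⟩

/-- Sort the common points by the point y of `c`: y = `x` lies on all (q - 1)(q + 1 - ρ) circles
considered, a y parallel to `x` on none, and any other y on q - ρ of them. -/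
theorem sum_common_through (h : IsCirclePlane q ρ inc par) {P x : α} {c : ι} (hc : inc c P)
    (hx : ¬ par x P) : ∑ d ∈ ({d | inc d x ∧ ¬ inc d P} : Finset ι), (common inc d c : ℝ)
      = if inc c x then ((q : ℝ) - 1) * (q + 1 - ρ) + (q - 1) * (q - ρ)
        else ((q : ℝ) - ρ) * (q - ρ) := by
  have hq := h.two_lt
  have hρ := h.rho_le
  have hq1 : ((q - 1 : ℕ) : ℝ) = (q : ℝ) - 1 := by rw [Nat.cast_sub (by omega)]; simp
  have hqρ : ((q - ρ : ℕ) : ℝ) = (q : ℝ) - ρ := by rw [Nat.cast_sub (by omega)]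
  have hqρ1 : ((q + 1 - ρ : ℕ) : ℝ) = (q : ℝ) + 1 - ρ := by rw [Nat.cast_sub (by omega)]; simp
  have h1 := sum_common_eq (inc := inc) (P := P) ({d | inc d x ∧ ¬ inc d P} : Finset ι)
    (by simp) c (fun _ => 1)
  simp only [one_mul] at h1
  rw [h1]
  have h2 : ∀ y ∈ ({y | inc c y ∧ y ≠ P} : Finset α),
      ∑ d ∈ ({d | inc d x ∧ ¬ inc d P} : Finset ι) with inc d y, (1 : ℝ) =
        if y = x then ((q : ℝ) - 1) * (q + 1 - ρ) else if par x y then 0 else (q : ℝ) - ρ := by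
    intro y hy
    simp only [mem_filter, mem_univ, true_and] at hy
    rw [sum_const, nsmul_eq_mul, mul_one, filter_filter]
    split_ifs with h3 h4
    · subst h3
      have : #{d | (inc d y ∧ ¬ inc d P) ∧ inc d y} = #{d | inc d y ∧ ¬ inc d P} := by
        congr 1; ext d; simp; tauto
      rw [this, h.card_through_not hx]
      push_cast [hq1, hqρ1]; ring
    · rw [Nat.cast_eq_zero, card_eq_zero, filter_eq_empty_iff]
      rintro d - ⟨⟨h5, -⟩, h6⟩
      exact h3 (h.eq_of_par h5 h6 h4).symm
    · have := h.card_through₂_not h4 hx (h.not_par hy.1 hc hy.2)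
      rw [← hqρ, ← this]
      congr 2; ext d; simp; tauto
  rw [sum_congr rfl h2]
  split_ifs with hcx
  · have hxP : x ≠ P := h.ne_of_not_par hx
    have hmem : x ∈ ({y | inc c y ∧ y ≠ P} : Finset α) := by simpa using ⟨hcx, hxP⟩
    rw [← add_sum_erase _ _ hmem, if_pos rfl, sum_congr rfl (g := fun _ => (q : ℝ) - ρ), sum_const,
      card_erase_of_mem hmem, h.card_erase hc, nsmul_eq_mul, hq1]
    intro y hy
    simp only [mem_erase, mem_filter, mem_univ, true_and] at hy
    rw [if_neg hy.1, if_neg (h.not_par hcx hy.2.1 hy.1.symm)]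
  · have h3 : ∀ y ∈ ({y | inc c y ∧ y ≠ P} : Finset α),
        (if y = x then ((q : ℝ) - 1) * (q + 1 - ρ) else if par x y then 0 else (q : ℝ) - ρ)
        = if ¬ par x y then (q : ℝ) - ρ else 0 := by
      intro y hy
      simp only [mem_filter, mem_univ, true_and] at hy
      rw [if_neg, ite_not]
      rintro rfl
      exact hcx hy.1
    rw [sum_congr rfl h3, ← sum_filter, filter_filter, sum_const, nsmul_eq_mul, ← hqρ]
    congr 2
    have h4 : ({a | (inc c a ∧ a ≠ P) ∧ ¬ par x a} : Finset α)
        = ({a | inc c a ∧ ¬ par x a} : Finset α).erase P := by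
      ext a; simp; tauto
    rw [h4, card_erase_of_mem (by simpa using ⟨hc, hx⟩), h.card_sub hcx]
    omega

/-- If `x` is on `c`, these are the members of the touching class of `c` in `x` other than `c`.
Otherwise exactly one of the q + 1 - ρ tangents through `x`, the one with contact point `P`, is
discarded. -/
theorem card_tangent_through (h : IsCirclePlane q ρ inc par) {P x : α} {c : ι} (hc : inc c P)
    (hx : ¬ par x P) : (#{d | (¬ inc d P ∧ common inc d c = 1) ∧ inc d x} : ℝ)
      = if inc c x then ((q : ℝ) - 1) else (q : ℝ) - ρ := by
  have hq := h.two_lt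
  have hρ := h.rho_le
  have hq1 : ((q - 1 : ℕ) : ℝ) = (q : ℝ) - 1 := by rw [Nat.cast_sub (by omega)]; simp
  have hqρ : ((q - ρ : ℕ) : ℝ) = (q : ℝ) - ρ := by rw [Nat.cast_sub (by omega)]
  have hxP := h.ne_of_not_par hx
  split_ifs with hcx
  · rw [← hq1, ← h.card_touch_ne hcx]
    congr 2
    ext d
    simp only [mem_filter, mem_univ, true_and]
    constructor
    · rintro ⟨⟨h1, h2⟩, h3⟩
      have := (h.common_eq_one_iff h3 hcx).1 h2
      exact ⟨this.1.symm, this.2⟩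
    · rintro ⟨h1, h2⟩
      refine ⟨⟨fun h3 => ?_, h1.symm.common_eq_one h2⟩, h1.2.1⟩
      exact hxP (h1.2.2.resolve_left (Ne.symm h2) P hc h3).symm
  · have h1 := h.card_tangent hcx
    obtain ⟨e, he, he'⟩ := h.existsUnique_touch_of_not_inc hc hcx fun hp => hx (h.symm hp)
    have h2 : #{d | (inc d x ∧ common inc d c = 1) ∧ inc d P} = 1 := by
      rw [card_eq_one]
      refine ⟨e, ?_⟩
      ext d
      simp only [mem_filter, mem_univ, true_and, mem_singleton]
      constructor
      · rintro ⟨⟨h1, h2⟩, h3⟩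
        exact he' d ⟨h1, (touch_of_common h2 h3 hc).symm⟩
      · rintro rfl
        refine ⟨⟨he.1, he.2.symm.common_eq_one ?_⟩, he.2.2.1⟩
        rintro rfl
        exact hcx he.1
    rw [← card_filter_add_card_filter_not (s := {d | inc d x ∧ common inc d c = 1})
      (fun d => inc d P), filter_filter, filter_filter, h2] at h1
    have h3 : #{d | (inc d x ∧ common inc d c = 1) ∧ ¬ inc d P} =
        #{d | (¬ inc d P ∧ common inc d c = 1) ∧ inc d x} := by
      congr 1; ext d; simp; tauto
    rw [← hqρ]
    congr 1
    omega

/-- Twice the indicator function of the relation of meeting, for distinct circles. -/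
noncomputable def weight (inc : ι → α → Prop) (c d : ι) : ℝ :=
  common inc d c + if common inc d c = 1 then 1 else 0

theorem weight_eq (h : IsCirclePlane q ρ inc par) {c d : ι} (hne : c ≠ d) :
    weight inc c d = 2 * if (∃ x, inc c x ∧ inc d x) then 1 else 0 := by
  have h1 := h.common_le hne.symm
  have h2 : (∃ x, inc c x ∧ inc d x) ↔ common inc d c ≠ 0 := by
    rw [common, Ne, card_eq_zero, filter_eq_empty_iff]
    push Not
    simp [and_comm]
  rw [weight, if_congr h2 rfl rfl]
  interval_cases common inc d c <;> norm_num

theorem card_common_erase (h : IsCirclePlane q ρ inc par) {P : α} {c d : ι} (hc : inc c P)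
    (hd : inc d P) : (#{x | (inc c x ∧ x ≠ P) ∧ inc d x} : ℝ)
      = q * (if c = d then 1 else 0) + 1 - if Touch inc P c d then 1 else 0 := by
  have hq := h.two_lt
  have h1 : ({x | (inc c x ∧ x ≠ P) ∧ inc d x} : Finset α)
      = ({x | inc c x ∧ inc d x} : Finset α).erase P := by
    ext x; simp; tauto
  have h2 : #{x | (inc c x ∧ x ≠ P) ∧ inc d x} + 1 = common inc c d := by
    rw [h1, common]
    exact card_erase_add_one (by simpa using ⟨hc, hd⟩)
  have h3 : (#{x | (inc c x ∧ x ≠ P) ∧ inc d x} : ℝ) = common inc c d - 1 := by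
    rw [← h2]; simp
  rw [h3]
  by_cases hcd : c = d
  · subst hcd
    rw [h.common_self, if_pos rfl, if_pos (touch_self hc)]
    push_cast; ring
  · have h4 := h.common_le hcd
    by_cases ht : Touch inc P c d
    · rw [if_neg hcd, if_pos ht, ht.common_eq_one hcd]; norm_num
    · have h5 : common inc c d ≠ 1 := fun h5 => ht (touch_of_common h5 hc hd)
      have h6 : common inc c d = 2 := by omega
      rw [if_neg hcd, if_neg ht, h6]; norm_num

theorem sum_erase_ite (h : IsCirclePlane q ρ inc par) {P : α} {c d : ι} (hc : inc c P)
    (hd : inc d P) (a b : ℝ) :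
    ∑ x ∈ ({x | inc c x ∧ x ≠ P} : Finset α), (if inc d x then a else b) = q * b + (a - b) *
      (q * (if c = d then 1 else 0) + 1 - if Touch inc P c d then 1 else 0) := by
  rw [← h.card_common_erase hc hd]
  have h1 : ∀ x ∈ ({x | inc c x ∧ x ≠ P} : Finset α),
      (if inc d x then a else b) = b + (a - b) * if inc d x then 1 else 0 := by
    intro x _
    split_ifs <;> ring
  rw [sum_congr rfl h1, sum_add_distrib, sum_const, h.card_erase hc, ← mul_sum, ← sum_filter,
    filter_filter, sum_const, nsmul_eq_mul, nsmul_eq_mul, mul_one]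

/-- The product of two weights expands into four terms. Three of them become sums over the points of
one circle other than `P`, with one value on the other circle and one value off it, so they are
linear in the number of common points other than `P`. The fourth is `bitangent` by definition. -/
theorem sum_weight_mul (h : IsCirclePlane q ρ inc par) {P : α} {c d : ι} (hc : inc c P)
    (hd : inc d P) :
    ∑ e ∈ ({e | ¬ inc e P} : Finset ι), weight inc c e * weight inc d e =
      q * (q - ρ) * (q - ρ + 2) + ((q : ℝ) ^ 2 - q - 3 + 4 * ρ - ρ ^ 2) *
        (q * (if c = d then 1 else 0) + 1 - if Touch inc P c d then 1 else 0)
      + bitangent inc P c d := by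
  set D : Finset ι := {e | ¬ inc e P} with hD
  have hDP : ∀ d ∈ D, ¬ inc d P := by simp [hD]
  have hpar : ∀ {c x}, inc c P → x ∈ ({x | inc c x ∧ x ≠ P} : Finset α) → ¬ par x P := by
    intro c x hc hx
    simp only [mem_filter, mem_univ, true_and] at hx
    exact h.not_par hx.1 hc hx.2
  have e1 : ∑ e ∈ D, (common inc e d : ℝ) * common inc e c = q * ((q - ρ) * (q - ρ)) +
      (((q : ℝ) - 1) * (q + 1 - ρ) + (q - 1) * (q - ρ) - (q - ρ) * (q - ρ)) *
      (q * (if c = d then 1 else 0) + 1 - if Touch inc P c d then 1 else 0) := by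
    rw [sum_common_eq D hDP, ← h.sum_erase_ite hc hd]
    refine sum_congr rfl fun x hx => ?_
    rw [← h.sum_common_through hd (hpar hc hx)]
    refine sum_congr ?_ fun _ _ => rfl
    ext e; simp [hD, and_comm]
  have e2 : ∀ {c d}, inc c P → inc d P → ∑ e ∈ D, (if common inc e d = 1 then 1 else 0 : ℝ) *
      common inc e c = q * (q - ρ) + (((q : ℝ) - 1) - (q - ρ)) *
      (q * (if c = d then 1 else 0) + 1 - if Touch inc P c d then 1 else 0) := by
    intro c d hc hd
    rw [sum_common_eq D hDP, ← h.sum_erase_ite hc hd]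
    refine sum_congr rfl fun x hx => ?_
    rw [← h.card_tangent_through hd (hpar hc hx), sum_boole, filter_filter, filter_filter]
    congr 2
    ext e; simp; tauto
  have e3 : ∑ e ∈ D, (if common inc e c = 1 then 1 else 0 : ℝ) *
      (if common inc e d = 1 then 1 else 0) = bitangent inc P c d := by
    rw [bitangent, card_filter, Nat.cast_sum, hD, sum_filter]
    refine sum_congr rfl fun e _ => ?_
    by_cases h1 : inc e P <;> by_cases h2 : common inc e c = 1 <;>
      by_cases h3 : common inc e d = 1 <;> simp [h1, h2, h3]
  have hsymT : (if Touch inc P d c then 1 else 0 : ℝ) = if Touch inc P c d then 1 else 0 :=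
    if_congr ⟨Touch.symm, Touch.symm⟩ rfl rfl
  have hsymE : (if d = c then 1 else 0 : ℝ) = if c = d then 1 else 0 :=
    if_congr eq_comm rfl rfl
  have e4 := e2 hd hc
  rw [hsymT, hsymE] at e4
  have expand : ∀ e ∈ D, weight inc c e * weight inc d e =
      (common inc e d : ℝ) * common inc e c + (if common inc e d = 1 then 1 else 0 : ℝ) *
      common inc e c + (if common inc e c = 1 then 1 else 0 : ℝ) * common inc e d
      + (if common inc e c = 1 then 1 else 0 : ℝ) * (if common inc e d = 1 then 1 else 0) := by
    intro e _
    simp only [weight]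
    ring
  rw [sum_congr rfl expand, sum_add_distrib, sum_add_distrib, sum_add_distrib, e1, e2 hc hd, e4,
    e3]
  ring

end IsCirclePlane

end Spectral

end CircleGeometry

namespace CircleGeometry

/-! ### Bounding the quadratic form on functions of sum zero. -/

section Bound

open Finset
open scoped Classical

theorem sum_sq_eq_sum_gram {ι : Type*} (C D : Finset ι) (w : ι → ι → ℝ) (f : ι → ℝ) :
    ∑ d ∈ D, (∑ c ∈ C, w c d * f c) ^ 2 =
      ∑ c ∈ C, ∑ c' ∈ C, f c * f c' * ∑ d ∈ D, w c d * w c' d := by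
  have h1 : ∀ d ∈ D, (∑ c ∈ C, w c d * f c) ^ 2 =
      ∑ c ∈ C, ∑ c' ∈ C, w c d * f c * (w c' d * f c') := fun d _ => by rw [sq, sum_mul_sum]
  rw [sum_congr rfl h1, sum_comm]
  refine sum_congr rfl fun c _ => ?_
  rw [sum_comm]
  refine sum_congr rfl fun c' _ => ?_
  rw [mul_sum]
  exact sum_congr rfl fun d _ => by ring

theorem sum_sum_mul_eq {ι : Type*} (C : Finset ι) (f : ι → ℝ) :
    ∑ c ∈ C, ∑ c' ∈ C, f c * f c' * (if c = c' then 1 else 0) = ∑ c ∈ C, f c ^ 2 := by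
  refine sum_congr rfl fun c hc => ?_
  simp [hc, sq]

/-- The form is the sum of the squares of the two type sums, which are opposite because `f` has sum
zero. -/
theorem sum_sum_mul_iff {ι : Type*} (C : Finset ι) (f : ι → ℝ) (ty : ι → Prop)
    (hf : ∑ c ∈ C, f c = 0) :
    ∑ c ∈ C, ∑ c' ∈ C, f c * f c' * (if ty c ↔ ty c' then 1 else 0) =
      2 * (∑ c ∈ C with ty c, f c) ^ 2 := by
  have h1 : ∑ c ∈ C with ty c, f c + ∑ c ∈ C with ¬ ty c, f c = 0 := by
    rw [sum_filter_add_sum_filter_not, hf]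
  have h2 : ∀ c ∈ C, ∑ c' ∈ C, f c * f c' * (if ty c ↔ ty c' then 1 else 0) =
      (∑ c ∈ C with ty c, f c) * (if ty c then f c else 0)
      + (∑ c ∈ C with ¬ ty c, f c) * (if ¬ ty c then f c else 0) := by
    intro c _
    by_cases hc : ty c
    · simp only [hc, true_iff, if_true, not_true, if_false, mul_zero, add_zero, sum_filter, sum_mul]
      refine sum_congr rfl fun c' _ => ?_
      split_ifs <;> ring
    · simp only [hc, false_iff, if_true, not_false_iff, if_false, mul_zero, zero_add, sum_filter,
        sum_mul]
      refine sum_congr rfl fun c' _ => ?_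
      split_ifs <;> ring
  rw [sum_congr rfl h2, sum_add_distrib, ← mul_sum, ← mul_sum, ← sum_filter, ← sum_filter,
    eq_neg_of_add_eq_zero_right h1]
  ring

namespace IsCirclePlane

variable {α ι : Type*} [Fintype α] [Fintype ι] {q ρ : ℕ} {inc : ι → α → Prop} {par : α → α → Prop}
  {ty : ι → Prop}

/-- The quadratic form of the relation of touching in `P`. -/
noncomputable def touchForm (inc : ι → α → Prop) (P : α) (f : ι → ℝ) : ℝ :=
  ∑ c ∈ ({c | inc c P} : Finset ι), ∑ d ∈ ({c | inc c P} : Finset ι),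
    f c * f d * if Touch inc P c d then 1 else 0

/-- The touching classes have q members, so the touching matrix A satisfies A² = qA. -/
theorem sum_touch_sq (h : IsCirclePlane q ρ inc par) (P : α) (f : ι → ℝ) :
    ∑ c ∈ ({c | inc c P} : Finset ι), (∑ d ∈ ({c | inc c P} : Finset ι),
      (if Touch inc P d c then 1 else 0) * f d) ^ 2 = q * touchForm inc P f := by
  rw [sum_sq_eq_sum_gram _ _ (fun d c => if Touch inc P d c then 1 else 0), touchForm, mul_sum]
  refine sum_congr rfl fun c hc => ?_
  rw [mul_sum]
  refine sum_congr rfl fun d hd => ?_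
  simp only [mem_filter, mem_univ, true_and] at hc hd
  have : ∑ e ∈ ({c | inc c P} : Finset ι), (if Touch inc P c e then 1 else 0 : ℝ) *
      (if Touch inc P d e then 1 else 0) = q * if Touch inc P c d then 1 else 0 := by
    split_ifs with hcd
    · rw [← h.card_touch hc, mul_one, card_filter, Nat.cast_sum, sum_filter]
      refine sum_congr rfl fun e _ => ?_
      by_cases h1 : Touch inc P c e
      · simp [h1, (h.touch_class_eq hcd e).1 h1, h1.2.1]
      · simp [h1]
    · rw [mul_zero]
      refine sum_eq_zero fun e _ => ?_
      by_cases h1 : Touch inc P c e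
      · rw [if_neg fun h2 => hcd (h.touch_trans h1 (Touch.symm h2)), mul_zero]
      · rw [if_neg h1, zero_mul]
  rw [this]
  ring

theorem touchForm_nonneg (h : IsCirclePlane q ρ inc par) (P : α) (f : ι → ℝ) :
    0 ≤ touchForm inc P f := by
  have h1 := h.sum_touch_sq P f
  have h2 : (0 : ℝ) < q := by exact_mod_cast (by have := h.two_lt; omega : 0 < q)
  have h3 : 0 ≤ (q : ℝ) * touchForm inc P f := by
    rw [← h1]
    exact sum_nonneg fun _ _ => sq_nonneg _
  exact nonneg_of_mul_nonneg_right h3 h2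

/-- From A² = qA for the touching matrix A, expanding the squared norm of Af - qf, which is
nonnegative, gives the estimate. -/
theorem touchForm_le (h : IsCirclePlane q ρ inc par) (P : α) (f : ι → ℝ) :
    touchForm inc P f ≤ q * ∑ c ∈ ({c | inc c P} : Finset ι), f c ^ 2 := by
  have h1 := h.sum_touch_sq P f
  have h2 : (0 : ℝ) < q := by exact_mod_cast (by have := h.two_lt; omega : 0 < q)
  set g : ι → ℝ := fun c => ∑ d ∈ ({c | inc c P} : Finset ι),
      (if Touch inc P d c then 1 else 0) * f d with hg
  have h3 : touchForm inc P f = ∑ c ∈ ({c | inc c P} : Finset ι), f c * g c := by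
    rw [touchForm]
    refine sum_congr rfl fun c _ => ?_
    rw [hg, mul_sum]
    refine sum_congr rfl fun d _ => ?_
    rw [if_congr (⟨Touch.symm, Touch.symm⟩ : Touch inc P c d ↔ Touch inc P d c) rfl rfl]
    ring
  have h4 : 0 ≤ ∑ c ∈ ({c | inc c P} : Finset ι), (g c - q * f c) ^ 2 :=
    sum_nonneg fun _ _ => sq_nonneg _
  have h5 : ∑ c ∈ ({c | inc c P} : Finset ι), (g c - q * f c) ^ 2 =
      ∑ c ∈ ({c | inc c P} : Finset ι), g c ^ 2
        - 2 * q * ∑ c ∈ ({c | inc c P} : Finset ι), f c * g c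
        + (q : ℝ) ^ 2 * ∑ c ∈ ({c | inc c P} : Finset ι), f c ^ 2 := by
    rw [mul_sum, mul_sum, ← sum_sub_distrib, ← sum_add_distrib]
    refine sum_congr rfl fun c _ => by ring
  rw [h5, ← h3, h1] at h4
  nlinarith

/-- Each type is a union of touching classes of size q, so the class sums total q times the type
sum. Cauchy–Schwarz over the q(q + 1 - ρ)/2 circles of the type gives the rest. -/
theorem sq_sum_type_le (h : IsCirclePlane q ρ inc par) (hq : Odd q) (hρ : Even ρ)
    (ht : IsTyping inc ty) (P : α) (f : ι → ℝ) :
    2 * q * (∑ c ∈ ({c | inc c P} : Finset ι) with ty c, f c) ^ 2 ≤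
      (q + 1 - ρ) * ∑ c ∈ ({c | inc c P} : Finset ι) with ty c,
        (∑ d ∈ ({c | inc c P} : Finset ι), (if Touch inc P d c then 1 else 0) * f d) ^ 2 := by
  have hρ2 := h.rho_le
  have hq2 := h.two_lt
  have h2 : (0 : ℝ) < q := by exact_mod_cast (by omega : 0 < q)
  set C : Finset ι := {c | inc c P} with hC
  set g : ι → ℝ := fun c => ∑ d ∈ C, (if Touch inc P d c then 1 else 0) * f d with hg
  have h3 : ∑ c ∈ C with ty c, g c = q * ∑ c ∈ C with ty c, f c := by
    rw [hg, sum_comm, mul_sum, sum_filter (s := C)]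
    refine sum_congr rfl fun d hd => ?_
    rw [← sum_mul]
    simp only [hC, mem_filter, mem_univ, true_and] at hd
    split_ifs with htd
    · congr 1
      rw [← h.card_touch hd, sum_boole, filter_filter, filter_filter]
      congr 2
      ext c
      simp only [mem_filter, mem_univ, true_and]
      exact ⟨fun h4 => h4.2.2, fun h4 => ⟨h4.2.1, (ht.touch h4).1 htd, h4⟩⟩
    · rw [sum_eq_zero, zero_mul]
      intro c hc
      simp only [mem_filter] at hc
      rw [if_neg]
      exact fun h4 => htd ((ht.touch h4).2 hc.2)
  have h4 := sq_sum_le_card_mul_sum_sq (s := {c ∈ C | ty c}) (f := g)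
  have h6 : 2 * (#{c ∈ C | ty c} : ℝ) = q * (q + 1 - ρ) := by
    have := h.card_type hq hρ ht P
    rw [hC, filter_filter]
    have h7 : ((q + 1 - ρ : ℕ) : ℝ) = (q : ℝ) + 1 - ρ := by rw [Nat.cast_sub (by omega)]; simp
    rw [← h7]
    exact_mod_cast this
  rw [h3] at h4
  have h8 : q * (2 * q * (∑ c ∈ C with ty c, f c) ^ 2)
      ≤ q * ((q + 1 - ρ) * ∑ c ∈ C with ty c, g c ^ 2) := by
    calc _ = 2 * (q * ∑ c ∈ C with ty c, f c) ^ 2 := by ring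
      _ ≤ 2 * (#{c ∈ C | ty c} * ∑ c ∈ C with ty c, g c ^ 2) := by linarith
      _ = (2 * (#{c ∈ C | ty c} : ℝ)) * ∑ c ∈ C with ty c, g c ^ 2 := by ring
      _ = _ := by rw [h6]; ring
  exact le_of_mul_le_mul_left h8 h2

/-- Add the previous inequality for the two types, whose sums differ only in sign. -/
theorem four_mul_sq_sum_type_le (h : IsCirclePlane q ρ inc par) (hq : Odd q) (hρ : Even ρ)
    (ht : IsTyping inc ty) (P : α) (f : ι → ℝ)
    (hf : ∑ c ∈ ({c | inc c P} : Finset ι), f c = 0) :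
    4 * (∑ c ∈ ({c | inc c P} : Finset ι) with ty c, f c) ^ 2
      ≤ (q + 1 - ρ) * touchForm inc P f := by
  have h2 : (0 : ℝ) < q := by exact_mod_cast (by have := h.two_lt; omega : 0 < q)
  have h3 := h.sq_sum_type_le hq hρ ht P f
  have h4 := h.sq_sum_type_le hq hρ ht.not P f
  have h5 := h.sum_touch_sq P f
  set C : Finset ι := {c | inc c P} with hC
  have h1 : ∑ c ∈ C with ¬ ty c, f c = - ∑ c ∈ C with ty c, f c := by
    rw [← sum_filter_add_sum_filter_not C ty] at hf
    linarith
  rw [← sum_filter_add_sum_filter_not C ty] at h5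
  have h6 : q * (4 * (∑ c ∈ C with ty c, f c) ^ 2) ≤ q * ((q + 1 - ρ) * touchForm inc P f) := by
    have h7 : ∑ c ∈ @filter ι (fun c => ¬ ty c) (fun c => Classical.propDecidable _) C, f c =
      - ∑ c ∈ C with ty c, f c := by rw [← h1]; congr!
    rw [h7] at h4
    have h8 : (q : ℝ) * ((q + 1 - ρ) * touchForm inc P f)
      = (q + 1 - ρ) * (q * touchForm inc P f) := by ring
    rw [h8, ← h5]
    have h9 := add_le_add h3 h4
    rw [← mul_add] at h9
    calc _ = _ := ?_
      _ ≤ _ := h9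
      _ = _ := ?_
    · ring
    · rw [mul_add]; congr!
  exact le_of_mul_le_mul_left h6 h2

/-- The constant part of the Gram matrix vanishes on functions of sum zero. -/
theorem sum_meets_sq (h : IsCirclePlane q ρ inc par) (P : α) (f : ι → ℝ)
    (hf : ∑ c ∈ ({c | inc c P} : Finset ι), f c = 0) :
    4 * ∑ d ∈ ({d | ¬ inc d P} : Finset ι),
      (∑ c ∈ ({c | inc c P} : Finset ι) with ∃ x, inc c x ∧ inc d x, f c) ^ 2 =
    ((q : ℝ) ^ 2 - q - 3 + 4 * ρ - ρ ^ 2) * (q * ∑ c ∈ ({c | inc c P} : Finset ι), f c ^ 2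
      - touchForm inc P f) + ∑ c ∈ ({c | inc c P} : Finset ι),
      ∑ d ∈ ({c | inc c P} : Finset ι), f c * f d * bitangent inc P c d := by
  set C : Finset ι := {c | inc c P} with hC
  have h1 : 4 * ∑ d ∈ ({d | ¬ inc d P} : Finset ι),
      (∑ c ∈ C with ∃ x, inc c x ∧ inc d x, f c) ^ 2 =
      ∑ d ∈ ({d | ¬ inc d P} : Finset ι), (∑ c ∈ C, weight inc c d * f c) ^ 2 := by
    rw [mul_sum]
    refine sum_congr rfl fun d hd => ?_
    have : ∑ c ∈ C, weight inc c d * f c = 2 * ∑ c ∈ C with ∃ x, inc c x ∧ inc d x, f c := by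
      rw [sum_filter (s := C), mul_sum]
      refine sum_congr rfl fun c hc => ?_
      rw [h.weight_eq (d := d)]
      · split_ifs <;> ring
      · rintro rfl
        simp only [hC, mem_filter, mem_univ, true_and] at hc hd
        exact hd hc
    rw [this]
    ring
  rw [h1, sum_sq_eq_sum_gram]
  have hmem : ∀ c ∈ C, inc c P := by simp [hC]
  have h2 : ∀ a : ℝ, ∑ c ∈ C, ∑ d ∈ C, f c * f d * a = 0 := by
    intro a
    simp only [← sum_mul, ← mul_sum, hf, mul_zero, zero_mul, sum_const_zero]
  have h3 : ∀ c ∈ C, ∑ d ∈ C, f c * f d * ∑ e ∈ ({d | ¬ inc d P} : Finset ι),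
      weight inc c e * weight inc d e =
      ∑ d ∈ C, f c * f d * (q * (q - ρ) * (q - ρ + 2) + ((q : ℝ) ^ 2 - q - 3 + 4 * ρ - ρ ^ 2)) +
      ((q : ℝ) ^ 2 - q - 3 + 4 * ρ - ρ ^ 2) * (q * ∑ d ∈ C, f c * f d * (if c = d then 1 else 0)
      - ∑ d ∈ C, f c * f d * (if Touch inc P c d then 1 else 0))
      + ∑ d ∈ C, f c * f d * bitangent inc P c d := by
    intro c hc
    rw [mul_sum, ← sum_sub_distrib, mul_sum, ← sum_add_distrib, ← sum_add_distrib]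
    refine sum_congr rfl fun d hd => ?_
    rw [h.sum_weight_mul (hmem c hc) (hmem d hd)]
    ring
  rw [sum_congr rfl h3, sum_add_distrib, sum_add_distrib, h2, ← mul_sum, sum_sub_distrib,
    ← mul_sum, sum_sum_mul_eq, touchForm]
  ring

/-- With n the squared norm of f and p its touching form, the left side equals (q² - (ρ - 2)²)(qn -
p), and p is nonnegative. -/
theorem spectral_of_odd (h : IsCirclePlane q ρ inc par) (hr : Odd (q + 1 - ρ)) (P : α) (f : ι → ℝ)
    (hf : ∑ c ∈ ({c | inc c P} : Finset ι), f c = 0) :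
    4 * ∑ d ∈ ({d | ¬ inc d P} : Finset ι),
      (∑ c ∈ ({c | inc c P} : Finset ι) with ∃ x, inc c x ∧ inc d x, f c) ^ 2 ≤
    lam q ρ * ∑ c ∈ ({c | inc c P} : Finset ι), f c ^ 2 := by
  have hρ2 := h.rho_le
  have hq2 := h.two_lt
  rw [h.sum_meets_sq P f hf]
  set C : Finset ι := {c | inc c P} with hC
  have hmem : ∀ c ∈ C, inc c P := by simp [hC]
  have h3 : ∀ c ∈ C, ∑ d ∈ C, f c * f d * (bitangent inc P c d : ℝ) =
      ∑ d ∈ C, f c * f d * ((q : ℝ) - 1) +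
      q * (q - 1) * ∑ d ∈ C, f c * f d * (if c = d then 1 else 0)
      - (q - 1) * ∑ d ∈ C, f c * f d * (if Touch inc P c d then 1 else 0) := by
    intro c hc
    rw [mul_sum, mul_sum, ← sum_add_distrib, ← sum_sub_distrib]
    refine sum_congr rfl fun d hd => ?_
    rw [h.bitangent_of_odd hr (hmem c hc) (hmem d hd)]
    ring
  have h2 : ∑ c ∈ C, ∑ d ∈ C, f c * f d * ((q : ℝ) - 1) = 0 := by
    simp only [← sum_mul, ← mul_sum, hf, mul_zero, zero_mul, sum_const_zero]
  rw [sum_congr rfl h3, sum_sub_distrib, sum_add_distrib, h2, ← mul_sum, ← mul_sum, sum_sum_mul_eq]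
  have hp := h.touchForm_nonneg P f
  rw [touchForm] at hp ⊢
  set p := ∑ c ∈ C, ∑ d ∈ C, f c * f d * (if Touch inc P c d then 1 else 0 : ℝ)
  have hq3 : (3 : ℝ) ≤ q := by exact_mod_cast hq2
  -- One formula for λ covers ρ = 1 with q odd and ρ = 0, 2 with q even.
  have hl : lam q ρ = q ^ 3 - q * (ρ - 2) ^ 2 := by
    rw [lam]
    split_ifs with hodd
    · interval_cases ρ
      · exact absurd hr (by rw [Nat.not_odd_iff_even]; simpa using hodd.add_one)
      · push_cast; ring
      · exfalso
        rw [Nat.odd_iff] at hr hodd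
        omega
    · interval_cases ρ
      · push_cast; ring
      · exact absurd hr hodd
      · push_cast; ring
  rw [hl]
  have hp2 : 0 ≤ ((q : ℝ) ^ 2 - 4 + 4 * ρ - ρ ^ 2) * p := by
    refine mul_nonneg ?_ hp
    have : (ρ : ℝ) ≤ 2 := by exact_mod_cast hρ2
    have : (0 : ℝ) ≤ ρ := by positivity
    nlinarith
  nlinarith

/-- With n and p as before and a the sum over one type, the left side is (q² - 5 + 4ρ - ρ²)(qn - p)
+ 4(q - 1)a², where 4a² ≤ (q + 1 - ρ)p. For ρ = 0 this leaves the coefficient 4 at p, and p ≤ qn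
finishes; for ρ = 2 the coefficient is negative, and p ≥ 0 finishes. -/
theorem spectral_of_type (h : IsCirclePlane q ρ inc par) (hq : Odd q) (hρ : Even ρ)
    (ht : IsTyping inc ty) (P : α) (f : ι → ℝ) (hf : ∑ c ∈ ({c | inc c P} : Finset ι), f c = 0) :
    4 * ∑ d ∈ ({d | ¬ inc d P} : Finset ι),
      (∑ c ∈ ({c | inc c P} : Finset ι) with ∃ x, inc c x ∧ inc d x, f c) ^ 2 ≤
    lam q ρ * ∑ c ∈ ({c | inc c P} : Finset ι), f c ^ 2 := by
  have hρ2 := h.rho_le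
  have hq2 := h.two_lt
  rw [h.sum_meets_sq P f hf]
  have he := h.four_mul_sq_sum_type_le hq hρ ht P f hf
  have hp' := h.touchForm_le P f
  set C : Finset ι := {c | inc c P} with hC
  have hmem : ∀ c ∈ C, inc c P := by simp [hC]
  have h3 : ∀ c ∈ C, ∑ d ∈ C, f c * f d * (bitangent inc P c d : ℝ) =
      q * (q - 2) * ∑ d ∈ C, f c * f d * (if c = d then 1 else 0)
      - (q - 2) * ∑ d ∈ C, f c * f d * (if Touch inc P c d then 1 else 0)
      + 2 * (q - 1) * ∑ d ∈ C, f c * f d * (if ty c ↔ ty d then 1 else 0) := by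
    intro c hc
    rw [mul_sum, mul_sum, mul_sum, ← sum_sub_distrib, ← sum_add_distrib]
    refine sum_congr rfl fun d hd => ?_
    rw [h.bitangent_of_type hq hρ ht (hmem c hc) (hmem d hd)]
    ring
  rw [sum_congr rfl h3, sum_add_distrib, sum_sub_distrib, ← mul_sum, ← mul_sum, ← mul_sum,
    sum_sum_mul_eq, sum_sum_mul_iff _ _ _ hf]
  have hp := h.touchForm_nonneg P f
  rw [touchForm] at hp hp' he ⊢
  set p := ∑ c ∈ C, ∑ d ∈ C, f c * f d * (if Touch inc P c d then 1 else 0 : ℝ)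
  set n := ∑ c ∈ C, f c ^ 2
  set a := ∑ c ∈ C with ty c, f c
  have hq3 : (3 : ℝ) ≤ q := by exact_mod_cast hq2
  rw [lam, if_pos hq]
  have he2 := mul_le_mul_of_nonneg_left he (by linarith : (0 : ℝ) ≤ q - 1)
  interval_cases ρ
  · push_cast at he2 ⊢
    nlinarith
  · simp at hρ
  · push_cast at he2 ⊢
    nlinarith

end IsCirclePlane

end Bound

end CircleGeometry

namespace CircleGeometry

/-! ### From the spectral estimate to the bound on families. -/

section FamilyBound

open Finset
open scoped Classical

/-- The bound on intersecting families, for an incidence structure given by an incidence relation. -/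
def FamilyBound {α ι : Type*} (q ρ : ℕ) (inc : ι → α → Prop) : Prop :=
  ∀ (F : Finset ι) (P : α), (∀ c ∈ F, ∀ d ∈ F, ∃ x, inc c x ∧ inc d x) →
    (#{c ∈ F | inc c P} : ℝ) * #{c ∈ F | ¬ inc c P} ≤
      ((q : ℝ) / ((q : ℝ) + (ρ : ℝ) - 2)) ^ 2 * lam q ρ *
        (1 - (#{c ∈ F | inc c P} : ℝ) / ((q : ℝ) * ((q : ℝ) + 1 - (ρ : ℝ)))) *
        (1 - (#{c ∈ F | ¬ inc c P} : ℝ) / ((q : ℝ) ^ 2 * ((q : ℝ) - 1)))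

/-- The bound for an incidence relation yields the bound for an isomorphic incidence structure. -/
theorem FamilyBound.transfer {α ι : Type*} [Fintype ι] {q ρ : ℕ} {inc : ι → α → Prop}
    (h : FamilyBound q ρ inc) (D : IncidenceStructure.{u}) (e : α ≃ D.Point)
    (blk : ι → Set D.Point) (hinj : Function.Injective blk) (hblk : D.blocks = Set.range blk)
    (hinc : ∀ i x, e x ∈ blk i ↔ inc i x)
    (F : Set (Set D.Point)) (hF : IsIntersectingFamily D F) (P : D.Point)
    (S T : Set (Set D.Point)) (hS : S = {c ∈ F | P ∈ c}) (hT : T = F \ S) :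
    (S.ncard : ℝ) * (T.ncard : ℝ) ≤
      ((q : ℝ) / ((q : ℝ) + (ρ : ℝ) - 2)) ^ 2 * lam q ρ *
        (1 - (S.ncard : ℝ) / ((q : ℝ) * ((q : ℝ) + 1 - (ρ : ℝ)))) *
        (1 - (T.ncard : ℝ) / ((q : ℝ) ^ 2 * ((q : ℝ) - 1))) := by
  have hP : ∀ i, P ∈ blk i ↔ inc i (e.symm P) := fun i => by
    rw [← hinc, Equiv.apply_symm_apply]
  have hFr : ∀ c ∈ F, ∃ i, blk i = c := fun c hc => by
    have := hF.1 hc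
    rwa [hblk] at this
  have hSc : S.ncard = #{i ∈ ({i | blk i ∈ F} : Finset ι) | inc i (e.symm P)} := by
    rw [← Set.ncard_coe_finset, ← Set.ncard_image_of_injective _ hinj]
    congr 1
    ext c
    simp only [hS, Set.mem_ofPred_eq, coe_filter, mem_filter, mem_univ, true_and, Set.mem_image]
    constructor
    · rintro ⟨h1, h2⟩
      obtain ⟨i, rfl⟩ := hFr c h1
      exact ⟨i, ⟨h1, (hP i).1 h2⟩, rfl⟩
    · rintro ⟨i, ⟨h1, h2⟩, rfl⟩
      exact ⟨h1, (hP i).2 h2⟩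
  have hTc : T.ncard = #{i ∈ ({i | blk i ∈ F} : Finset ι) | ¬ inc i (e.symm P)} := by
    rw [← Set.ncard_coe_finset, ← Set.ncard_image_of_injective _ hinj]
    congr 1
    ext c
    simp only [hT, hS, Set.mem_ofPred_eq, coe_filter, mem_filter, mem_univ, true_and,
      Set.mem_image, Set.mem_sdiff, not_and]
    constructor
    · rintro ⟨h1, h2⟩
      obtain ⟨i, rfl⟩ := hFr c h1
      exact ⟨i, ⟨h1, fun h3 => h2 h1 ((hP i).2 h3)⟩, rfl⟩
    · rintro ⟨i, ⟨h1, h2⟩, rfl⟩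
      exact ⟨h1, fun _ h3 => h2 ((hP i).1 h3)⟩
  rw [hSc, hTc]
  refine h _ _ fun c hc d hd => ?_
  simp only [mem_filter, mem_univ, true_and] at hc hd
  obtain ⟨x, hx1, hx2⟩ := hF.2 _ hc _ hd
  refine ⟨e.symm x, ?_, ?_⟩
  · rwa [← hinc, Equiv.apply_symm_apply]
  · rwa [← hinc, Equiv.apply_symm_apply]

namespace IsCirclePlane

variable {α ι : Type*} [Fintype α] [Fintype ι] {q ρ : ℕ} {inc : ι → α → Prop} {par : α → α → Prop}

theorem injective (h : IsCirclePlane q ρ inc par) {c d : ι} (hcd : ∀ x, inc c x ↔ inc d x) :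
    c = d := by
  by_contra hne
  have h1 := h.common_le hne
  have h2 := h.two_lt
  have h3 : common inc c d = common inc c c := by
    simp only [common, hcd]
  rw [h3, h.common_self] at h1
  omega

theorem sum_common_left (h : IsCirclePlane q ρ inc par) {P : α} {d : ι} (hd : ¬ inc d P) :
    ∑ c ∈ ({c | inc c P} : Finset ι), common inc c d = (q + 1 - ρ) * (q + 1 - ρ) := by
  have key := sum_card_bipartiteAbove_eq_sum_card_bipartiteBelow
    (s := ({c | inc c P} : Finset ι)) (t := ({x | inc d x ∧ ¬ par P x} : Finset α)) inc
  have h2 : ∀ x ∈ ({x | inc d x ∧ ¬ par P x} : Finset α),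
      #(bipartiteBelow inc ({c | inc c P} : Finset ι) x) = q + 1 - ρ := by
    intro x hx
    simp only [mem_filter, mem_univ, true_and] at hx
    rw [← h.card_through₂ hx.2]
    congr 1
    ext c
    simp [mem_bipartiteBelow]
  rw [sum_congr rfl h2, sum_const, smul_eq_mul, h.card_sub hd] at key
  rw [← key]
  refine sum_congr rfl fun c hc => ?_
  simp only [mem_filter, mem_univ, true_and] at hc
  rw [common]
  congr 1
  ext x
  simp only [mem_bipartiteAbove, mem_filter, mem_univ, true_and]
  constructor
  · rintro ⟨h1, h2⟩
    refine ⟨⟨h2, h.not_par hc h1 ?_⟩, h1⟩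
    rintro rfl
    exact hd h2
  · rintro ⟨h1, h2⟩
    exact ⟨h2, h1.1⟩

theorem sum_common_right (h : IsCirclePlane q ρ inc par) {P : α} {c : ι} (hc : inc c P) :
    ∑ d ∈ ({d | ¬ inc d P} : Finset ι), common inc d c = q * ((q - 1) * (q + 1 - ρ)) := by
  have key := sum_card_bipartiteAbove_eq_sum_card_bipartiteBelow
    (s := ({d | ¬ inc d P} : Finset ι)) (t := ({x | inc c x ∧ x ≠ P} : Finset α)) inc
  have h2 : ∀ x ∈ ({x | inc c x ∧ x ≠ P} : Finset α),
      #(bipartiteBelow inc ({d | ¬ inc d P} : Finset ι) x) = (q - 1) * (q + 1 - ρ) := by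
    intro x hx
    simp only [mem_filter, mem_univ, true_and] at hx
    rw [← h.card_through_not (h.not_par hx.1 hc hx.2)]
    congr 1
    ext c
    simp [mem_bipartiteBelow, and_comm]
  rw [sum_congr rfl h2, sum_const, smul_eq_mul, h.card_erase hc] at key
  rw [← key]
  refine sum_congr rfl fun d hd => ?_
  simp only [mem_filter, mem_univ, true_and] at hd
  rw [common]
  congr 1
  ext x
  simp only [mem_bipartiteAbove, mem_filter, mem_univ, true_and]
  constructor
  · rintro ⟨h1, h2⟩
    refine ⟨⟨h2, ?_⟩, h1⟩
    rintro rfl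
    exact hd h1
  · rintro ⟨h1, h2⟩
    exact ⟨h2, h1.1⟩

theorem familyBound_of_spectral (h : IsCirclePlane q ρ inc par) (hspec : ∀ (P : α) (f : ι → ℝ),
      ∑ c ∈ ({c | inc c P} : Finset ι), f c = 0 → 4 * ∑ d ∈ ({d | ¬ inc d P} : Finset ι),
      (∑ c ∈ ({c | inc c P} : Finset ι) with ∃ x, inc c x ∧ inc d x, f c) ^ 2 ≤
      lam q ρ * ∑ c ∈ ({c | inc c P} : Finset ι), f c ^ 2) : FamilyBound q ρ inc := by
  intro F P hF
  have hρ2 := h.rho_le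
  have hq2 := h.two_lt
  have hq1 : ((q - 1 : ℕ) : ℝ) = (q : ℝ) - 1 := by rw [Nat.cast_sub (by omega)]; simp
  have hqρ1 : ((q + 1 - ρ : ℕ) : ℝ) = (q : ℝ) + 1 - ρ := by rw [Nat.cast_sub (by omega)]; simp
  have hq3 : (3 : ℝ) ≤ q := by exact_mod_cast hq2
  have hρ3 : (ρ : ℝ) ≤ 2 := by exact_mod_cast hρ2
  have hρ4 : (0 : ℝ) ≤ ρ := by positivity
  have hr : (0 : ℝ) < q + 1 - ρ := by linarith
  have hcol : ∀ d ∈ ({d | ¬ inc d P} : Finset ι),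
      (#{c ∈ ({c | inc c P} : Finset ι) | ∃ x, inc c x ∧ inc d x} : ℝ)
      = (q + 1 - ρ) * (q + 2 - ρ) / 2 := by
    intro d hd
    simp only [mem_filter, mem_univ, true_and] at hd
    -- The degree is half a column sum of `weight`, that is, common points plus tangents.
    have h1 : (2 : ℝ) * #{c ∈ ({c | inc c P} : Finset ι) | ∃ x, inc c x ∧ inc d x} =
        ∑ c ∈ ({c | inc c P} : Finset ι), weight inc c d := by
      rw [← sum_boole, mul_sum]
      refine sum_congr rfl fun c hc => ?_
      rw [h.weight_eq (d := d)]
      rintro rfl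
      simp only [mem_filter, mem_univ, true_and] at hc
      exact hd hc
    have h2 : ∑ c ∈ ({c | inc c P} : Finset ι), weight inc c d
        = (q + 1 - ρ) * (q + 1 - ρ) + (q + 1 - ρ) := by
      simp only [weight]
      rw [sum_add_distrib, sum_boole, filter_filter]
      congr 1
      · rw [← hqρ1, ← Nat.cast_mul, ← h.sum_common_left hd, Nat.cast_sum]
        exact sum_congr rfl fun c _ => by rw [common_comm]
      · rw [← hqρ1, ← h.card_tangent hd]
        simp only [common_comm]
    linarith
  have hrow : ∀ c ∈ ({c | inc c P} : Finset ι),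
      (#{d ∈ ({d | ¬ inc d P} : Finset ι) | ∃ x, inc c x ∧ inc d x} : ℝ)
      = (q * ((q - 1) * (q + 1 - ρ)) + q * (q - 1)) / 2 := by
    intro c hc
    simp only [mem_filter, mem_univ, true_and] at hc
    have h1 : (2 : ℝ) * #{d ∈ ({d | ¬ inc d P} : Finset ι) | ∃ x, inc c x ∧ inc d x} =
        ∑ d ∈ ({d | ¬ inc d P} : Finset ι), weight inc c d := by
      rw [← sum_boole, mul_sum]
      refine sum_congr rfl fun d hd => ?_
      rw [h.weight_eq (c := c)]
      rintro rfl
      simp only [mem_filter, mem_univ, true_and] at hd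
      exact hd hc
    have h2 : ∑ d ∈ ({d | ¬ inc d P} : Finset ι), weight inc c d
        = q * ((q - 1) * (q + 1 - ρ)) + q * (q - 1) := by
      simp only [weight]
      rw [sum_add_distrib, sum_boole, filter_filter]
      congr 1
      · rw [← hqρ1, ← hq1, ← Nat.cast_mul, ← Nat.cast_mul, ← h.sum_common_right hc, Nat.cast_sum]
      · rw [← hq1, ← Nat.cast_mul, ← h.bitangent_self hc, bitangent]
        simp only [and_self]
    linarith
  have hL : 0 ≤ lam q ρ := by
    rw [lam]
    split_ifs
    · have : (0 : ℝ) ≤ (q : ℝ) ^ 2 - 1 := by nlinarith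
      positivity
    · have h1 : (0 : ℝ) ≤ (q : ℝ) - 2 + ρ := by linarith
      have h2 : (0 : ℝ) ≤ (q : ℝ) + (1 - ρ) * (2 - ρ) := by nlinarith
      positivity
  have hXm : (q + 1 - ρ) * (q + 2 - ρ) / 2 < (q : ℝ) * (q + 1 - ρ) := by nlinarith
  have main := card_mul_card_le_of_meets (fun c d => ∃ x, inc c x ∧ inc d x)
    ({c | inc c P} : Finset ι) ({d | ¬ inc d P} : Finset ι) {c ∈ F | inc c P} {c ∈ F | ¬ inc c P}
    (fun c hc => by simpa using (mem_filter.1 hc).2)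
    (fun c hc => by simpa using (mem_filter.1 hc).2)
    (fun c hc d hd => hF c (mem_filter.1 hc).1 d (mem_filter.1 hd).1)
    ((q : ℝ) * (q + 1 - ρ)) ((q : ℝ) ^ 2 * (q - 1)) ((q + 1 - ρ) * (q + 2 - ρ) / 2)
    ((q * ((q - 1) * (q + 1 - ρ)) + q * (q - 1)) / 2) (lam q ρ)
    (by rw [h.card_through P]; push_cast [hqρ1]; ring)
    (by rw [h.card_not_through P]; push_cast [hq1]; ring)
    (by positivity) (mul_pos (by positivity) (by linarith)) hXm hL
    (fun d hd => by convert hcol d hd) (fun c hc => by convert hrow c hc)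
    (fun f hf => by convert hspec P f hf)
  refine main.trans_eq ?_
  congr 2
  -- The factor 2 is squared and cancels the 4 that comes from doubling the meeting matrix.
  have h5 : (q : ℝ) * (q + 1 - ρ) / (q * (q + 1 - ρ) - (q + 1 - ρ) * (q + 2 - ρ) / 2)
      = 2 * (q / (q + ρ - 2)) := by
    have h6 : (q : ℝ) + ρ - 2 ≠ 0 := by linarith
    have h7 : (q : ℝ) * (q + 1 - ρ) - (q + 1 - ρ) * (q + 2 - ρ) / 2
        = (q + 1 - ρ) * (q + ρ - 2) / 2 := by ring
    rw [h7]
    field_simp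
  rw [h5]
  ring

theorem familyBound_of_odd (h : IsCirclePlane q ρ inc par) (hr : Odd (q + 1 - ρ)) :
    FamilyBound q ρ inc :=
  h.familyBound_of_spectral fun P f => h.spectral_of_odd hr P f

theorem familyBound_of_type (h : IsCirclePlane q ρ inc par) (hq : Odd q) (hρ : Even ρ)
    {ty : ι → Prop} (ht : IsTyping inc ty) : FamilyBound q ρ inc :=
  h.familyBound_of_spectral fun P f => h.spectral_of_type hq hρ ht P f

end IsCirclePlane

end FamilyBound

end CircleGeometry

namespace CircleGeometry

/-! ### Linear functionals evaluated on an arc: the algebraic form of a cone. -/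

section Functional

open Finset
open scoped Classical

variable {K V A : Type*} [Field K] [AddCommGroup V] [Module K V]

/-- A graph of a linear functional on an arc: the points are the pairs `(a, s)` with `a` in the arc
and `s` a scalar. -/
def GraphInc (v : A → V) (g : Module.Dual K V) (x : A × K) : Prop := g (v x.1) = x.2

/-- An arc in a three-dimensional space: any three distinct vectors are linearly independent. -/
def IsArc (K : Type*) {V A : Type*} [Field K] [AddCommGroup V] [Module K V] (v : A → V) : Prop :=
  ∀ a b c, a ≠ b → a ≠ c → b ≠ c → LinearIndependent K ![v a, v b, v c]

/-- Three vectors of an arc form a basis. This provides existence and uniqueness of the circle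
through three points on different generators. -/
theorem IsArc.bijective {v : A → V} (hv : IsArc K v) (hV : Module.finrank K V = 3) {a b c : A}
    (hab : a ≠ b) (hac : a ≠ c) (hbc : b ≠ c) :
    Function.Bijective fun g : Module.Dual K V => (g (v a), g (v b), g (v c)) := by
  have hli := hv a b c hab hac hbc
  let B := basisOfLinearIndependentOfCardEqFinrank hli (by simp [hV])
  have hB : ∀ i, B i = ![v a, v b, v c] i := fun i => by simp [B]
  constructor
  · intro g g' h
    simp only [Prod.mk.injEq] at h
    refine B.ext fun i => ?_
    rw [hB]
    fin_cases i
    · exact h.1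
    · exact h.2.1
    · exact h.2.2
  · rintro ⟨s, t, u⟩
    refine ⟨B.constr K ![s, t, u], ?_⟩
    have h0 := B.constr_basis K ![s, t, u] 0
    have h1 := B.constr_basis K ![s, t, u] 1
    have h2 := B.constr_basis K ![s, t, u] 2
    rw [hB] at h0 h1 h2
    simp only [Prod.mk.injEq]
    exact ⟨h0, h1, h2⟩

variable [Fintype K] [Fintype A] [Fintype (Module.Dual K V)]

omit [Fintype K] [Fintype A] in
theorem IsArc.card_three {v : A → V} (hv : IsArc K v) (hV : Module.finrank K V = 3) {a b c : A}
    (hab : a ≠ b) (hac : a ≠ c) (hbc : b ≠ c) (s t u : K) :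
    #{g : Module.Dual K V | g (v a) = s ∧ g (v b) = t ∧ g (v c) = u} = 1 := by
  obtain ⟨hi, hs⟩ := hv.bijective hV hab hac hbc
  obtain ⟨g, hg⟩ := hs (s, t, u)
  simp only [Prod.mk.injEq] at hg
  rw [card_eq_one]
  refine ⟨g, ?_⟩
  ext g'
  simp only [mem_filter, mem_univ, true_and, mem_singleton]
  constructor
  · rintro ⟨h1, h2, h3⟩
    apply hi
    simp only [h1, h2, h3, hg]
  · rintro rfl
    exact hg

theorem IsArc.card_two {v : A → V} (hv : IsArc K v) (hV : Module.finrank K V = 3)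
    (hA : 3 ≤ Fintype.card A) {a b : A} (hab : a ≠ b) (s t : K) :
    #{g : Module.Dual K V | g (v a) = s ∧ g (v b) = t} = Fintype.card K := by
  obtain ⟨c, hc⟩ : ∃ c, c ∉ ({a, b} : Finset A) := by
    by_contra! h
    have : Fintype.card A ≤ #({a, b} : Finset A) := by
      rw [← card_univ]; exact card_le_card fun c _ => h c
    rw [card_pair hab] at this
    omega
  simp only [mem_insert, mem_singleton, not_or] at hc
  have h1 := card_eq_sum_card_fiberwise (s := ({g : Module.Dual K V | g (v a) = s ∧ g (v b) = t} :
    Finset _)) (t := (univ : Finset K)) (f := fun g => g (v c)) (by simp)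
  rw [h1, sum_congr rfl (g := fun _ => 1), ← card_eq_sum_ones, card_univ]
  intro u _
  rw [filter_filter, ← hv.card_three hV hab (Ne.symm hc.1) (Ne.symm hc.2) s t u]
  simp only [and_assoc]

theorem IsArc.card_one {v : A → V} (hv : IsArc K v) (hV : Module.finrank K V = 3)
    (hA : 3 ≤ Fintype.card A) (a : A) (s : K) :
    #{g : Module.Dual K V | g (v a) = s} = Fintype.card K ^ 2 := by
  obtain ⟨b, hb⟩ : ∃ b, b ≠ a := by
    by_contra! h
    have : Fintype.card A ≤ 1 := Fintype.card_le_one_iff.2 fun x y => by rw [h x, h y]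
    omega
  have h1 := card_eq_sum_card_fiberwise (s := ({g : Module.Dual K V | g (v a) = s} :
    Finset _)) (t := (univ : Finset K)) (f := fun g => g (v b)) (by simp)
  rw [h1, sum_congr rfl (g := fun _ => Fintype.card K), sum_const, card_univ, smul_eq_mul, sq]
  intro u _
  rw [filter_filter, ← hv.card_two hV hA (Ne.symm hb) s u]

omit [Fintype (Module.Dual K V)] in
theorem card_graph (v : A → V) (g : Module.Dual K V) (p : A → Prop) :
    #{x : A × K | GraphInc v g x ∧ p x.1} = #{a | p a} := by
  symm
  refine card_bij (fun a _ => (a, g (v a))) ?_ ?_ ?_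
  · intro a ha
    rw [mem_filter] at ha ⊢
    exact ⟨mem_univ _, rfl, ha.2⟩
  · intro a _ b _ h
    exact (Prod.mk.inj h).1
  · rintro ⟨a, s⟩ hx
    rw [mem_filter] at hx
    exact ⟨a, by simpa using hx.2.2, Prod.ext rfl hx.2.1⟩

theorem card_fst {K A : Type*} [Fintype K] [Fintype A] (p : A → Prop) :
    #{x : A × K | p x.1} = #{a | p a} * Fintype.card K := by
  have : ({x : A × K | p x.1} : Finset _) = ({a | p a} : Finset A) ×ˢ (univ : Finset K) := by
    ext x; simp
  rw [this, card_product, card_univ]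

theorem card_ne {A : Type*} [Fintype A] (a : A) : #{b | a ≠ b} = Fintype.card A - 1 := by
  have : ({b | a ≠ b} : Finset A) = univ.erase a := by ext; simp [eq_comm]
  rw [this, card_erase_of_mem (mem_univ a), card_univ]

theorem card_ne_ne {A : Type*} [Fintype A] {a b : A} (hab : a ≠ b) : #{c | a ≠ c ∧ b ≠ c} = Fintype.card A - 2 := by
  have : ({c | a ≠ c ∧ b ≠ c} : Finset A) = (univ.erase a).erase b := by
    ext; simp [eq_comm, and_comm]
  rw [this, card_erase_of_mem (by simpa using hab.symm), card_erase_of_mem (mem_univ a), card_univ]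
  omega

/-- Parallel points are those over the same element of the arc, that is, on the same generator; a
circle has one point on each generator, whence ρ = 1. -/
theorem IsArc.isCirclePlane {v : A → V} (hv : IsArc K v) (hV : Module.finrank K V = 3) {q : ℕ}
    (hq : 2 < q) (hK : Fintype.card K = q) (hA : Fintype.card A = q + 1) :
    IsCirclePlane q 1 (GraphInc (K := K) v) (fun x y => x.1 = y.1) where
  two_lt := hq
  rho_le := by norm_num
  refl _ := rfl
  symm h := h.symm
  card_circle g := by
    have := card_graph v g (fun _ => True)
    simpa [hA] using this
  eq_of_par := by
    rintro g ⟨a, s⟩ ⟨b, t⟩ h1 h2 (rfl : a = b)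
    simp only [GraphInc] at h1 h2
    rw [← h1, ← h2]
  exists_circle := by
    rintro ⟨a, s⟩ ⟨b, t⟩ ⟨c, u⟩ h1 h2 h3
    obtain ⟨g, hg⟩ := (hv.bijective hV h1 h2 h3).2 (s, t, u)
    simp only [Prod.mk.injEq] at hg
    exact ⟨g, hg⟩
  unique_circle := by
    rintro g g' ⟨a, s⟩ ⟨b, t⟩ ⟨c, u⟩ h1 h2 h3 h4 h5 h6 h7 h8 h9
    simp only [GraphInc] at h4 h5 h6 h7 h8 h9
    refine (hv.bijective hV (a := a) (b := b) (c := c) ?_ ?_ ?_).1 ?_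
    · rintro rfl; exact h1 (by rw [← h4, ← h5])
    · rintro rfl; exact h2 (by rw [← h4, ← h6])
    · rintro rfl; exact h3 (by rw [← h5, ← h6])
    · simp only [h4, h5, h6, h7, h8, h9]
  card_par := by
    rintro g ⟨a, s⟩ -
    have := card_graph v g (fun b => a = b)
    rw [filter_eq univ a, if_pos (mem_univ a), card_singleton] at this
    exact this
  card_not_par := by
    rintro ⟨a, s⟩
    calc _ = #{b | a ≠ b} * Fintype.card K := by convert card_fst (K := K) (fun b => a ≠ b)
      _ = (Fintype.card A - 1) * Fintype.card K := by congr 1; convert card_ne a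
      _ = q ^ 2 := by rw [hA, hK, Nat.add_sub_cancel, sq]
  card_not_par₂ := by
    rintro ⟨a, s⟩ ⟨b, t⟩ hab
    calc _ = #{c | a ≠ c ∧ b ≠ c} * Fintype.card K := by
          convert card_fst (K := K) (fun c => a ≠ c ∧ b ≠ c)
      _ = (Fintype.card A - 2) * Fintype.card K := by congr 1; convert card_ne_ne hab
      _ = _ := by rw [hA, hK, Nat.add_sub_cancel, show q - 1 = q + 1 - 2 by omega]

/-- A line meets a hyperoval in no or two points. -/
theorem IsArc.card_zeros {v : A → V} (hv : IsArc K v) (hV : Module.finrank K V = 3) {q : ℕ}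
    (hq : 2 < q) (hK : Fintype.card K = q) (hA : Fintype.card A = q + 2) {g : Module.Dual K V}
    (hg : g ≠ 0) {a : A} (ha : g (v a) = 0) : #{b | g (v b) = 0} = 2 := by
  have hA3 : 3 ≤ Fintype.card A := by omega
  have hle : ∀ g ∈ ({g : Module.Dual K V | g (v a) = 0} : Finset _).erase 0,
      #{b ∈ univ.erase a | g (v b) = 0} ≤ 1 := by
    intro g hg
    simp only [mem_erase, mem_filter, mem_univ, true_and] at hg
    rw [card_le_one]
    intro b hb c hc
    simp only [mem_erase, mem_filter, mem_univ, and_true] at hb hc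
    by_contra hne
    refine hg.1 ((hv.bijective hV (Ne.symm hb.1) (Ne.symm hc.1) hne).1 ?_)
    simp [hg.2, hb.2, hc.2]
  -- Each of the q + 1 other arc points is a zero of q - 1 nonzero functionals vanishing at `v a`.
  -- This makes q² - 1 further zeros for q² - 1 functionals with at most one each, so each has
  -- exactly one.
  have hsum : ∑ g ∈ ({g : Module.Dual K V | g (v a) = 0} : Finset _).erase 0,
      #{b ∈ univ.erase a | g (v b) = 0}
      = ∑ g ∈ ({g : Module.Dual K V | g (v a) = 0} : Finset _).erase 0, 1 := by
    have key := sum_card_bipartiteAbove_eq_sum_card_bipartiteBelow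
      (s := ({g : Module.Dual K V | g (v a) = 0} : Finset _).erase 0) (t := univ.erase a)
      (fun g b => g (v b) = 0)
    have h2 : ∀ b ∈ univ.erase a, #(bipartiteBelow (fun (g : Module.Dual K V) b => g (v b) = 0)
        (({g : Module.Dual K V | g (v a) = 0} : Finset _).erase 0) b) = q - 1 := by
      intro b hb
      simp only [mem_erase, mem_univ, and_true] at hb
      have h3 : bipartiteBelow (fun (g : Module.Dual K V) b => g (v b) = 0)
        (({g : Module.Dual K V | g (v a) = 0} : Finset _).erase 0) b
        = ({g : Module.Dual K V | g (v a) = 0 ∧ g (v b) = 0} : Finset _).erase 0 := by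
        ext g; simp [bipartiteBelow, and_assoc]
      rw [h3, card_erase_of_mem (by simp), hv.card_two hV hA3 (Ne.symm hb), hK]
    rw [sum_congr rfl h2, sum_const, card_erase_of_mem (mem_univ a), card_univ, hA,
      smul_eq_mul] at key
    refine key.trans ?_
    rw [← card_eq_sum_ones, card_erase_of_mem (by simp), hv.card_one hV hA3, hK]
    obtain ⟨n, rfl⟩ : ∃ n, q = n + 1 := ⟨q - 1, by omega⟩
    simp only [Nat.add_sub_cancel, show n + 1 + 2 - 1 = n + 2 by omega]
    have : (n + 1) ^ 2 = (n + 2) * n + 1 := by ring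
    omega
  have h1 := (sum_eq_sum_iff_of_le hle).1 hsum g (by simpa using ⟨hg, ha⟩)
  have h2 : ({b ∈ univ.erase a | g (v b) = 0} : Finset A)
      = ({b | g (v b) = 0} : Finset A).erase a := by ext; simp [and_comm]
  have hmem : a ∈ ({b | g (v b) = 0} : Finset A) := by simpa using ha
  rw [h2, card_erase_of_mem hmem] at h1
  have := card_pos.2 ⟨a, hmem⟩
  omega

/-- Coincidences of two functionals are zeros of their difference, hence none or two. There is no
tangency, and `common` alone plays the part of `weight`. -/
theorem IsArc.common_graph {v : A → V} (hv : IsArc K v) (hV : Module.finrank K V = 3) {q : ℕ}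
    (hq : 2 < q) (hK : Fintype.card K = q) (hA : Fintype.card A = q + 2) {g g' : Module.Dual K V}
    (hg : g ≠ g') : (common (GraphInc (K := K) v) g' g : ℝ) =
      2 * if (∃ x, GraphInc v g x ∧ GraphInc v g' x) then 1 else 0 := by
  have h1 : common (GraphInc (K := K) v) g' g = #{a | (g - g') (v a) = 0} := by
    have := card_graph v g' (fun a => g (v a) = g' (v a))
    rw [common]
    simp only [LinearMap.sub_apply, sub_eq_zero]
    rw [← this]
    congr 1
    ext x
    rw [mem_filter, mem_filter]
    refine and_congr_right fun _ => and_congr_right fun h => ?_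
    rw [GraphInc] at h ⊢
    rw [h]
  split_ifs with h
  · obtain ⟨⟨a, s⟩, h2, h3⟩ := h
    simp only [GraphInc] at h2 h3
    rw [h1, hv.card_zeros hV hq hK hA (sub_ne_zero.2 hg) (a := a) (by simp [h2, h3])]
    norm_num
  · rw [common, mul_zero, Nat.cast_eq_zero, card_eq_zero, filter_eq_empty_iff]
    rintro x - ⟨h2, h3⟩
    exact h ⟨x, h3, h2⟩

end Functional

end CircleGeometry

namespace CircleGeometry

/-! ### The bound for extended Laguerre planes. -/

section Hyperoval

open Finset
open scoped Classical

variable {K V A : Type*} [Field K] [AddCommGroup V] [Module K V]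
  [Fintype K] [Fintype A] [Fintype (Module.Dual K V)]

/-- With q + 2 generators the circle plane axioms fail, but the count is simpler: the Gram matrix of
`common` is q²(q - 1)I + (q + 2)q(q - 1)J, and λ = q²(q - 1) is its eigenvalue on vectors of sum
zero. -/
theorem IsArc.familyBound {v : A → V} (hv : IsArc K v) (hV : Module.finrank K V = 3) {q : ℕ}
    (hq : 2 < q) (hqe : Even q) (hK : Fintype.card K = q) (hA : Fintype.card A = q + 2) :
    FamilyBound q 1 (GraphInc (K := K) v) := by
  rintro F ⟨a, s⟩ hF
  have hA3 : 3 ≤ Fintype.card A := by omega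
  have hq3 : (3 : ℝ) ≤ q := by exact_mod_cast hq
  have hq1 : ((q - 1 : ℕ) : ℝ) = (q : ℝ) - 1 := by rw [Nat.cast_sub (by omega)]; simp
  set C : Finset (Module.Dual K V) := {g | g (v a) = s} with hC
  set D : Finset (Module.Dual K V) := {g | ¬ g (v a) = s} with hD
  have hCc : (#C : ℝ) = q ^ 2 := by rw [hC, hv.card_one hV hA3, hK]; simp
  have hthr : ∀ {b}, b ≠ a → ∀ t, (#{g : Module.Dual K V | g (v b) = t ∧ ¬ g (v a) = s} : ℝ)
      = q ^ 2 - q := by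
    intro b hb t
    have h1 := hv.card_one hV hA3 b t
    rw [← card_filter_add_card_filter_not (fun g : Module.Dual K V => g (v a) = s), filter_filter,
      filter_filter, hv.card_two hV hA3 hb, hK] at h1
    rw [eq_sub_iff_add_eq, ← Nat.cast_pow, ← h1]
    push_cast
    ring
  have hthr2 : ∀ {b c}, b ≠ a → c ≠ a → b ≠ c → ∀ t u,
      (#{g : Module.Dual K V | (g (v b) = t ∧ ¬ g (v a) = s) ∧ g (v c) = u} : ℝ) = q - 1 := by
    intro b c hb hc hbc t u
    have h1 := hv.card_two hV hA3 hbc t u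
    have h2 := hv.card_three hV hbc hb hc t u s
    rw [← card_filter_add_card_filter_not (fun g : Module.Dual K V => g (v a) = s), filter_filter,
      filter_filter, hK] at h1
    simp only [and_assoc] at h1
    rw [h2] at h1
    have h3 : #{g : Module.Dual K V | (g (v b) = t ∧ ¬ g (v a) = s) ∧ g (v c) = u} =
        #{g : Module.Dual K V | g (v b) = t ∧ g (v c) = u ∧ ¬ g (v a) = s} := by
      congr 1; ext; simp; tauto
    rw [h3, eq_sub_iff_add_eq, ← h1]
    push_cast
    ring
  have hgr : ∀ {g : Module.Dual K V}, g ∈ C → ∀ x : A × K, GraphInc v g x ∧ x ≠ (a, s) ↔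
      GraphInc v g x ∧ x.1 ≠ a := by
    rintro g hg ⟨b, t⟩
    simp only [hC, mem_filter, mem_univ, true_and] at hg
    refine and_congr_right fun h => not_congr ⟨fun h1 => (Prod.mk.inj h1).1, fun h1 => ?_⟩
    simp only [GraphInc] at h
    simp only at h1
    subst h1
    rw [← h, hg]
  have hgc : ∀ {g : Module.Dual K V}, g ∈ C → #{x : A × K | GraphInc v g x ∧ x ≠ (a, s)}
      = q + 1 := by
    intro g hg
    have h1 := card_graph v g (fun b => b ≠ a)
    have h2 : #{b | b ≠ a} = Fintype.card A - 1 := by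
      rw [← card_ne a]; congr 1; ext; simp [eq_comm]
    calc _ = #{x : A × K | GraphInc v g x ∧ x.1 ≠ a} := by
          congr 1; ext x; rw [mem_filter, mem_filter, hgr hg]
      _ = #{b | b ≠ a} := by convert h1
      _ = q + 1 := by rw [h2, hA]; rfl
  have hDP : ∀ g ∈ D, ¬ GraphInc v g (a, s) := by
    intro g hg
    simpa [hD, GraphInc] using hg
  have hne : ∀ {g g'}, g ∈ C → g' ∈ D → g ≠ g' := by
    rintro g g' h1 h2 rfl
    simp only [hC, hD, mem_filter, mem_univ, true_and] at h1 h2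
    exact h2 h1
  have hsum : ∀ (E : Finset (Module.Dual K V)), (∀ d ∈ E, ¬ GraphInc v d (a, s)) →
      ∀ (c : Module.Dual K V) (f : Module.Dual K V → ℝ),
      ∑ d ∈ E, f d * common (GraphInc (K := K) v) d c =
        ∑ x ∈ ({x | GraphInc v c x ∧ x ≠ (a, s)} : Finset (A × K)),
          ∑ d ∈ E with GraphInc v d x, f d := by
    intro E hE c f
    convert IsCirclePlane.sum_common_eq E hE c f
  -- Sort by the generator of the common point with `g'`. Each of the q generators other than those
  -- of `P` and x contributes q - 1 circles; the generator of x contributes q² - q if `g'` passes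
  -- through x and nothing otherwise.
  have hZ : ∀ {g g'}, g ∈ C → g' ∈ C → ∀ x ∈ ({x | GraphInc v g x ∧ x ≠ (a, s)} : Finset (A × K)),
      ∑ d ∈ D with GraphInc v d x, (common (GraphInc (K := K) v) d g' : ℝ) =
      q * (q - 1) + if GraphInc v g' x then (q : ℝ) * (q - 1) else 0 := by
    rintro g g' hg hg' ⟨b, t⟩ hx
    rw [mem_filter, hgr hg] at hx
    have hba : b ≠ a := hx.2.2
    have h1 := hsum
      (D.filter fun d => GraphInc v d (b, t)) (fun d hd => hDP d (mem_filter.1 hd).1) g'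
      (fun _ => 1)
    simp only [one_mul] at h1
    rw [h1]
    have h2 : ∀ y ∈ ({x | GraphInc v g' x ∧ x ≠ (a, s)} : Finset (A × K)),
        ∑ d ∈ D.filter (fun d => GraphInc v d (b, t)) with GraphInc v d y, (1 : ℝ) =
        if b = y.1 then (if GraphInc v g' (b, t) then (q : ℝ) ^ 2 - q else 0) else q - 1 := by
      rintro ⟨c, u⟩ hy
      rw [mem_filter, hgr hg'] at hy
      have hca : c ≠ a := hy.2.2
      rw [sum_const, nsmul_eq_mul, mul_one, filter_filter, filter_filter]
      simp only
      split_ifs with h3 h4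
      · subst h3
        have hut : u = t := hy.2.1.symm.trans h4
        subst hut
        rw [← hthr hba u]
        congr 2
        ext d
        rw [mem_filter, mem_filter]
        simp only [GraphInc]
        tauto
      · subst h3
        rw [Nat.cast_eq_zero, card_eq_zero, filter_eq_empty_iff]
        rintro d - ⟨-, h5, h6⟩
        simp only [GraphInc] at h5 h6 h4 hy
        exact h4 (by rw [hy.2.1, ← h6, h5])
      · rw [← hthr2 hba hca h3 t u]
        congr 2
        ext d
        rw [mem_filter, mem_filter]
        simp only [GraphInc]
        tauto
    rw [sum_congr rfl h2, sum_ite, sum_const, sum_const, filter_filter, filter_filter]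
    have h3 : #{x : A × K | (GraphInc v g' x ∧ x ≠ (a, s)) ∧ b = x.1} = 1 := by
      rw [card_eq_one]
      refine ⟨(b, g' (v b)), ?_⟩
      ext ⟨c, u⟩
      rw [mem_filter, hgr hg', mem_singleton, Prod.mk.injEq]
      simp only [GraphInc, mem_univ, true_and]
      constructor
      · rintro ⟨⟨h5, h6⟩, rfl⟩
        exact ⟨rfl, h5.symm⟩
      · rintro ⟨rfl, rfl⟩
        exact ⟨⟨rfl, hba⟩, rfl⟩
    have h4 := card_filter_add_card_filter_not (s := ({x | GraphInc v g' x ∧ x ≠ (a, s)} :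
      Finset (A × K))) (fun x => b = x.1)
    rw [hgc hg', filter_filter, filter_filter, h3] at h4
    have h5 : #{x : A × K | (GraphInc v g' x ∧ x ≠ (a, s)) ∧ ¬ b = x.1} = q := by omega
    rw [h3, h5]
    split_ifs <;> simp <;> ring
  have hG : ∀ {g g'}, g ∈ C → g' ∈ C → ∑ d ∈ D, (common (GraphInc (K := K) v) d g : ℝ) *
      common (GraphInc (K := K) v) d g' =
      (q + 2) * (q * (q - 1)) + (q : ℝ) ^ 2 * (q - 1) * if g = g' then 1 else 0 := by
    intro g g' hg hg'
    have h1 := hsum D hDP g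
      (fun d => (common (GraphInc (K := K) v) d g' : ℝ))
    rw [sum_congr rfl fun d _ => mul_comm _ _, h1, sum_congr rfl (hZ hg hg'), sum_add_distrib,
      sum_const, hgc hg, ← sum_filter, sum_const, filter_filter]
    -- Two distinct circles through (a, s) share exactly one further point.
    have h2 : (#{x : A × K | (GraphInc v g x ∧ x ≠ (a, s)) ∧ GraphInc v g' x} : ℝ)
        = 1 + q * if g = g' then 1 else 0 := by
      by_cases hgg : g = g'
      · subst hgg
        rw [if_pos rfl, mul_one, add_comm, ← Nat.cast_add_one, ← hgc hg]
        congr 2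
        ext x
        rw [mem_filter, mem_filter]
        tauto
      · have h3 := hv.common_graph hV hq hK hA hgg
        have hga : GraphInc v g (a, s) := by simpa [hC, GraphInc] using hg
        have hga' : GraphInc v g' (a, s) := by simpa [hC, GraphInc] using hg'
        rw [if_pos ⟨_, hga, hga'⟩] at h3
        have h4 : ({x | (GraphInc v g x ∧ x ≠ (a, s)) ∧ GraphInc v g' x} : Finset (A × K))
            = ({x | GraphInc v g' x ∧ GraphInc v g x} : Finset (A × K)).erase (a, s) := by
          ext x
          rw [mem_filter, mem_erase, mem_filter]
          tauto
        have h5 : #{x : A × K | (GraphInc v g x ∧ x ≠ (a, s)) ∧ GraphInc v g' x} + 1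
            = common (GraphInc (K := K) v) g' g := by
          rw [h4, common]
          exact card_erase_add_one (by rw [mem_filter]; exact ⟨mem_univ _, hga', hga⟩)
        rw [← h5] at h3
        push_cast at h3
        rw [if_neg hgg]
        linarith
    rw [nsmul_eq_mul, nsmul_eq_mul, h2]
    push_cast
    ring
  have hmeet : ∀ {g g'}, g ∈ C → g' ∈ D →
      (2 * if (∃ x, GraphInc v g x ∧ GraphInc v g' x) then 1 else 0 : ℝ) =
      common (GraphInc (K := K) v) g' g :=
    fun hg hg' => (hv.common_graph hV hq hK hA (hne hg hg')).symm
  have hDcard : (#D : ℝ) = q ^ 2 * (q - 1) := by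
    obtain ⟨b, hb⟩ : ∃ b, b ≠ a := by
      by_contra! h
      have : Fintype.card A ≤ 1 := Fintype.card_le_one_iff.2 fun x y => by rw [h x, h y]
      omega
    have h1 := card_eq_sum_card_fiberwise (s := D) (t := (univ : Finset K))
      (f := fun g => g (v b)) (by simp)
    rw [h1, Nat.cast_sum, sum_congr rfl (g := fun _ => (q : ℝ) ^ 2 - q), sum_const, card_univ, hK,
      nsmul_eq_mul]
    · ring
    · intro u _
      rw [hD, filter_filter, ← hthr hb u]
      simp only [and_comm]
  have hrow : ∀ g ∈ C, (#{d ∈ D | ∃ x, GraphInc (K := K) v g x ∧ GraphInc v d x} : ℝ)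
      = (q + 1) * (q ^ 2 - q) / 2 := by
    intro g hg
    have h1 : (2 : ℝ) * #{d ∈ D | ∃ x, GraphInc v g x ∧ GraphInc v d x} =
        ∑ d ∈ D, 1 * (common (GraphInc (K := K) v) d g : ℝ) := by
      rw [← sum_boole, mul_sum]
      exact sum_congr rfl fun d hd => by rw [one_mul, hmeet hg hd]
    rw [hsum D hDP] at h1
    have h2 : ∀ x ∈ ({x | GraphInc v g x ∧ x ≠ (a, s)} : Finset (A × K)),
        ∑ d ∈ D with GraphInc v d x, (1 : ℝ) = q ^ 2 - q := by
      rintro ⟨b, t⟩ hx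
      rw [mem_filter, hgr hg] at hx
      rw [sum_const, nsmul_eq_mul, mul_one, filter_filter, ← hthr hx.2.2 t]
      congr 2
      ext d
      rw [mem_filter, mem_filter]
      simp only [GraphInc]
      tauto
    rw [sum_congr rfl h2, sum_const, hgc hg, nsmul_eq_mul] at h1
    push_cast at h1
    linarith
  have hcol : ∀ d ∈ D, (#{g ∈ C | ∃ x, GraphInc (K := K) v g x ∧ GraphInc v d x} : ℝ)
      = (q + 1) * q / 2 := by
    intro d hd
    have h1 : (2 : ℝ) * #{g ∈ C | ∃ x, GraphInc v g x ∧ GraphInc v d x} =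
        ∑ g ∈ C, (common (GraphInc (K := K) v) d g : ℝ) := by
      rw [← sum_boole, mul_sum]
      exact sum_congr rfl fun g hg => hmeet hg hd
    have h2 : ∑ g ∈ C, common (GraphInc (K := K) v) d g = (q + 1) * q := by
      have key := sum_card_bipartiteAbove_eq_sum_card_bipartiteBelow (s := C)
        (t := ({b | a ≠ b} : Finset A)) (fun g b => g (v b) = d (v b))
      have h3 : ∀ b ∈ ({b | a ≠ b} : Finset A),
          #(bipartiteBelow (fun (g : Module.Dual K V) b => g (v b) = d (v b)) C b) = q := by
        intro b hb
        simp only [mem_filter, mem_univ, true_and] at hb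
        rw [← hK, ← hv.card_two hV hA3 hb s (d (v b)), bipartiteBelow, hC, filter_filter]
      rw [sum_congr rfl h3, sum_const, card_ne, hA, smul_eq_mul] at key
      refine Eq.trans (sum_congr rfl fun g hg => ?_) key
      have h4 := card_graph v d (fun b => a ≠ b ∧ g (v b) = d (v b))
      rw [bipartiteAbove, filter_filter]
      calc common (GraphInc (K := K) v) d g
          = #{x : A × K | GraphInc v d x ∧ a ≠ x.1 ∧ g (v x.1) = d (v x.1)} := by
            rw [common]
            congr 1
            ext ⟨b, t⟩
            rw [mem_filter, mem_filter]
            refine and_congr_right fun _ => and_congr_right fun h5 => ?_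
            simp only [GraphInc] at h5 ⊢
            rw [h5]
            refine ⟨fun h6 => ⟨?_, h6⟩, fun h6 => h6.2⟩
            rintro rfl
            simp only [hC, hD, mem_filter, mem_univ, true_and] at hg hd
            exact hd (by rw [h5, ← h6, hg])
        _ = #{b | a ≠ b ∧ g (v b) = d (v b)} := by convert h4
        _ = _ := by congr!
    rw [← Nat.cast_sum, h2] at h1
    push_cast at h1
    linarith
  have hspec : ∀ f : Module.Dual K V → ℝ, ∑ c ∈ C, f c = 0 →
      4 * ∑ d ∈ D, (∑ c ∈ C with ∃ x, GraphInc v c x ∧ GraphInc v d x, f c) ^ 2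
        ≤ lam q 1 * ∑ c ∈ C, f c ^ 2 := by
    intro f hf
    have h1 : 4 * ∑ d ∈ D, (∑ c ∈ C with ∃ x, GraphInc v c x ∧ GraphInc v d x, f c) ^ 2
        = ∑ d ∈ D, (∑ c ∈ C, (common (GraphInc (K := K) v) d c : ℝ) * f c) ^ 2 := by
      rw [mul_sum]
      refine sum_congr rfl fun d hd => ?_
      have : ∑ c ∈ C, (common (GraphInc (K := K) v) d c : ℝ) * f c =
          2 * ∑ c ∈ C with ∃ x, GraphInc v c x ∧ GraphInc v d x, f c := by
        rw [sum_filter (s := C), mul_sum]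
        refine sum_congr rfl fun c hc => ?_
        rw [← hmeet hc hd]
        split_ifs <;> ring
      rw [this]
      ring
    rw [h1, sum_sq_eq_sum_gram C D (fun c d => (common (GraphInc (K := K) v) d c : ℝ))]
    have h2 : ∀ c ∈ C, ∑ c' ∈ C, f c * f c' * ∑ d ∈ D,
        (common (GraphInc (K := K) v) d c : ℝ) * common (GraphInc (K := K) v) d c' =
        (q + 2) * (q * (q - 1)) * (f c * ∑ c' ∈ C, f c') +
        (q : ℝ) ^ 2 * (q - 1) * ∑ c' ∈ C, f c * f c' * (if c = c' then 1 else 0) := by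
      intro c hc
      rw [mul_sum, mul_sum, mul_sum, ← sum_add_distrib]
      refine sum_congr rfl fun c' hc' => ?_
      rw [hG hc hc']
      ring
    rw [sum_congr rfl h2, sum_add_distrib, ← mul_sum, ← mul_sum, sum_sum_mul_eq, hf]
    have h3 : lam q 1 = (q : ℝ) ^ 2 * (q - 1) := by
      rw [lam, if_neg (Nat.not_odd_iff_even.2 hqe)]
      push_cast; ring
    rw [h3]
    simp
  have hL : 0 ≤ lam q 1 := by
    rw [lam, if_neg (Nat.not_odd_iff_even.2 hqe)]
    push_cast
    have : (0 : ℝ) ≤ (q : ℝ) - 2 + 1 := by linarith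
    have h2 : (0 : ℝ) ≤ (q : ℝ) + (1 - 1) * (2 - 1) := by linarith
    positivity
  have main := card_mul_card_le_of_meets
    (fun c d => ∃ x, GraphInc (K := K) v c x ∧ GraphInc v d x)
    C D {c ∈ F | GraphInc v c (a, s)} {c ∈ F | ¬ GraphInc v c (a, s)}
    (fun c hc => mem_filter.2 ⟨mem_univ c, (mem_filter.1 hc).2⟩)
    (fun c hc => mem_filter.2 ⟨mem_univ c, (mem_filter.1 hc).2⟩)
    (fun c hc d hd => hF c (mem_filter.1 hc).1 d (mem_filter.1 hd).1)
    ((q : ℝ) ^ 2) ((q : ℝ) ^ 2 * (q - 1)) ((q + 1) * q / 2)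
    ((q + 1) * (q ^ 2 - q) / 2) (lam q 1) hCc hDcard
    (by positivity) (mul_pos (by positivity) (by linarith)) (by nlinarith) hL
    (fun d hd => by convert hcol d hd) (fun c hc => by convert hrow c hc)
    (fun f hf => by convert hspec f hf)
  have h5 : (q : ℝ) ^ 2 / (q ^ 2 - (q + 1) * q / 2) = 2 * (q / (q + (1 : ℕ) - 2)) := by
    have h7 : (q : ℝ) ^ 2 - (q + 1) * q / 2 = q * (q - 1) / 2 := by ring
    have h6 : (q : ℝ) - 1 ≠ 0 := by linarith
    have h8 : (q : ℝ) + (1 : ℕ) - 2 = q - 1 := by push_cast; ring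
    rw [h7, h8]
    field_simp
  rw [h5] at main
  refine main.trans_eq ?_
  rw [show (q : ℝ) * (q + 1 - (1 : ℕ)) = q ^ 2 by push_cast; ring]
  ring

end Hyperoval

end CircleGeometry

namespace CircleGeometry

/-! ### Points, lines and planes of PG(3, K) in coordinates. -/

section SpaceBasics

variable {K : Type u} [Field K]

theorem mem_pointsOf {W : Flat K} {X : PG3 K} : X ∈ pointsOf W ↔ X.rep ∈ W := by
  change X.submodule ≤ W ↔ _
  rw [Projectivization.submodule_eq, Submodule.span_singleton_le_iff_mem]

theorem mk_mem_pointsOf {W : Flat K} {v : Fin 4 → K} (hv : v ≠ 0) :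
    Projectivization.mk K v hv ∈ pointsOf W ↔ v ∈ W := by
  change (Projectivization.mk K v hv).submodule ≤ W ↔ _
  rw [Projectivization.submodule_mk, Submodule.span_singleton_le_iff_mem]

theorem pointsOf_mono {W U : Flat K} (h : W ≤ U) : pointsOf W ⊆ pointsOf U :=
  fun _ hX => le_trans hX h

theorem mem_span₂ {X Y : PG3 K} {v : Fin 4 → K} :
    v ∈ span₂ X Y ↔ ∃ a b : K, a • X.rep + b • Y.rep = v := by
  rw [span₂, Projectivization.submodule_eq, Projectivization.submodule_eq,
    ← Submodule.span_insert, Submodule.mem_span_pair]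

theorem left_mem_span₂ (X Y : PG3 K) : X ∈ pointsOf (span₂ X Y) :=
  show X.submodule ≤ _ from le_sup_left

theorem right_mem_span₂ (X Y : PG3 K) : Y ∈ pointsOf (span₂ X Y) :=
  show Y.submodule ≤ _ from le_sup_right

theorem span₂_le {X Y : PG3 K} {W : Flat K} (hX : X ∈ pointsOf W) (hY : Y ∈ pointsOf W) :
    span₂ X Y ≤ W := sup_le hX hY

theorem linearIndependent_rep {X Y : PG3 K} (h : X ≠ Y) : LinearIndependent K ![X.rep, Y.rep] :=
  Projectivization.linearIndependent_pair_iff_ne.2 h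

theorem isLine_span₂ {X Y : PG3 K} (h : X ≠ Y) : IsLine (span₂ X Y) := by
  have h1 : span₂ X Y = Submodule.span K (Set.range ![X.rep, Y.rep]) := by
    ext v
    rw [mem_span₂, Matrix.range_cons, Matrix.range_cons, Matrix.range_empty, Set.union_empty,
      Set.singleton_union, Submodule.mem_span_pair]
  rw [IsLine, h1, finrank_span_eq_card (linearIndependent_rep h), Fintype.card_fin]

theorem span₂_eq {X Y : PG3 K} (h : X ≠ Y) {l : Flat K} (hl : IsLine l) (hX : X ∈ pointsOf l)
    (hY : Y ∈ pointsOf l) : span₂ X Y = l :=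
  Submodule.eq_of_le_of_finrank_eq (span₂_le hX hY) (by rw [hl, isLine_span₂ h])

theorem span₂_mk {u v : Fin 4 → K} (hu : u ≠ 0) (hv : v ≠ 0) :
    span₂ (Projectivization.mk K u hu) (Projectivization.mk K v hv) = Submodule.span K {u, v} := by
  rw [span₂, Projectivization.submodule_mk, Projectivization.submodule_mk,
    ← Submodule.span_insert]

theorem linearIndependent_three_iff {V : Type*} [AddCommGroup V] [Module K V] {u v w : V} :
    LinearIndependent K ![u, v, w] ↔
      ∀ a b c : K, a • u + b • v + c • w = 0 → a = 0 ∧ b = 0 ∧ c = 0 := by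
  rw [Fintype.linearIndependent_iff]
  constructor
  · intro h a b c habc
    have h1 := h ![a, b, c] (by simpa [Fin.sum_univ_three] using habc)
    exact ⟨h1 0, h1 1, h1 2⟩
  · intro h g hg
    rw [Fin.sum_univ_three] at hg
    obtain ⟨h0, h1, h2⟩ := h _ _ _ hg
    intro i
    fin_cases i
    · exact h0
    · exact h1
    · exact h2

theorem linearIndependent_triple {X Y Z : PG3 K} (h : X ≠ Y) (hZ : Z ∉ pointsOf (span₂ X Y)) :
    LinearIndependent K ![X.rep, Y.rep, Z.rep] := by
  rw [linearIndependent_three_iff]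
  intro a b c habc
  have hc : c = 0 := by
    by_contra hc
    refine hZ (mem_pointsOf.2 (mem_span₂.2 ⟨-(c⁻¹ * a), -(c⁻¹ * b), ?_⟩))
    have h1 : c • Z.rep = -(a • X.rep) - b • Y.rep := by
      rw [eq_sub_iff_add_eq, eq_neg_iff_add_eq_zero, ← habc]; abel
    rw [← one_smul K Z.rep, ← inv_mul_cancel₀ hc, mul_smul, h1]
    module
  subst hc
  rw [zero_smul, add_zero] at habc
  obtain ⟨ha, hb⟩ := (LinearIndependent.pair_iff (x := X.rep) (y := Y.rep)).1
    (linearIndependent_rep h) a b habc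
  exact ⟨ha, hb, rfl⟩

theorem noThreeCollinear_iff [Finite K] {s : Set (PG3 K)} : NoThreeCollinear s ↔
    ∀ X ∈ s, ∀ Y ∈ s, ∀ Z ∈ s, X ≠ Y → X ≠ Z → Y ≠ Z → Z ∉ pointsOf (span₂ X Y) := by
  constructor
  · intro h X hX Y hY Z hZ hXY hXZ hYZ hl
    have h1 := h _ (isLine_span₂ hXY)
    rw [← not_lt] at h1
    exact h1 ((Set.two_lt_ncard_iff (Set.toFinite _)).2 ⟨X, Y, Z, ⟨hX, left_mem_span₂ X Y⟩,
      ⟨hY, right_mem_span₂ X Y⟩, ⟨hZ, hl⟩, hXY, hXZ, hYZ⟩)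
  · intro h l hl
    by_contra! h1
    obtain ⟨X, Y, Z, hX, hY, hZ, hXY, hXZ, hYZ⟩ := (Set.two_lt_ncard_iff (Set.toFinite _)).1 h1
    refine h X hX.1 Y hY.1 Z hZ.1 hXY hXZ hYZ ?_
    rw [span₂_eq hXY hl hX.2 hY.2]
    exact hZ.2

theorem NoThreeCollinear.mono {s t : Set (PG3 K)} [Finite K] (h : NoThreeCollinear t)
    (hst : s ⊆ t) : NoThreeCollinear s := fun l hl =>
  (Set.ncard_le_ncard (Set.inter_subset_inter_left _ hst)).trans (h l hl)

theorem exists_dual_of_notMem {p : Flat K} (hp : IsPlane p) {R : PG3 K} (hR : R ∉ pointsOf p) :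
    ∃ f : Module.Dual K (Fin 4 → K), LinearMap.ker f = p ∧ f R.rep = 1 := by
  obtain ⟨f, hf, hle⟩ := Submodule.exists_le_ker_of_notMem (fun h => hR (mem_pointsOf.2 h))
  have hf0 : f ≠ 0 := by rintro rfl; exact hf rfl
  have h1 := Module.Dual.finrank_ker_add_one_of_ne_zero (f := f) hf0
  rw [Module.finrank_fin_fun] at h1
  have h2 : p = LinearMap.ker f := Submodule.eq_of_le_of_finrank_eq hle (by rw [hp]; omega)
  refine ⟨(f R.rep)⁻¹ • f, ?_, by simp [hf]⟩
  rw [LinearMap.ker_smul _ _ (inv_ne_zero hf), h2]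

theorem isPlane_ker {f : Module.Dual K (Fin 4 → K)} (hf : f ≠ 0) : IsPlane (LinearMap.ker f) := by
  have h1 := Module.Dual.finrank_ker_add_one_of_ne_zero (f := f) hf
  rw [Module.finrank_fin_fun] at h1
  rw [IsPlane]
  omega

end SpaceBasics

/-! ### Cones: Laguerre planes and extended Laguerre planes. -/

section Cone

variable {K : Type u} [Field K] {p : Flat K} {R : PG3 K}

theorem eq_zero_of_smul_mem (hR : R ∉ pointsOf p) {s : K} (h : s • R.rep ∈ p) : s = 0 := by
  by_contra hs
  exact hR (mem_pointsOf.2 ((Submodule.smul_mem_iff p hs).1 h))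

theorem add_smul_ne_zero (hR : R ∉ pointsOf p) (Y : pointsOf p) (s : K) :
    (Y : PG3 K).rep + s • R.rep ≠ 0 := by
  intro h
  have h1 : s = 0 := eq_zero_of_smul_mem hR <| by
    rw [← neg_eq_of_add_eq_zero_right h]
    exact p.neg_mem (mem_pointsOf.1 Y.2)
  rw [h1, zero_smul, add_zero] at h
  exact (Y : PG3 K).rep_nonzero h

/-- The point with coordinate `s` on the generator through `Y` of a cone with vertex `R`. -/
noncomputable def conePoint (hR : R ∉ pointsOf p) (Y : pointsOf p) (s : K) : PG3 K :=
  Projectivization.mk K ((Y : PG3 K).rep + s • R.rep) (add_smul_ne_zero hR Y s)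

theorem conePoint_inj (hR : R ∉ pointsOf p) {Y Y' : pointsOf p} {s s' : K}
    (h : conePoint hR Y s = conePoint hR Y' s') : Y = Y' ∧ s = s' := by
  rw [conePoint, conePoint, Projectivization.mk_eq_mk_iff'] at h
  obtain ⟨a, ha⟩ := h
  have h1 : a * s' - s = 0 := eq_zero_of_smul_mem hR <| by
    have : (a * s' - s) • R.rep = (Y : PG3 K).rep - a • (Y' : PG3 K).rep := by
      rw [sub_smul, mul_smul, sub_eq_sub_iff_add_eq_add, ← ha, smul_add]; abel
    rw [this]
    exact p.sub_mem (mem_pointsOf.1 Y.2) (p.smul_mem _ (mem_pointsOf.1 Y'.2))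
  have h2 : a • (Y' : PG3 K).rep = (Y : PG3 K).rep := by
    rw [smul_add, ← mul_smul, sub_eq_zero.1 h1] at ha
    exact add_right_cancel ha
  have h3 : Y = Y' := by
    apply Subtype.ext
    rw [← Projectivization.mk_rep (Y : PG3 K), ← Projectivization.mk_rep (Y' : PG3 K),
      Projectivization.mk_eq_mk_iff']
    exact ⟨a, h2⟩
  subst h3
  have h4 : a = 1 := smul_left_injective K (Y : PG3 K).rep_nonzero (by simpa using h2)
  rw [h4, one_mul] at h1
  exact ⟨rfl, (sub_eq_zero.1 h1).symm⟩

theorem conePoint_ne (hR : R ∉ pointsOf p) (Y : pointsOf p) (s : K) : conePoint hR Y s ≠ R := by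
  intro h
  have h := h.trans (Projectivization.mk_rep R).symm
  rw [conePoint, Projectivization.mk_eq_mk_iff'] at h
  obtain ⟨a, ha⟩ := h
  have h1 : a - s = 0 := eq_zero_of_smul_mem hR <| by
    rw [sub_smul, ha, add_sub_cancel_right]
    exact mem_pointsOf.1 Y.2
  rw [sub_eq_zero.1 h1] at ha
  exact (Y : PG3 K).rep_nonzero (by simpa using ha.symm)

theorem conePoint_mem_span₂ (hR : R ∉ pointsOf p) (Y : pointsOf p) (s : K) :
    conePoint hR Y s ∈ pointsOf (span₂ R Y) := by
  rw [conePoint, mk_mem_pointsOf, mem_span₂]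
  exact ⟨s, 1, by rw [one_smul, add_comm]⟩

theorem exists_conePoint (hR : R ∉ pointsOf p) (Y : pointsOf p) {X : PG3 K} (hX : X ≠ R)
    (h : X ∈ pointsOf (span₂ R Y)) : ∃ s, conePoint hR Y s = X := by
  rw [mem_pointsOf, mem_span₂] at h
  obtain ⟨a, b, hab⟩ := h
  have hb : b ≠ 0 := by
    rintro rfl
    refine hX ?_
    rw [← Projectivization.mk_rep X, ← Projectivization.mk_rep R, Projectivization.mk_eq_mk_iff']
    exact ⟨a, by simpa using hab⟩
  refine ⟨b⁻¹ * a, ?_⟩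
  rw [conePoint, ← Projectivization.mk_rep X, Projectivization.mk_eq_mk_iff']
  refine ⟨b⁻¹, ?_⟩
  rw [← hab, smul_add, ← mul_smul, ← mul_smul, inv_mul_cancel₀ hb, one_smul, add_comm]

/-- Projection from `R` onto the base plane turns a collinear triple of such points into a collinear
triple of `O`. -/
theorem noThreeCollinear_conePoint [Finite K] (hR : R ∉ pointsOf p) {O : Set (PG3 K)}
    (hO : NoThreeCollinear O) (σ : pointsOf p → K) :
    NoThreeCollinear {X | ∃ Y : pointsOf p, (Y : PG3 K) ∈ O ∧ conePoint hR Y (σ Y) = X} := by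
  rw [noThreeCollinear_iff] at hO ⊢
  rintro _ ⟨X, hX, rfl⟩ _ ⟨Y, hY, rfl⟩ _ ⟨Z, hZ, rfl⟩ h1 h2 h3 h4
  refine hO X hX Y hY Z hZ (fun h => h1 ?_) (fun h => h2 ?_) (fun h => h3 ?_) ?_
  · rw [Subtype.ext h]
  · rw [Subtype.ext h]
  · rw [Subtype.ext h]
  rw [conePoint, conePoint, conePoint, mk_mem_pointsOf, span₂_mk, Submodule.mem_span_pair] at h4
  obtain ⟨a, b, hab⟩ := h4
  rw [mem_pointsOf, mem_span₂]
  refine ⟨a, b, ?_⟩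
  have h5 : a * σ X + b * σ Y - σ Z = 0 := eq_zero_of_smul_mem hR <| by
    have : (a * σ X + b * σ Y - σ Z) • R.rep =
        (Z : PG3 K).rep - (a • (X : PG3 K).rep + b • (Y : PG3 K).rep) := by
      rw [sub_smul, add_smul, sub_eq_sub_iff_add_eq_add, ← hab]
      module
    rw [this]
    exact p.sub_mem (mem_pointsOf.1 Z.2) (p.add_mem (p.smul_mem _ (mem_pointsOf.1 X.2))
      (p.smul_mem _ (mem_pointsOf.1 Y.2)))
  have h6 : a • (X : PG3 K).rep + b • (Y : PG3 K).rep + (a * σ X + b * σ Y) • R.rep =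
      (Z : PG3 K).rep + σ Z • R.rep := by
    rw [← hab]; module
  rw [sub_eq_zero.1 h5] at h6
  exact add_right_cancel h6

/-- A functional on a plane extends to the functional with value `-1` at the vertex. -/
theorem exists_extension (hp : IsPlane p) (hR : R ∉ pointsOf p) (g : Module.Dual K p) :
    ∃ h : Module.Dual K (Fin 4 → K), (∀ y : p, h y = g y) ∧ h R.rep = -1 := by
  obtain ⟨f, hf, hfR⟩ := exists_dual_of_notMem hp hR
  obtain ⟨g', hg'⟩ := LinearMap.exists_extend g
  refine ⟨g' - (1 + g' R.rep) • f, fun y => ?_, ?_⟩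
  · have h1 : f y = 0 := hf.ge y.2
    have h2 : g' y = g y := by rw [← hg']; rfl
    simp [h1, h2]
  · simp [hfR]

/-- The normalization `h R.rep = -1` is chosen so that incidence of a plane with the point of
coordinate `s` reads "the functional takes the value `s`". -/
theorem conePoint_mem_ker (hR : R ∉ pointsOf p) {g : Module.Dual K p}
    {h : Module.Dual K (Fin 4 → K)} (hg : ∀ y : p, h y = g y) (hh : h R.rep = -1)
    (Y : pointsOf p) (s : K) : conePoint hR Y s ∈ pointsOf (LinearMap.ker h) ↔
      g ⟨(Y : PG3 K).rep, mem_pointsOf.1 Y.2⟩ = s := by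
  rw [conePoint, mk_mem_pointsOf, LinearMap.mem_ker, map_add, map_smul, hh, ← hg, smul_eq_mul,
    mul_neg, mul_one, ← sub_eq_add_neg, sub_eq_zero]

/-- A plane through the vertex and another point of the cone contains a whole generator, hence three
collinear points of the cone. -/
theorem vertex_notMem_of_isOvalPlane [Finite K] (hK : 2 < Nat.card K) {O : Set (PG3 K)}
    (hOp : O ⊆ pointsOf p) (hR : R ∉ pointsOf p) {π : Flat K}
    (hπ : IsOvalPlane (cone R O) π) : R ∉ pointsOf π := by
  intro hRπ
  obtain ⟨-, -, hcard, harc⟩ := hπ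
  obtain ⟨X, hX, hXR⟩ := Set.exists_ne_of_one_lt_ncard (by rw [hcard]; omega) R
  obtain ⟨Y, hY, hXY⟩ := hX.2
  have hYR : Y ≠ R := fun h => hR (h ▸ hOp hY)
  have hl : span₂ R Y ≤ π := by
    rw [← span₂_eq hXR.symm (isLine_span₂ hYR.symm) (left_mem_span₂ R Y) hXY]
    exact span₂_le hRπ hX.1
  have hmem : ∀ Z ∈ pointsOf (span₂ R Y), Z ∈ pointsOf π ∩ cone R O := fun Z hZ =>
    ⟨pointsOf_mono hl hZ, Y, hY, hZ⟩
  rw [noThreeCollinear_iff] at harc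
  have h0 : conePoint hR ⟨Y, hOp hY⟩ 0 ≠ conePoint hR ⟨Y, hOp hY⟩ 1 := fun h =>
    zero_ne_one (conePoint_inj hR h).2
  have h1 := conePoint_mem_span₂ hR ⟨Y, hOp hY⟩ 0
  have h2 := conePoint_mem_span₂ hR ⟨Y, hOp hY⟩ 1
  refine harc _ (hmem _ h1) _ (hmem _ h2) R (hmem R (left_mem_span₂ R Y)) h0
    (conePoint_ne hR _ _) (conePoint_ne hR _ _) ?_
  rw [span₂_eq h0 (isLine_span₂ hYR.symm) h1 h2]
  exact left_mem_span₂ R Y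

/-- A plane off the vertex has one point on each generator, and projection from the vertex maps this
section bijectively onto the oval; so all planes missing the vertex are oval. -/
theorem isOvalPlane_cone_iff [Finite K] (hK : 2 < Nat.card K) {O : Set (PG3 K)}
    (hO : IsOvalIn p O) (hR : R ∉ pointsOf p) {π : Flat K} :
    IsOvalPlane (cone R O) π ↔ ∃ h : Module.Dual K (Fin 4 → K), h R.rep = -1 ∧
      LinearMap.ker h = π := by
  obtain ⟨hp, hOp, hcard, harc⟩ := hO
  constructor
  · intro hπ
    obtain ⟨f, hf, hfR⟩ := exists_dual_of_notMem hπ.1 (vertex_notMem_of_isOvalPlane hK hOp hR hπ)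
    exact ⟨-f, by simp [hfR], by rw [← hf]; ext x; simp⟩
  · rintro ⟨h, hh, rfl⟩
    set g : Module.Dual K p := h.comp p.subtype with hg
    have hgy : ∀ y : p, h y = g y := fun y => rfl
    set σ : pointsOf p → K := fun Y => g ⟨(Y : PG3 K).rep, mem_pointsOf.1 Y.2⟩ with hσ
    have hset : pointsOf (LinearMap.ker h) ∩ cone R O =
        {X | ∃ Y : pointsOf p, (Y : PG3 K) ∈ O ∧ conePoint hR Y (σ Y) = X} := by
      ext X
      constructor
      · rintro ⟨hX, Y, hY, hXY⟩
        have hXR : X ≠ R := by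
          rintro rfl
          rw [mem_pointsOf, LinearMap.mem_ker, hh] at hX
          exact one_ne_zero (neg_eq_zero.1 hX)
        obtain ⟨s, rfl⟩ := exists_conePoint hR ⟨Y, hOp hY⟩ hXR hXY
        exact ⟨⟨Y, hOp hY⟩, hY, congrArg (conePoint hR _) ((conePoint_mem_ker hR hgy hh _ _).1 hX)⟩
      · rintro ⟨Y, hY, rfl⟩
        exact ⟨(conePoint_mem_ker hR hgy hh _ _).2 rfl, Y, hY, conePoint_mem_span₂ hR _ _⟩
    have h0 : h ≠ 0 := by
      rintro rfl
      exact one_ne_zero (neg_eq_zero.1 hh.symm)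
    refine ⟨isPlane_ker h0, Set.inter_subset_left, ?_, ?_⟩
    · rw [hset, ← hcard]
      symm
      refine Set.ncard_congr (fun Y hY => conePoint hR ⟨Y, hOp hY⟩ (σ ⟨Y, hOp hY⟩))
        (fun Y hY => ⟨⟨Y, hOp hY⟩, hY, rfl⟩) (fun Y Z hY hZ hYZ => ?_) ?_
      · exact congrArg Subtype.val (conePoint_inj hR hYZ).1
      · rintro _ ⟨Y, hY, rfl⟩
        exact ⟨Y, hY, rfl⟩
    · rw [hset]
      exact noThreeCollinear_conePoint hR harc σ

theorem mem_cone_of_mem {O : Set (PG3 K)} (hR : R ∉ pointsOf p) {Y : pointsOf p}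
    (hY : (Y : PG3 K) ∈ O) (s : K) : conePoint hR Y s ∈ cone R O \ {R} :=
  ⟨⟨Y, hY, conePoint_mem_span₂ hR Y s⟩, conePoint_ne hR Y s⟩

/-- The point of a cone with given coordinates. -/
noncomputable def coneMap (hR : R ∉ pointsOf p) {O : Set (PG3 K)} (hOp : O ⊆ pointsOf p)
    (x : O × K) : (cone R O \ {R} : Set (PG3 K)) :=
  ⟨conePoint hR ⟨x.1, hOp x.1.2⟩ x.2, mem_cone_of_mem hR x.1.2 x.2⟩

theorem coneMap_bijective (hR : R ∉ pointsOf p) {O : Set (PG3 K)} (hOp : O ⊆ pointsOf p) :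
    Function.Bijective (coneMap hR hOp) := by
  constructor
  · rintro ⟨Y, s⟩ ⟨Z, t⟩ h
    obtain ⟨h1, h2⟩ := conePoint_inj hR (congrArg Subtype.val h)
    exact Prod.ext (Subtype.ext (Subtype.mk.inj h1)) h2
  · rintro ⟨X, ⟨Y, hY, hXY⟩, hXR⟩
    obtain ⟨s, hs⟩ := exists_conePoint hR ⟨Y, hOp hY⟩ hXR hXY
    exact ⟨(⟨Y, hY⟩, s), Subtype.ext hs⟩

/-- The coordinatisation of the points of a cone. -/
noncomputable def coneEquiv (hR : R ∉ pointsOf p) {O : Set (PG3 K)} (hOp : O ⊆ pointsOf p) :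
    O × K ≃ (cone R O \ {R} : Set (PG3 K)) :=
  Equiv.ofBijective _ (coneMap_bijective hR hOp)

/-- The vectors representing the points of a subset of a plane. -/
noncomputable def planeRep {O : Set (PG3 K)} (hOp : O ⊆ pointsOf p) (Y : O) : p :=
  ⟨(Y : PG3 K).rep, mem_pointsOf.1 (hOp Y.2)⟩

theorem isArc_planeRep [Finite K] {O : Set (PG3 K)} (hOp : O ⊆ pointsOf p)
    (hO : NoThreeCollinear O) : IsArc K (planeRep hOp) := by
  intro X Y Z hXY hXZ hYZ
  rw [noThreeCollinear_iff] at hO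
  have h1 := linearIndependent_triple (fun h => hXY (Subtype.ext h))
    (hO X X.2 Y Y.2 Z Z.2 (fun h => hXY (Subtype.ext h)) (fun h => hXZ (Subtype.ext h))
    (fun h => hYZ (Subtype.ext h)))
  rw [linearIndependent_three_iff] at h1 ⊢
  intro a b c habc
  refine h1 a b c ?_
  simpa [planeRep] using congrArg Subtype.val habc

/-- The oval planes come from `O`, the points from `O'`, which is `O` itself or `O` with its
nucleus; both Laguerre cases are covered in this way. -/
theorem bound_of_cone [Finite K] (hK : 2 < Nat.card K) {O O' : Set (PG3 K)}
    (hO : IsOvalIn p O) (hOO' : O ⊆ O') (hOp : O' ⊆ pointsOf p) (harc : NoThreeCollinear O')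
    (hR : R ∉ pointsOf p) [Fintype (Module.Dual K p)] {q : ℕ}
    (hb : FamilyBound q 1 (GraphInc (K := K) (planeRep hOp)))
    {F : Set (Set (cone R O' \ {R} : Set (PG3 K)))}
    (hF : IsIntersectingFamily (sections (cone R O) (cone R O' \ {R})) F)
    (P : (cone R O' \ {R} : Set (PG3 K)))
    (S T : Set (Set (cone R O' \ {R} : Set (PG3 K)))) (hS : S = {c ∈ F | P ∈ c})
    (hT : T = F \ S) :
    (S.ncard : ℝ) * (T.ncard : ℝ) ≤
      ((q : ℝ) / ((q : ℝ) + ((1 : ℕ) : ℝ) - 2)) ^ 2 * lam q 1 *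
        (1 - (S.ncard : ℝ) / ((q : ℝ) * ((q : ℝ) + 1 - ((1 : ℕ) : ℝ)))) *
        (1 - (T.ncard : ℝ) / ((q : ℝ) ^ 2 * ((q : ℝ) - 1))) := by
  choose ext hext hextR using exists_extension hO.1 hR
  have hinc : ∀ (g : Module.Dual K p) (x : O' × K), (coneEquiv hR hOp x : PG3 K) ∈
      pointsOf (LinearMap.ker (ext g)) ↔ GraphInc (planeRep hOp) g x := fun g x =>
    conePoint_mem_ker hR (hext g) (hextR g) _ _
  refine hb.transfer (sections (cone R O) (cone R O' \ {R})) (coneEquiv hR hOp)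
    (fun g => {x : (cone R O' \ {R} : Set (PG3 K)) | (x : PG3 K) ∈ pointsOf (LinearMap.ker (ext g))})
    ?_ ?_ hinc F hF P S T hS hT
  · intro g g' hgg
    have hval : ∀ Y : O', g (planeRep hOp Y) = g' (planeRep hOp Y) := by
      intro Y
      have h1 := hinc g (Y, g' (planeRep hOp Y))
      have h2 := hinc g' (Y, g' (planeRep hOp Y))
      have h3 : (coneEquiv hR hOp (Y, g' (planeRep hOp Y)) : PG3 K) ∈
          pointsOf (LinearMap.ker (ext g)) := by
        have h4 := h2.2 rfl
        have h5 := Set.ext_iff.1 hgg (coneEquiv hR hOp (Y, g' (planeRep hOp Y)))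
        exact h5.2 h4
      exact h1.1 h3
    obtain ⟨X, Y, Z, hX, hY, hZ, hXY, hXZ, hYZ⟩ := (Set.two_lt_ncard_iff (Set.toFinite _)).1
      (show 2 < O.ncard by rw [hO.2.2.1]; omega)
    refine ((isArc_planeRep hOp harc).bijective hO.1 (a := ⟨X, hOO' hX⟩) (b := ⟨Y, hOO' hY⟩)
      (c := ⟨Z, hOO' hZ⟩) (by simpa using hXY) (by simpa using hXZ) (by simpa using hYZ)).1 ?_
    simp only [hval]
  · ext c
    constructor
    · rintro ⟨π, hπ, rfl⟩
      obtain ⟨h, hh, rfl⟩ := (isOvalPlane_cone_iff hK hO hR).1 hπ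
      refine ⟨h.comp p.subtype, ?_⟩
      -- The plane `p` and the vertex span the space, so a functional is determined by its
      -- restriction to `p` and its value at the vertex.
      have h1 : ext (h.comp p.subtype) = h := by
        obtain ⟨f, hf, hfR⟩ := exists_dual_of_notMem hO.1 hR
        refine LinearMap.ext fun x => ?_
        have hx : x = (x - f x • R.rep) + f x • R.rep := by abel
        have hxp : x - f x • R.rep ∈ p := by
          rw [← hf, LinearMap.mem_ker]; simp [hfR]
        have h2 := hext (h.comp p.subtype) ⟨_, hxp⟩
        simp only [LinearMap.comp_apply, Submodule.subtype_apply] at h2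
        rw [hx, map_add, map_add, h2, map_smul, map_smul, hextR, hh]
      simp only [h1]
      rfl
    · rintro ⟨g, rfl⟩
      exact ⟨_, (isOvalPlane_cone_iff hK hO hR).2 ⟨ext g, hextR g, rfl⟩, rfl⟩

/-- The line from `N` to another point of the oval would be tangent and yet contain two points of
the oval. -/
theorem IsNucleus.notMem [Finite K] {O : Set (PG3 K)} {N : PG3 K} (hO : IsOvalIn p O)
    (hN : IsNucleus p O N) : N ∉ O := by
  intro h
  have h1 : 1 < O.ncard := by
    rw [hO.2.2.1]
    have : 0 < Nat.card K := Nat.card_pos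
    omega
  obtain ⟨X, hX, hXN⟩ := Set.exists_ne_of_one_lt_ncard h1 N
  have h2 := (hN.2 _ (isLine_span₂ hXN) (span₂_le (hO.2.1 hX) hN.1)).2 (right_mem_span₂ X N)
  obtain ⟨Z, hZ⟩ := Set.ncard_eq_one.1 h2
  have h3 : X ∈ ({Z} : Set (PG3 K)) := hZ ▸ ⟨hX, left_mem_span₂ X N⟩
  have h4 : N ∈ ({Z} : Set (PG3 K)) := hZ ▸ ⟨h, right_mem_span₂ X N⟩
  exact hXN (h3.trans h4.symm)

/-- A line through `N` with two points of the oval would lie in `p` and so be a tangent. -/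
theorem IsNucleus.noThreeCollinear [Finite K] {O : Set (PG3 K)} {N : PG3 K} (hO : IsOvalIn p O)
    (hN : IsNucleus p O N) : NoThreeCollinear (insert N O) := by
  intro l hl
  by_cases hNl : N ∈ pointsOf l
  · rw [Set.insert_inter_of_mem hNl]
    refine (Set.ncard_insert_le _ _).trans (Nat.succ_le_succ ?_)
    by_contra! h1
    obtain ⟨X, Y, hX, hY, hXY⟩ := (Set.one_lt_ncard_iff (Set.toFinite _)).1 h1
    have hlp : l ≤ p := by
      rw [← span₂_eq hXY hl hX.2 hY.2]
      exact span₂_le (hO.2.1 hX.1) (hO.2.1 hY.1)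
    rw [(hN.2 l hl hlp).2 hNl] at h1
    exact lt_irrefl _ h1
  · rw [Set.insert_inter_of_notMem hNl]
    exact hO.2.2.2 l hl

theorem cone_insert {O : Set (PG3 K)} {N : PG3 K} :
    cone R O ∪ pointsOf (span₂ R N) = cone R (insert N O) := by
  ext X
  simp only [cone, Set.mem_union, Set.mem_ofPred_eq, Set.mem_insert_iff, exists_eq_or_imp]
  exact or_comm

theorem bound_laguerre [Finite K] (hK : 2 < Nat.card K) (hq : Odd (Nat.card K)) {O : Set (PG3 K)}
    (hO : IsOvalIn p O) (hR : R ∉ pointsOf p)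
    {F : Set (Set (cone R O \ {R} : Set (PG3 K)))}
    (hF : IsIntersectingFamily (sections (cone R O) (cone R O \ {R})) F)
    (P : (cone R O \ {R} : Set (PG3 K)))
    (S T : Set (Set (cone R O \ {R} : Set (PG3 K)))) (hS : S = {c ∈ F | P ∈ c})
    (hT : T = F \ S) {q : ℕ} (hKq : Nat.card K = q) :
    (S.ncard : ℝ) * (T.ncard : ℝ) ≤
      ((q : ℝ) / ((q : ℝ) + ((1 : ℕ) : ℝ) - 2)) ^ 2 * lam q 1 *
        (1 - (S.ncard : ℝ) / ((q : ℝ) * ((q : ℝ) + 1 - ((1 : ℕ) : ℝ)))) *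
        (1 - (T.ncard : ℝ) / ((q : ℝ) ^ 2 * ((q : ℝ) - 1))) := by
  have := Fintype.ofFinite K
  have := Module.finite_of_finite K (M := Module.Dual K p)
  have := Fintype.ofFinite (Module.Dual K p)
  have := Fintype.ofFinite O
  subst hKq
  refine bound_of_cone hK hO subset_rfl hO.2.1 hO.2.2.2 hR ?_ hF P S T hS hT
  have h1 := (isArc_planeRep hO.2.1 hO.2.2.2).isCirclePlane (q := Nat.card K) hO.1 hK
    Nat.card_eq_fintype_card.symm
    (by rw [← Nat.card_eq_fintype_card, Nat.card_coe_set_eq, hO.2.2.1])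
  exact h1.familyBound_of_odd (by simpa using hq)

theorem bound_extendedLaguerre [Finite K] (hK : 2 < Nat.card K) (hq : Even (Nat.card K))
    {O : Set (PG3 K)} (hO : IsOvalIn p O) (hR : R ∉ pointsOf p) {N : PG3 K} (hN : IsNucleus p O N)
    {F : Set (Set ((cone R O ∪ pointsOf (span₂ R N)) \ {R} : Set (PG3 K)))}
    (hF : IsIntersectingFamily
      (sections (cone R O) ((cone R O ∪ pointsOf (span₂ R N)) \ {R})) F)
    (P : ((cone R O ∪ pointsOf (span₂ R N)) \ {R} : Set (PG3 K)))
    (S T : Set (Set ((cone R O ∪ pointsOf (span₂ R N)) \ {R} : Set (PG3 K))))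
    (hS : S = {c ∈ F | P ∈ c}) (hT : T = F \ S) {q : ℕ} (hKq : Nat.card K = q) :
    (S.ncard : ℝ) * (T.ncard : ℝ) ≤
      ((q : ℝ) / ((q : ℝ) + ((1 : ℕ) : ℝ) - 2)) ^ 2 * lam q 1 *
        (1 - (S.ncard : ℝ) / ((q : ℝ) * ((q : ℝ) + 1 - ((1 : ℕ) : ℝ)))) *
        (1 - (T.ncard : ℝ) / ((q : ℝ) ^ 2 * ((q : ℝ) - 1))) := by
  have := Fintype.ofFinite K
  have := Module.finite_of_finite K (M := Module.Dual K p)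
  have := Fintype.ofFinite (Module.Dual K p)
  have := Fintype.ofFinite (insert N O : Set (PG3 K))
  subst hKq
  have hsub : insert N O ⊆ pointsOf p := Set.insert_subset hN.1 hO.2.1
  have harc := hN.noThreeCollinear hO
  revert F P S T
  rw [cone_insert]
  intro F hF P S T hS hT
  refine bound_of_cone hK hO (Set.subset_insert N O) hsub harc hR ?_ hF P S T hS hT
  exact (isArc_planeRep hsub harc).familyBound hO.1 hK hq Nat.card_eq_fintype_card.symm
    (by rw [← Nat.card_eq_fintype_card, Nat.card_coe_set_eq,
      Set.ncard_insert_of_notMem (hN.notMem hO), hO.2.2.1])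

end Cone

end CircleGeometry

namespace CircleGeometry

/-! ### Minkowski planes from sharply three-transitive families. -/

section Permutations

open Finset
open scoped Classical

variable {L ι : Type*} [Fintype L] [Fintype ι]

/-- A sharply three-transitive family of permutations is a Minkowski plane. -/
theorem isCirclePlane_of_perm {q : ℕ} (hq : 2 < q) (hL : Fintype.card L = q + 1)
    (f : ι → Equiv.Perm L)
    (hex : ∀ a b c a' b' c', a ≠ b → a ≠ c → b ≠ c → a' ≠ b' → a' ≠ c' → b' ≠ c' →
      ∃ i, f i a = a' ∧ f i b = b' ∧ f i c = c')
    (huniq : ∀ a b c i j, a ≠ b → a ≠ c → b ≠ c → f i a = f j a → f i b = f j b → f i c = f j c →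
      i = j) :
    IsCirclePlane q 2 (fun i (x : L × L) => x.2 = f i x.1) fun x y => x.1 = y.1 ∨ x.2 = y.2 where
  two_lt := hq
  rho_le := le_rfl
  refl x := Or.inl rfl
  symm h := h.imp Eq.symm Eq.symm
  card_circle i := by
    rw [← hL, ← card_univ, ← card_image_of_injective univ (f := fun a => (a, f i a))
      fun a b h => (Prod.mk.inj h).1]
    congr 1
    ext ⟨a, b⟩
    simp [eq_comm]
  eq_of_par := by
    rintro i ⟨a, b⟩ ⟨a', b'⟩ h1 h2 h3
    simp only at h1 h2 h3
    subst h1 h2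
    rcases h3 with rfl | h3
    · rfl
    · rw [(f i).injective h3]
  exists_circle := by
    rintro ⟨a, a'⟩ ⟨b, b'⟩ ⟨c, c'⟩ h1 h2 h3
    simp only [not_or] at h1 h2 h3
    obtain ⟨i, hi⟩ := hex a b c a' b' c' h1.1 h2.1 h3.1 h1.2 h2.2 h3.2
    exact ⟨i, hi.1.symm, hi.2.1.symm, hi.2.2.symm⟩
  unique_circle := by
    rintro i j ⟨a, a'⟩ ⟨b, b'⟩ ⟨c, c'⟩ hab hac hbc h1 h2 h3 h4 h5 h6
    simp only at h1 h2 h3 h4 h5 h6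
    refine huniq a b c i j ?_ ?_ ?_ (h1.symm.trans h4) (h2.symm.trans h5) (h3.symm.trans h6)
    · rintro rfl; exact hab (by rw [h1, h2])
    · rintro rfl; exact hac (by rw [h1, h3])
    · rintro rfl; exact hbc (by rw [h2, h3])
  card_par := by
    rintro i ⟨a, b⟩ h
    simp only at h
    -- The parallel points on the graph are those with first coordinate `a` and with second
    -- coordinate `b`; they differ because `(a, b)` is off the graph.
    refine (congrArg Finset.card (?_ : _ = {(a, f i a), ((f i).symm b, b)})).trans (card_pair ?_)
    · ext ⟨c, d⟩
      simp only [mem_filter, mem_univ, true_and, mem_insert, mem_singleton, Prod.mk.injEq]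
      constructor
      · rintro ⟨rfl, rfl | rfl⟩
        · exact Or.inl ⟨rfl, rfl⟩
        · exact Or.inr ⟨by simp, rfl⟩
      · rintro (⟨rfl, rfl⟩ | ⟨rfl, rfl⟩)
        · exact ⟨rfl, Or.inl rfl⟩
        · exact ⟨by simp, Or.inr rfl⟩
    · exact fun h2 => h (Prod.mk.inj h2).2.symm
  card_not_par := by
    rintro ⟨a, b⟩
    refine (congrArg Finset.card (?_ : _ = (univ.erase a) ×ˢ (univ.erase b))).trans ?_
    · ext ⟨c, d⟩
      simp [eq_comm]
    rw [card_product, card_erase_of_mem (mem_univ _), card_erase_of_mem (mem_univ _), card_univ,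
      hL]
    simp [sq]
  card_not_par₂ := by
    rintro ⟨a, b⟩ ⟨a', b'⟩ h
    simp only [not_or] at h
    refine (congrArg Finset.card (?_ : _ = ((univ.erase a).erase a') ×ˢ
      ((univ.erase b).erase b'))).trans ?_
    · ext ⟨c, d⟩
      simp only [mem_filter, mem_univ, true_and, mem_product, mem_erase, not_or, and_true, ne_eq,
        eq_comm]
      tauto
    rw [card_product, card_erase_of_mem (mem_erase.2 ⟨Ne.symm h.1, mem_univ _⟩),
      card_erase_of_mem (mem_erase.2 ⟨Ne.symm h.2, mem_univ _⟩), card_erase_of_mem (mem_univ _),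
      card_erase_of_mem (mem_univ _), card_univ, hL]
    rfl

end Permutations

/-! ### Squares in finite fields. -/

section Squares

variable {K : Type*} [Field K] [Finite K]

/-- The quadratic character is multiplicative; in characteristic two every element is a square. -/
theorem isSquare_mul_iff {a b : K} (ha : a ≠ 0) (hb : b ≠ 0) :
    IsSquare (a * b) ↔ (IsSquare a ↔ IsSquare b) := by
  classical
  have := Fintype.ofFinite K
  by_cases hK : ringChar K = 2
  · simp [FiniteField.isSquare_of_char_two hK]
  have hχ : ∀ {c : K}, c ≠ 0 → (quadraticChar K c = 1 ∨ quadraticChar K c = -1) := fun hc =>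
    quadraticChar_dichotomy hc
  rw [← quadraticChar_one_iff_isSquare (mul_ne_zero ha hb), ← quadraticChar_one_iff_isSquare ha,
    ← quadraticChar_one_iff_isSquare hb, map_mul]
  rcases hχ ha with h1 | h1 <;> rcases hχ hb with h2 | h2 <;> rw [h1, h2] <;> norm_num

end Squares

/-! ### PGL(2, q) on the projective line and the planes CM(2, q, φ). -/

section ProjectiveLine

variable {K : Type u} [Field K]

theorem mem_pslSubgroup_iff (g : GL (Fin 2) K) :
    Matrix.ProjGenLinGroup.mk g ∈ pslSubgroup K ↔ IsSquare (g : Matrix (Fin 2) (Fin 2) K).det := by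
  constructor
  · rintro ⟨h, hh⟩
    induction h using QuotientGroup.induction_on with | H h =>
    rw [Matrix.ProjectiveSpecialLinearGroup.toPGL_mk, Matrix.ProjGenLinGroup.mk_eq_mk_iff] at hh
    obtain ⟨u, rfl⟩ := hh
    refine ⟨u, ?_⟩
    simp [sq]
  · rintro ⟨r, hr⟩
    have hr0 : r ≠ 0 := by
      rintro rfl
      have := g.det.ne_zero
      simp [hr] at this
    refine ⟨QuotientGroup.mk ⟨r⁻¹ • (g : Matrix (Fin 2) (Fin 2) K), ?_⟩, ?_⟩
    · rw [Matrix.det_smul, hr, Fintype.card_fin]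
      field_simp
    · refine Matrix.ProjGenLinGroup.mk_eq_mk_iff.2 ⟨Units.mk0 r hr0, Units.ext ?_⟩
      change r⁻¹ • (g : Matrix (Fin 2) (Fin 2) K) * Matrix.scalar (Fin 2) r = g
      ext i j
      simp
      field_simp

/-- Membership means square determinant; the subgroup has index at most two. -/
theorem mul_mem_pslSubgroup_iff [Finite K] (M N : PGL(2, K)) :
    M * N ∈ pslSubgroup K ↔ (M ∈ pslSubgroup K ↔ N ∈ pslSubgroup K) := by
  induction M using Matrix.ProjGenLinGroup.induction_on with | mk g =>
  induction N using Matrix.ProjGenLinGroup.induction_on with | mk h =>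
  rw [← map_mul, mem_pslSubgroup_iff, mem_pslSubgroup_iff, mem_pslSubgroup_iff, Units.val_mul,
    Matrix.det_mul, isSquare_mul_iff (Matrix.GeneralLinearGroup.det_ne_zero g)
      (Matrix.GeneralLinearGroup.det_ne_zero h)]

theorem map_mem_pslSubgroup_iff (φ : K ≃+* K) (M : PGL(2, K)) :
    Matrix.ProjGenLinGroup.map (φ : K →+* K) M ∈ pslSubgroup K ↔ M ∈ pslSubgroup K := by
  induction M using Matrix.ProjGenLinGroup.induction_on with | mk g =>
  rw [Matrix.ProjGenLinGroup.map_mk, mem_pslSubgroup_iff, mem_pslSubgroup_iff]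
  have h1 : (Matrix.GeneralLinearGroup.map (φ : K →+* K) g : Matrix (Fin 2) (Fin 2) K).det =
      φ (g : Matrix (Fin 2) (Fin 2) K).det := by
    rw [RingEquiv.map_det]; rfl
  rw [h1]
  constructor
  · rintro ⟨r, hr⟩
    exact ⟨φ.symm r, φ.injective (by simp [hr])⟩
  · rintro ⟨r, hr⟩
    exact ⟨φ r, by rw [hr, map_mul]⟩

theorem autAct_smul (φ : K ≃+* K) (M : PGL(2, K)) (x : ℙ K (Fin 2 → K)) :
    autAct φ (M • x) = Matrix.ProjGenLinGroup.map (φ : K →+* K) M • autAct φ x := by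
  induction M using Matrix.ProjGenLinGroup.induction_on with | mk g =>
  induction x using Projectivization.ind with | h v hv =>
  rw [Matrix.ProjGenLinGroup.map_mk, Projectivization.PGL.mk_smul_mk]
  have h1 : autAct φ (Projectivization.mk K v hv) = Projectivization.mk K (coordMap φ v)
    (fun h => hv (coordMap_injective φ (h.trans (map_zero _).symm))) := rfl
  rw [h1, Projectivization.PGL.mk_smul_mk, autAct, Projectivization.map_mk]
  congr 1
  ext i
  fin_cases i <;> simp [coordMap, Units.smul_def, Matrix.mulVec, dotProduct, Fin.sum_univ_two]

theorem autAct_injective (φ : K ≃+* K) : Function.Injective (autAct φ) :=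
  have := RingHomInvPair.of_ringEquiv φ
  Projectivization.map_injective (τ := (φ.symm : K →+* K)) _ (coordMap_injective φ)

/-- The affine point with coordinate `t` of the projective line. -/
def affinePoint (t : K) : ℙ K (Fin 2 → K) :=
  Projectivization.mk K ![t, 1] fun h => one_ne_zero (congrFun h 1)

/-- The point at infinity of the projective line. -/
def infinity (K : Type u) [Field K] : ℙ K (Fin 2 → K) :=
  Projectivization.mk K ![1, 0] fun h => one_ne_zero (congrFun h 0)

theorem affinePoint_ne_infinity (t : K) : affinePoint t ≠ infinity K := by
  intro h
  obtain ⟨a, ha⟩ := (Projectivization.mk_eq_mk_iff' _ _ _ _ _).1 h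
  have := congrFun ha 1
  simp at this

theorem affinePoint_injective : Function.Injective (affinePoint (K := K)) := by
  intro s t h
  obtain ⟨a, ha⟩ := (Projectivization.mk_eq_mk_iff' _ _ _ _ _).1 h
  have h1 := congrFun ha 1
  have h0 := congrFun ha 0
  simp only [Pi.smul_apply, Matrix.cons_val_one, Matrix.cons_val_zero, smul_eq_mul, mul_one] at h0 h1
  rw [← h0, h1, one_mul]

theorem autAct_infinity (φ : K ≃+* K) : autAct φ (infinity K) = infinity K := by
  rw [infinity, autAct, Projectivization.map_mk]
  congr 1
  ext i
  fin_cases i <;> simp [coordMap]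

theorem autAct_affinePoint (φ : K ≃+* K) (t : K) : autAct φ (affinePoint t) = affinePoint (φ t) := by
  rw [affinePoint, autAct, Projectivization.map_mk, affinePoint]
  congr 1
  ext i
  fin_cases i <;> simp [coordMap]

theorem mk_smul_mk_eq {g : GL (Fin 2) K} {v : Fin 2 → K} (hv : v ≠ 0) {x : ℙ K (Fin 2 → K)} (a : K)
    (h : a • x.rep = (g : Matrix (Fin 2) (Fin 2) K).mulVec v) :
    Matrix.ProjGenLinGroup.mk g • Projectivization.mk K v hv = x := by
  conv_rhs => rw [← Projectivization.mk_rep x]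
  rw [Projectivization.PGL.mk_smul_mk, Projectivization.mk_eq_mk_iff']
  exact ⟨a, h⟩

/-- The columns of the matrix are representatives of `a` and `b`, scaled so that their sum
represents `c`. -/
theorem exists_frame {a b c : ℙ K (Fin 2 → K)} (hab : a ≠ b) (hac : a ≠ c) (hbc : b ≠ c) :
    ∃ B : PGL(2, K), B • infinity K = a ∧ B • affinePoint 0 = b ∧ B • affinePoint 1 = c := by
  have hli := Projectivization.linearIndependent_pair_iff_ne.2 hab
  have hspan : c.rep ∈ Submodule.span K {a.rep, b.rep} := by
    have h1 := hli.span_eq_top_of_card_eq_finrank (by simp)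
    rw [Matrix.range_cons, Matrix.range_cons, Matrix.range_empty, Set.union_empty,
      Set.singleton_union] at h1
    rw [h1]; trivial
  obtain ⟨s, t, hst⟩ := Submodule.mem_span_pair.1 hspan
  have hs : s ≠ 0 := by
    rintro rfl
    refine hbc.symm ?_
    rw [← Projectivization.mk_rep b, ← Projectivization.mk_rep c, Projectivization.mk_eq_mk_iff']
    exact ⟨t, by simpa using hst⟩
  have ht : t ≠ 0 := by
    rintro rfl
    refine hac.symm ?_
    rw [← Projectivization.mk_rep a, ← Projectivization.mk_rep c, Projectivization.mk_eq_mk_iff']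
    exact ⟨s, by simpa using hst⟩
  have hdet : (Matrix.of ![s • a.rep, t • b.rep]).transpose.det ≠ 0 := by
    intro h
    rw [Matrix.det_fin_two] at h
    simp only [Matrix.transpose_apply, Matrix.of_apply, Matrix.cons_val_zero, Matrix.cons_val_one,
      Pi.smul_apply, smul_eq_mul] at h
    have h1 : a.rep 0 * b.rep 1 = a.rep 1 * b.rep 0 := by
      have : s * t * (a.rep 0 * b.rep 1 - a.rep 1 * b.rep 0) = 0 := by linear_combination h
      simpa [hs, ht, sub_eq_zero] using this
    rw [LinearIndependent.pair_iff] at hli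
    have h2 := (hli (b.rep 1) (-a.rep 1) (by
      ext i
      fin_cases i
      · simp; linear_combination h1
      · simp; ring)).2
    have h3 := (hli (b.rep 0) (-a.rep 0) (by
      ext i
      fin_cases i
      · simp; ring
      · simp; linear_combination -h1)).2
    refine a.rep_nonzero ?_
    ext i
    fin_cases i
    · simpa using h3
    · simpa using h2
  refine ⟨Matrix.ProjGenLinGroup.mk (Matrix.GeneralLinearGroup.mkOfDetNeZero _ hdet), ?_, ?_, ?_⟩
  · refine mk_smul_mk_eq _ s ?_
    ext i
    simp [Matrix.mulVec, dotProduct, Fin.sum_univ_two, Matrix.GeneralLinearGroup.mkOfDetNeZero]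
  · refine mk_smul_mk_eq _ t ?_
    ext i
    simp [Matrix.mulVec, dotProduct, Fin.sum_univ_two, Matrix.GeneralLinearGroup.mkOfDetNeZero]
  · refine mk_smul_mk_eq _ 1 ?_
    rw [one_smul, ← hst]
    ext i
    simp [Matrix.mulVec, dotProduct, Fin.sum_univ_two, Matrix.GeneralLinearGroup.mkOfDetNeZero]

/-- Fixing infinity and 0 makes the matrix diagonal, and fixing 1 makes it scalar. -/
theorem eq_one_of_frame {M : PGL(2, K)} (h1 : M • infinity K = infinity K)
    (h2 : M • affinePoint (0 : K) = affinePoint 0) (h3 : M • affinePoint (1 : K) = affinePoint 1) :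
    M = 1 := by
  induction M using Matrix.ProjGenLinGroup.induction_on with | mk g =>
  rw [infinity, Projectivization.PGL.mk_smul_mk, Projectivization.mk_eq_mk_iff'] at h1
  rw [affinePoint, Projectivization.PGL.mk_smul_mk, Projectivization.mk_eq_mk_iff'] at h2 h3
  obtain ⟨a, ha⟩ := h1
  obtain ⟨b, hb⟩ := h2
  obtain ⟨c, hc⟩ := h3
  have ha0 := congrFun ha 0
  have ha1 := congrFun ha 1
  have hb0 := congrFun hb 0
  have hb1 := congrFun hb 1
  have hc0 := congrFun hc 0
  have hc1 := congrFun hc 1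
  simp [Units.smul_def, Matrix.mulVec, dotProduct, Fin.sum_univ_two] at ha0 ha1 hb0 hb1 hc0 hc1
  rw [Matrix.ProjGenLinGroup.mk_eq_one, Matrix.GeneralLinearGroup.center_eq_range_scalar]
  have ha : a ≠ 0 := by
    rintro rfl
    have := Matrix.GeneralLinearGroup.det_ne_zero g
    rw [Matrix.det_fin_two, ← ha0, ← ha1] at this
    simp at this
  refine ⟨Units.mk0 a ha, Units.ext ?_⟩
  ext i j
  have h4 : (g : Matrix (Fin 2) (Fin 2) K) 1 1 = a := by
    rw [← ha1, zero_add] at hc1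
    rw [← hb0, add_zero] at hc0
    rw [← hc1, hc0, ha0]
  fin_cases i <;> fin_cases j <;> simp [h4, ← ha0, ← ha1, ← hb0]

theorem eq_of_frame {M N : PGL(2, K)} (h1 : M • infinity K = N • infinity K)
    (h2 : M • affinePoint (0 : K) = N • affinePoint 0)
    (h3 : M • affinePoint (1 : K) = N • affinePoint 1) : M = N := by
  have := eq_one_of_frame (M := N⁻¹ * M) (by rw [mul_smul, h1, inv_smul_smul])
    (by rw [mul_smul, h2, inv_smul_smul]) (by rw [mul_smul, h3, inv_smul_smul])
  exact (inv_mul_eq_one.1 this).symm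

theorem card_projectiveLine [Finite K] : Nat.card (ℙ K (Fin 2 → K)) = Nat.card K + 1 :=
  Projectivization.card_of_finrank_two _ _ (by simp)

theorem twistedMap_injective (φ : K ≃+* K) (M : PGL(2, K)) :
    Function.Injective (twistedMap φ M) := by
  intro x y h
  unfold twistedMap at h
  split_ifs at h
  · exact MulAction.injective M h
  · exact autAct_injective φ (MulAction.injective M h)

open scoped Classical in
-- A matrix whose twisted map carries the frame of B to that of C is either C B⁻¹, if this lies in
-- PSL, or C (B^φ)⁻¹, if this lies outside PSL. Since φ preserves squares, both candidates are on
-- the same side, so exactly one of them is admissible.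
theorem isCirclePlane_twistedMap [Fintype (ℙ K (Fin 2 → K))] [Fintype PGL(2, K)] [Finite K]
    (hK : 2 < Nat.card K) (φ : K ≃+* K) :
    IsCirclePlane (Nat.card K) 2
      (fun (M : PGL(2, K)) (x : ℙ K (Fin 2 → K) × ℙ K (Fin 2 → K)) => x.2 = twistedMap φ M x.1)
      fun x y => x.1 = y.1 ∨ x.2 = y.2 := by
  have key : ∀ a b c a' b' c' : ℙ K (Fin 2 → K), a ≠ b → a ≠ c → b ≠ c → a' ≠ b' → a' ≠ c' →
      b' ≠ c' → ∃ M, (twistedMap φ M a = a' ∧ twistedMap φ M b = b' ∧ twistedMap φ M c = c') ∧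
      ∀ N, twistedMap φ N a = a' → twistedMap φ N b = b' → twistedMap φ N c = c' → N = M := by
    intro a b c a' b' c' hab hac hbc hab' hac' hbc'
    obtain ⟨B, rfl, rfl, rfl⟩ := exists_frame hab hac hbc
    obtain ⟨C, rfl, rfl, rfl⟩ := exists_frame hab' hac' hbc'
    set B' := Matrix.ProjGenLinGroup.map (φ : K →+* K) B with hB'
    have h1 : ∀ N : PGL(2, K), N • B • infinity K = C • infinity K →
        N • B • affinePoint (0 : K) = C • affinePoint 0 →
        N • B • affinePoint (1 : K) = C • affinePoint 1 → N = C * B⁻¹ := by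
      intro N e1 e2 e3
      rw [eq_mul_inv_iff_mul_eq]
      exact eq_of_frame (by rwa [mul_smul]) (by rwa [mul_smul]) (by rwa [mul_smul])
    have h2 : ∀ N : PGL(2, K), N • autAct φ (B • infinity K) = C • infinity K →
        N • autAct φ (B • affinePoint (0 : K)) = C • affinePoint 0 →
        N • autAct φ (B • affinePoint (1 : K)) = C • affinePoint 1 → N = C * B'⁻¹ := by
      intro N e1 e2 e3
      rw [autAct_smul, autAct_infinity] at e1
      rw [autAct_smul, autAct_affinePoint, map_zero] at e2
      rw [autAct_smul, autAct_affinePoint, map_one] at e3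
      rw [eq_mul_inv_iff_mul_eq]
      exact eq_of_frame (by rwa [mul_smul]) (by rwa [mul_smul]) (by rwa [mul_smul])
    have h3 : C * B⁻¹ ∈ pslSubgroup K ↔ C * B'⁻¹ ∈ pslSubgroup K := by
      rw [mul_mem_pslSubgroup_iff, mul_mem_pslSubgroup_iff, inv_mem_iff, inv_mem_iff, hB',
        map_mem_pslSubgroup_iff]
    by_cases h : C * B⁻¹ ∈ pslSubgroup K
    · refine ⟨C * B⁻¹, ?_, fun N e1 e2 e3 => ?_⟩
      · simp only [twistedMap, if_pos h, mul_smul, inv_smul_smul, and_self]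
      · unfold twistedMap at e1 e2 e3
        by_cases hN : N ∈ pslSubgroup K
        · rw [if_pos hN] at e1 e2 e3
          exact h1 N e1 e2 e3
        · rw [if_neg hN] at e1 e2 e3
          have h4 := h2 N e1 e2 e3
          rw [h4, ← h3] at hN
          exact absurd h hN
    · have h' := fun h4 => h (h3.2 h4)
      refine ⟨C * B'⁻¹, ?_, fun N e1 e2 e3 => ?_⟩
      · simp only [twistedMap, if_neg h', autAct_smul, autAct_infinity, autAct_affinePoint, map_zero,
          map_one, mul_smul, ← hB', inv_smul_smul, and_self]
      · unfold twistedMap at e1 e2 e3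
        by_cases hN : N ∈ pslSubgroup K
        · rw [if_pos hN] at e1 e2 e3
          have h4 := h1 N e1 e2 e3
          rw [h4] at hN
          exact absurd hN h
        · rw [if_neg hN] at e1 e2 e3
          exact h2 N e1 e2 e3
  exact isCirclePlane_of_perm hK (by rw [← Nat.card_eq_fintype_card, card_projectiveLine])
    (fun M => Equiv.ofBijective (twistedMap φ M)
      (Finite.injective_iff_bijective.1 (twistedMap_injective φ M)))
    (fun a b c a' b' c' hab hac hbc hab' hac' hbc' => by
      obtain ⟨M, hM, -⟩ := key a b c a' b' c' hab hac hbc hab' hac' hbc'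
      exact ⟨M, hM⟩)
    (fun a b c M N hab hac hbc ha hb hc => by
      obtain ⟨M', -, hM'⟩ := key a b c (twistedMap φ M a) (twistedMap φ M b) (twistedMap φ M c)
        hab hac hbc ((twistedMap_injective φ M).ne hab) ((twistedMap_injective φ M).ne hac)
        ((twistedMap_injective φ M).ne hbc)
      rw [hM' M rfl rfl rfl, hM' N ha.symm hb.symm hc.symm])

/-- A projectivity outside `PSL(2, K)` fixing the point at infinity agrees with a field
automorphism in an affine point. -/
theorem exists_affinePoint_smul_eq [Finite K] (φ : K ≃+* K) {N : PGL(2, K)}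
    (hN : N ∉ pslSubgroup K) (hinf : N • infinity K = infinity K) :
    ∃ t : K, N • affinePoint t = affinePoint (φ t) := by
  induction N using Matrix.ProjGenLinGroup.induction_on with | mk g =>
  rw [mem_pslSubgroup_iff, Matrix.det_fin_two] at hN
  have hdet := Matrix.GeneralLinearGroup.det_ne_zero g
  rw [Matrix.det_fin_two] at hdet
  rw [infinity, Projectivization.PGL.mk_smul_mk, Projectivization.mk_eq_mk_iff'] at hinf
  obtain ⟨a, ha⟩ := hinf
  have ha1 := congrFun ha 1
  simp [Units.smul_def, Matrix.mulVec, dotProduct, Fin.sum_univ_two] at ha1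
  rw [← ha1, mul_zero, sub_zero] at hN hdet
  set x := (g : Matrix (Fin 2) (Fin 2) K) 0 0
  set y := (g : Matrix (Fin 2) (Fin 2) K) 0 1
  set z := (g : Matrix (Fin 2) (Fin 2) K) 1 1
  have hx := left_ne_zero_of_mul hdet
  have hz := right_ne_zero_of_mul hdet
  -- The condition on t is z φ(t) - x t = y, whose left side is additive in t. A zero t ≠ 0 would
  -- give xz = z² φ(t)/t, a square because φ(t)t is one. So the map is injective, and by finiteness
  -- surjective.
  let f : K →+ K := (AddMonoidHom.mulLeft z).comp (φ : K →+ K) - AddMonoidHom.mulLeft x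
  have hf : ∀ t, f t = z * φ t - x * t := fun t => rfl
  have hinj : Function.Injective f := by
    rw [injective_iff_map_eq_zero]
    intro t ht
    by_contra ht0
    rw [hf, sub_eq_zero] at ht
    have hφt : φ t ≠ 0 := by simpa using ht0
    have h1 : IsSquare (φ t * t) := by
      rw [isSquare_mul_iff hφt ht0]
      constructor
      · rintro ⟨r, hr⟩
        exact ⟨φ.symm r, φ.injective (by simp [hr])⟩
      · rintro ⟨r, hr⟩
        exact ⟨φ r, by rw [hr, map_mul]⟩
    obtain ⟨r, hr⟩ := h1
    refine hN ⟨z * r / t, ?_⟩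
    field_simp
    linear_combination (-t) * ht + z * hr
  obtain ⟨t, ht⟩ := (Finite.injective_iff_surjective.1 hinj) y
  rw [hf] at ht
  refine ⟨t, ?_⟩
  rw [affinePoint, affinePoint, Projectivization.PGL.mk_smul_mk, Projectivization.mk_eq_mk_iff']
  refine ⟨z, ?_⟩
  ext i
  fin_cases i
  · simp [Units.smul_def, Matrix.mulVec, dotProduct, Fin.sum_univ_two]
    linear_combination ht
  · simp [Units.smul_def, Matrix.mulVec, dotProduct, Fin.sum_univ_two, ← ha1, z]

/-- Moving `x` to infinity reduces this to `exists_affinePoint_smul_eq`. It shows that circles of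
different types are never tangent. -/
theorem exists_second_common [Finite K] (φ : K ≃+* K) {M N : PGL(2, K)} (hM : M ∈ pslSubgroup K)
    (hN : N ∉ pslSubgroup K) {x : ℙ K (Fin 2 → K)} (hx : M • x = N • autAct φ x) :
    ∃ y ≠ x, M • y = N • autAct φ y := by
  have : Nontrivial (ℙ K (Fin 2 → K)) := ⟨_, _, affinePoint_ne_infinity (0 : K)⟩
  obtain ⟨y, hy⟩ := exists_ne x
  obtain ⟨z, hzx, hzy⟩ : ∃ z : ℙ K (Fin 2 → K), z ≠ x ∧ z ≠ y := by
    by_contra! h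
    have h1 : ∀ t : K, affinePoint t ≠ x → affinePoint t = y := fun t ht => h _ ht
    have h2 : infinity K ≠ x → infinity K = y := fun ht => h _ ht
    have h3 := affinePoint_ne_infinity (0 : K)
    have h4 := affinePoint_ne_infinity (1 : K)
    have h5 : affinePoint (0 : K) ≠ affinePoint 1 := fun h6 =>
      zero_ne_one (affinePoint_injective h6)
    by_cases h0 : affinePoint (0 : K) = x
    · exact h4 ((h1 1 (h0 ▸ h5.symm)).trans (h2 (h0 ▸ h3.symm)).symm)
    · by_cases h6 : affinePoint (1 : K) = x
      · exact h3 ((h1 0 h0).trans (h2 (h6 ▸ h4.symm)).symm)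
      · exact h5 ((h1 0 h0).trans (h1 1 h6).symm)
  obtain ⟨B, rfl, -, -⟩ := exists_frame hy.symm hzx.symm hzy.symm
  rw [autAct_smul, autAct_infinity] at hx
  set B' := Matrix.ProjGenLinGroup.map (φ : K →+* K) B with hB'
  have hpsl : (N * B')⁻¹ * (M * B) ∉ pslSubgroup K := by
    rw [mul_mem_pslSubgroup_iff, inv_mem_iff, mul_mem_pslSubgroup_iff, mul_mem_pslSubgroup_iff, hB',
      map_mem_pslSubgroup_iff]
    tauto
  obtain ⟨t, ht⟩ := exists_affinePoint_smul_eq φ hpsl <| by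
    rw [mul_smul, inv_smul_eq_iff, mul_smul, mul_smul, hx]
  refine ⟨B • affinePoint t, fun h => affinePoint_ne_infinity t (MulAction.injective B h), ?_⟩
  rw [mul_smul, inv_smul_eq_iff, mul_smul, mul_smul] at ht
  rw [ht, autAct_smul, autAct_affinePoint]

/-- A common point of circles of different types is never their only one. Both types occur since odd
q admits a nonsquare determinant. -/
theorem isTyping_twistedMap [Fintype (ℙ K (Fin 2 → K))] [Finite K] (hK : Odd (Nat.card K))
    (φ : K ≃+* K) :
    IsTyping (fun (M : PGL(2, K)) (x : ℙ K (Fin 2 → K) × ℙ K (Fin 2 → K)) =>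
      x.2 = twistedMap φ M x.1) (· ∈ pslSubgroup K) := by
  have key : ∀ M N : PGL(2, K), M ∈ pslSubgroup K → common
      (fun (M : PGL(2, K)) (x : ℙ K (Fin 2 → K) × ℙ K (Fin 2 → K)) => x.2 = twistedMap φ M x.1)
      M N = 1 → N ∈ pslSubgroup K := by
    intro M N hM h
    by_contra hN
    obtain ⟨⟨x, y⟩, ⟨hx, hy, -⟩, huniq⟩ := exists_touch_of_common h
    simp only [twistedMap, if_pos hM, if_neg hN] at hx hy huniq
    obtain ⟨x', hne, hx'⟩ := exists_second_common φ hM hN (hx.symm.trans hy)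
    exact hne (congrArg Prod.fst (huniq (x', M • x') rfl hx'))
  refine ⟨fun M N h => ⟨fun hM => key M N hM h, fun hN => key N M hN (by rwa [common_comm])⟩,
    ⟨1, one_mem _⟩, ?_⟩
  have := Fintype.ofFinite K
  have hK2 : ringChar K ≠ 2 := by
    intro h2
    have := FiniteField.even_card_iff_char_two.1 h2
    rw [← Nat.card_eq_fintype_card] at this
    rw [Nat.odd_iff] at hK
    omega
  obtain ⟨a, ha⟩ := FiniteField.exists_nonsquare hK2
  have ha0 : a ≠ 0 := by rintro rfl; exact ha (IsSquare.zero)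
  refine ⟨Matrix.ProjGenLinGroup.mk (Matrix.GeneralLinearGroup.mkOfDetNeZero !![a, 0; 0, 1]
    (by simpa using ha0)), ?_⟩
  rw [mem_pslSubgroup_iff]
  simpa [Matrix.GeneralLinearGroup.mkOfDetNeZero] using ha

theorem familyBound_twistedMap [Finite K] (hK : 2 < Nat.card K) (φ : K ≃+* K) :
    FamilyBound (Nat.card K) 2
      (fun (M : PGL(2, K)) (x : ℙ K (Fin 2 → K) × ℙ K (Fin 2 → K)) => x.2 = twistedMap φ M x.1) := by
  have : Finite PGL(2, K) := Finite.of_surjective _ Matrix.ProjGenLinGroup.mk_surjective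
  have := Fintype.ofFinite (ℙ K (Fin 2 → K))
  have := Fintype.ofFinite PGL(2, K)
  rcases Nat.even_or_odd (Nat.card K) with h | h
  · refine (isCirclePlane_twistedMap hK φ).familyBound_of_odd ?_
    rw [Nat.odd_iff]
    rw [Nat.even_iff] at h
    omega
  · exact (isCirclePlane_twistedMap hK φ).familyBound_of_type h even_two
      (isTyping_twistedMap h φ)

theorem twistedMap_eq_imp [Finite K] (hK : 2 < Nat.card K) (φ : K ≃+* K) {M N : PGL(2, K)}
    (h : ∀ x, twistedMap φ M x = twistedMap φ N x) : M = N := by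
  have : Finite PGL(2, K) := Finite.of_surjective _ Matrix.ProjGenLinGroup.mk_surjective
  have := Fintype.ofFinite (ℙ K (Fin 2 → K))
  have := Fintype.ofFinite PGL(2, K)
  exact (isCirclePlane_twistedMap hK φ).injective fun x => by rw [h]

theorem bound_twistedMinkowski [Finite K] (hK : 2 < Nat.card K) (φ : K ≃+* K)
    {F : Set (Set (minkowskiPlane φ).Point)} (hF : IsIntersectingFamily (minkowskiPlane φ) F)
    (P : (minkowskiPlane φ).Point) (S T : Set (Set (minkowskiPlane φ).Point))
    (hS : S = {c ∈ F | P ∈ c}) (hT : T = F \ S) {q : ℕ} (hKq : Nat.card K = q) :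
    (S.ncard : ℝ) * (T.ncard : ℝ) ≤
      ((q : ℝ) / ((q : ℝ) + ((2 : ℕ) : ℝ) - 2)) ^ 2 * lam q 2 *
        (1 - (S.ncard : ℝ) / ((q : ℝ) * ((q : ℝ) + 1 - ((2 : ℕ) : ℝ)))) *
        (1 - (T.ncard : ℝ) / ((q : ℝ) ^ 2 * ((q : ℝ) - 1))) := by
  subst hKq
  have : Finite PGL(2, K) := Finite.of_surjective _ Matrix.ProjGenLinGroup.mk_surjective
  have := Fintype.ofFinite PGL(2, K)
  refine (familyBound_twistedMap hK φ).transfer (minkowskiPlane φ) (Equiv.refl _)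
    (fun M => {x | x.2 = twistedMap φ M x.1}) ?_ ?_ (fun M x => Iff.rfl) F hF P S T hS hT
  · intro M N h
    refine twistedMap_eq_imp hK φ fun x => ?_
    have h1 : (x, twistedMap φ M x) ∈ {x : ℙ K (Fin 2 → K) × ℙ K (Fin 2 → K) |
      x.2 = twistedMap φ N x.1} := (Set.ext_iff.1 h (x, twistedMap φ M x)).1 rfl
    exact h1
  · ext c
    constructor
    · rintro ⟨M, rfl⟩
      exact ⟨M, rfl⟩
    · rintro ⟨M, rfl⟩
      exact ⟨M, rfl⟩

end ProjectiveLine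

end CircleGeometry

namespace CircleGeometry

/-! ### Hyperbolic quadrics via the Segre embedding. -/

section Segre

variable {K : Type u} [Field K]

theorem exists_isPlane_ker {p : Flat K} (hp : IsPlane p) :
    ∃ f : Module.Dual K (Fin 4 → K), f ≠ 0 ∧ LinearMap.ker f = p := by
  have hne : p ≠ ⊤ := by
    rintro rfl
    rw [IsPlane, finrank_top, Module.finrank_fin_fun] at hp
    omega
  obtain ⟨f, hf, hle⟩ := Submodule.exists_le_ker_of_lt_top p (lt_top_iff_ne_top.2 hne)
  exact ⟨f, hf, (Submodule.eq_of_le_of_finrank_eq hle (by rw [hp, isPlane_ker hf])).symm⟩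

theorem mk_eq_mk_iff_cross {u w : Fin 2 → K} (hu : u ≠ 0) (hw : w ≠ 0) :
    Projectivization.mk K u hu = Projectivization.mk K w hw ↔ u 0 * w 1 - u 1 * w 0 = 0 := by
  rw [Projectivization.mk_eq_mk_iff']
  constructor
  · rintro ⟨a, rfl⟩
    simp only [Pi.smul_apply, smul_eq_mul]
    ring
  · intro h
    by_cases h0 : w 0 = 0
    · have h1 : w 1 ≠ 0 := fun h1 => hw (by ext i; fin_cases i <;> assumption)
      refine ⟨u 1 / w 1, ?_⟩
      ext i
      fin_cases i
      · simp only [Fin.zero_eta, Pi.smul_apply, smul_eq_mul, h0, mul_zero]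
        rw [h0, mul_zero, sub_zero] at h
        exact ((mul_eq_zero.1 h).resolve_right h1).symm
      · simp [h1]
    · refine ⟨u 0 / w 0, ?_⟩
      ext i
      fin_cases i
      · simp [h0]
      · simp only [Fin.mk_one, Pi.smul_apply, smul_eq_mul]
        field_simp
        linear_combination h

/-- Coordinates adapted to three pairwise disjoint lines. -/
theorem exists_matrix_coordinates {l₀ l₁ l₂ : Flat K} (h₀ : IsLine l₀) (h₁ : IsLine l₁)
    (h₂ : IsLine l₂) (h₀₁ : Disjoint l₀ l₁) (h₀₂ : Disjoint l₀ l₂) (h₁₂ : Disjoint l₁ l₂) :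
    ∃ Ψ : Matrix (Fin 2) (Fin 2) K ≃ₗ[K] (Fin 4 → K),
      (∀ m, Ψ m ∈ l₀ ↔ m 1 = 0) ∧ (∀ m, Ψ m ∈ l₁ ↔ m 0 = 0) ∧ ∀ m, Ψ m ∈ l₂ ↔ m 0 = m 1 := by
  have hsup : l₀ ⊔ l₁ = ⊤ := by
    refine Submodule.eq_top_of_finrank_eq ?_
    have := Submodule.finrank_sup_add_finrank_inf_eq l₀ l₁
    rw [h₀₁.eq_bot, finrank_bot, h₀, h₁] at this
    rw [Module.finrank_fin_fun]
    omega
  obtain ⟨b⟩ : Nonempty (Module.Basis (Fin 2) K l₂) := ⟨Module.finBasisOfFinrankEq K l₂ h₂⟩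
  -- The components in `l₀` and `l₁` of a basis of `l₂` are bases of `l₀` and `l₁`, because `l₂` is
  -- disjoint from both. In these coordinates `l₂` consists of the matrices with equal rows.
  have hdec : ∀ i, ∃ e ∈ l₀, ∃ f ∈ l₁, e + f = b i := fun i =>
    Submodule.mem_sup.1 (hsup ▸ Submodule.mem_top)
  choose e he f hf hef using hdec
  have hcomb : ∀ x y : K, x • e 0 + y • e 1 + (x • f 0 + y • f 1) ∈ l₂ := by
    intro x y
    have : x • e 0 + y • e 1 + (x • f 0 + y • f 1) = x • (b 0 : Fin 4 → K) + y • (b 1) := by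
      rw [← hef, ← hef]; module
    rw [this]
    exact l₂.add_mem (l₂.smul_mem _ (b 0).2) (l₂.smul_mem _ (b 1).2)
  have hb : ∀ x y : K, x • e 0 + y • e 1 + (x • f 0 + y • f 1) = 0 → x = 0 ∧ y = 0 := by
    intro x y h
    have h1 := b.linearIndependent
    rw [Fintype.linearIndependent_iff] at h1
    have h2 := h1 ![x, y] (by
      apply Subtype.ext
      simp only [Fin.sum_univ_two, Matrix.cons_val_zero, Matrix.cons_val_one, Submodule.coe_add,
        Submodule.coe_smul, ZeroMemClass.coe_zero, ← hef]
      rw [← h]; module)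
    exact ⟨h2 0, h2 1⟩
  have hemem : ∀ x y : K, x • e 0 + y • e 1 ∈ l₀ := fun x y =>
    l₀.add_mem (l₀.smul_mem _ (he 0)) (l₀.smul_mem _ (he 1))
  have hfmem : ∀ x y : K, x • f 0 + y • f 1 ∈ l₁ := fun x y =>
    l₁.add_mem (l₁.smul_mem _ (hf 0)) (l₁.smul_mem _ (hf 1))
  have hE : ∀ x y : K, x • e 0 + y • e 1 = 0 → x = 0 ∧ y = 0 := by
    intro x y h
    have h1 := hcomb x y
    rw [h, zero_add] at h1
    refine hb x y ?_
    rw [h, zero_add]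
    exact Submodule.disjoint_def.1 h₁₂ _ (hfmem x y) h1
  have hF : ∀ x y : K, x • f 0 + y • f 1 = 0 → x = 0 ∧ y = 0 := by
    intro x y h
    have h1 := hcomb x y
    rw [h, add_zero] at h1
    refine hb x y ?_
    rw [h, add_zero]
    exact Submodule.disjoint_def.1 h₀₂ _ (hemem x y) h1
  let Ψ₀ : Matrix (Fin 2) (Fin 2) K →ₗ[K] (Fin 4 → K) :=
    { toFun := fun m => m 0 0 • e 0 + m 0 1 • e 1 + (m 1 0 • f 0 + m 1 1 • f 1)
      map_add' := fun m n => by simp only [Matrix.add_apply]; module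
      map_smul' := fun a m => by
        simp only [Matrix.smul_apply, smul_eq_mul, RingHom.id_apply]; module }
  have hΨ₀ : ∀ m, Ψ₀ m = m 0 0 • e 0 + m 0 1 • e 1 + (m 1 0 • f 0 + m 1 1 • f 1) := fun m => rfl
  have hrow : ∀ m : Matrix (Fin 2) (Fin 2) K, ∀ i, m i = 0 ↔ m i 0 = 0 ∧ m i 1 = 0 := by
    intro m i
    constructor
    · intro h; rw [h]; exact ⟨rfl, rfl⟩
    · rintro ⟨h0, h1⟩
      ext j
      fin_cases j
      · exact h0
      · exact h1
  have hm0 : ∀ m, Ψ₀ m ∈ l₀ ↔ m 1 = 0 := by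
    intro m
    rw [hΨ₀, Submodule.add_mem_iff_right _ (hemem _ _), hrow]
    constructor
    · intro h
      exact hF _ _ (Submodule.disjoint_def.1 h₀₁ _ h (hfmem _ _))
    · rintro ⟨h0, h1⟩
      rw [h0, h1, zero_smul, zero_smul, zero_add]
      exact l₀.zero_mem
  have hm1 : ∀ m, Ψ₀ m ∈ l₁ ↔ m 0 = 0 := by
    intro m
    rw [hΨ₀, Submodule.add_mem_iff_left _ (hfmem _ _), hrow]
    constructor
    · intro h
      exact hE _ _ (Submodule.disjoint_def.1 h₀₁ _ (hemem _ _) h)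
    · rintro ⟨h0, h1⟩
      rw [h0, h1, zero_smul, zero_smul, zero_add]
      exact l₁.zero_mem
  have hm2 : ∀ m, Ψ₀ m ∈ l₂ ↔ m 0 = m 1 := by
    intro m
    have h1 : Ψ₀ m = ((m 0 0 - m 1 0) • e 0 + (m 0 1 - m 1 1) • e 1) +
        (m 1 0 • e 0 + m 1 1 • e 1 + (m 1 0 • f 0 + m 1 1 • f 1)) := by
      rw [hΨ₀]; module
    rw [h1, Submodule.add_mem_iff_left _ (hcomb _ _)]
    constructor
    · intro h
      obtain ⟨h2, h3⟩ := hE _ _ (Submodule.disjoint_def.1 h₀₂ _ (hemem _ _) h)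
      ext j
      fin_cases j
      · exact sub_eq_zero.1 h2
      · exact sub_eq_zero.1 h3
    · intro h
      rw [h, sub_self, sub_self, zero_smul, zero_smul, zero_add]
      exact l₂.zero_mem
  have hinj : Function.Injective Ψ₀ := by
    rw [← LinearMap.ker_eq_bot, LinearMap.ker_eq_bot']
    intro m hm
    have h0 := (hm0 m).1 (hm ▸ l₀.zero_mem)
    have h1 := (hm1 m).1 (hm ▸ l₁.zero_mem)
    ext i j
    fin_cases i
    · exact congrFun h1 j
    · exact congrFun h0 j
  refine ⟨LinearEquiv.ofInjectiveOfFinrankEq Ψ₀ hinj ?_, hm0, hm1, hm2⟩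
  rw [Module.finrank_matrix, Module.finrank_fin_fun]
  simp

theorem vecMulVec_ne_zero {y a : Fin 2 → K} (hy : y ≠ 0) (ha : a ≠ 0) :
    Matrix.vecMulVec y a ≠ 0 := by
  obtain ⟨i, hi⟩ := Function.ne_iff.1 hy
  obtain ⟨j, hj⟩ := Function.ne_iff.1 ha
  intro h
  have := congrFun (congrFun h i) j
  rw [Matrix.vecMulVec_apply] at this
  exact mul_ne_zero hi hj this

/-- A transversal is spanned by a point of `l₀` and a point of `l₁`; its point on `l₂` has equal
rows, so both have proportional rows. Hence a transversal consists of the matrices `vecMulVec y a`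
with `a` fixed. -/
theorem mem_transversalUnion_iff {l₀ l₁ l₂ : Flat K}
    {Ψ : Matrix (Fin 2) (Fin 2) K ≃ₗ[K] (Fin 4 → K)}
    (h0 : ∀ m, Ψ m ∈ l₀ ↔ m 1 = 0) (h1 : ∀ m, Ψ m ∈ l₁ ↔ m 0 = 0) (h2 : ∀ m, Ψ m ∈ l₂ ↔ m 0 = m 1)
    {X : PG3 K} : X ∈ transversalUnion l₀ l₁ l₂ ↔
      ∃ y a : Fin 2 → K, a ≠ 0 ∧ X.rep = Ψ (Matrix.vecMulVec y a) := by
  have hΨ0 : ∀ {m}, Ψ m ≠ 0 ↔ m ≠ 0 := fun {m} => not_congr (map_eq_zero_iff Ψ Ψ.injective)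
  have hli : ∀ {a b : Fin 2 → K}, a ≠ 0 → b ≠ 0 →
      LinearIndependent K ![Ψ (Matrix.of ![a, 0]), Ψ (Matrix.of ![0, b])] := by
    intro a b ha hb
    rw [LinearIndependent.pair_iff]
    intro s t hst
    rw [← map_smul Ψ, ← map_smul Ψ, ← map_add Ψ, map_eq_zero_iff Ψ Ψ.injective] at hst
    have e0 : s • a = 0 := by ext j; simpa using congrFun (congrFun hst 0) j
    have e1 : t • b = 0 := by ext j; simpa using congrFun (congrFun hst 1) j
    exact ⟨(smul_eq_zero.1 e0).resolve_right ha, (smul_eq_zero.1 e1).resolve_right hb⟩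
  constructor
  · rintro ⟨m, hm, hm0, hm1, hm2, hX⟩
    obtain ⟨v, ⟨hvm, hv0⟩, hv⟩ := Submodule.exists_mem_ne_zero_of_ne_bot hm0
    obtain ⟨w, ⟨hwm, hw1⟩, hw⟩ := Submodule.exists_mem_ne_zero_of_ne_bot hm1
    obtain ⟨z, ⟨hzm, hz2⟩, hz⟩ := Submodule.exists_mem_ne_zero_of_ne_bot hm2
    obtain ⟨v, rfl⟩ := Ψ.surjective v
    obtain ⟨w, rfl⟩ := Ψ.surjective w
    obtain ⟨z, rfl⟩ := Ψ.surjective z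
    rw [SetLike.mem_coe, h0] at hv0
    rw [SetLike.mem_coe, h1] at hw1
    rw [SetLike.mem_coe, h2] at hz2
    rw [hΨ0] at hv hw hz
    have ev : v = Matrix.of ![v 0, 0] := by
      ext i j; fin_cases i
      · rfl
      · exact congrFun hv0 j
    have ew : w = Matrix.of ![0, w 1] := by
      ext i j; fin_cases i
      · exact congrFun hw1 j
      · rfl
    have ha : v 0 ≠ 0 := fun h => hv (by rw [ev, h]; ext i j; fin_cases i <;> rfl)
    have hb : w 1 ≠ 0 := fun h => hw (by rw [ew, h]; ext i j; fin_cases i <;> rfl)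
    have hspan : m = Submodule.span K {Ψ v, Ψ w} := by
      symm
      refine Submodule.eq_of_le_of_finrank_eq ?_ ?_
      · rw [Submodule.span_le]
        rintro _ (rfl | rfl)
        · exact hvm
        · exact hwm
      · have h3 := finrank_span_eq_card (hli ha hb)
        rw [Matrix.range_cons, Matrix.range_cons, Matrix.range_empty, Set.union_empty,
          Set.singleton_union, ← ev, ← ew] at h3
        rw [h3, hm, Fintype.card_fin]
    rw [SetLike.mem_coe, hspan, Submodule.mem_span_pair] at hzm
    obtain ⟨s, t, hst⟩ := hzm
    rw [← map_smul Ψ, ← map_smul Ψ, ← map_add Ψ] at hst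
    have hst := Ψ.injective hst
    have e0 : s • v 0 = z 0 := by ext j; simpa [hw1] using congrFun (congrFun hst 0) j
    have e1 : t • w 1 = z 1 := by ext j; simpa [hv0] using congrFun (congrFun hst 1) j
    have ht : t ≠ 0 := by
      rintro rfl
      rw [zero_smul] at e1
      exact hz (by ext i j; fin_cases i <;> simp [← e1, hz2])
    rw [mem_pointsOf, hspan, Submodule.mem_span_pair] at hX
    obtain ⟨x, y, hxy⟩ := hX
    refine ⟨![x, y * t⁻¹ * s], v 0, ha, ?_⟩
    rw [← hxy, ← map_smul Ψ, ← map_smul Ψ, ← map_add Ψ]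
    congr 1
    have ew1 : w 1 = (t⁻¹ * s) • v 0 := by
      rw [mul_smul, e0, hz2, ← e1, smul_smul, inv_mul_cancel₀ ht, one_smul]
    ext i j
    fin_cases i
    · simp [Matrix.vecMulVec_apply, hw1]
    · simp [Matrix.vecMulVec_apply, hv0, ew1]; ring
  · rintro ⟨y, a, ha, hX⟩
    have hmem0 : Ψ (Matrix.of ![a, 0]) ∈
        Submodule.span K {Ψ (Matrix.of ![a, 0]), Ψ (Matrix.of ![0, a])} :=
      Submodule.subset_span (by simp)
    have hmem1 : Ψ (Matrix.of ![0, a]) ∈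
        Submodule.span K {Ψ (Matrix.of ![a, 0]), Ψ (Matrix.of ![0, a])} :=
      Submodule.subset_span (by simp)
    obtain ⟨j, hj⟩ := Function.ne_iff.1 ha
    refine ⟨Submodule.span K {Ψ (Matrix.of ![a, 0]), Ψ (Matrix.of ![0, a])}, ?_, ?_, ?_, ?_, ?_⟩
    · have h3 := finrank_span_eq_card (hli ha ha)
      rw [Matrix.range_cons, Matrix.range_cons, Matrix.range_empty, Set.union_empty,
        Set.singleton_union] at h3
      rw [IsLine, h3, Fintype.card_fin]
    · refine (Submodule.ne_bot_iff _).2 ⟨Ψ (Matrix.of ![a, 0]), ⟨hmem0, (h0 _).2 rfl⟩, ?_⟩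
      exact hΨ0.2 fun h => hj (congrFun (congrFun h 0) j)
    · refine (Submodule.ne_bot_iff _).2 ⟨Ψ (Matrix.of ![0, a]), ⟨hmem1, (h1 _).2 rfl⟩, ?_⟩
      exact hΨ0.2 fun h => hj (congrFun (congrFun h 1) j)
    · refine (Submodule.ne_bot_iff _).2 ⟨Ψ (Matrix.of ![a, 0]) + Ψ (Matrix.of ![0, a]),
        ⟨Submodule.add_mem _ hmem0 hmem1, ?_⟩, ?_⟩
      · rw [← map_add]
        exact (h2 _).2 (by ext j; simp)
      · rw [← map_add]
        refine hΨ0.2 fun h => hj ?_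
        have := congrFun (congrFun h 0) j
        simpa using this
    · rw [mem_pointsOf, hX, Submodule.mem_span_pair]
      refine ⟨y 0, y 1, ?_⟩
      rw [← map_smul Ψ, ← map_smul Ψ, ← map_add Ψ]
      congr 1
      ext i j
      fin_cases i <;> simp [Matrix.vecMulVec_apply]

/-- The form on matrices whose zeros among the products `vecMulVec y a` are the pairs with `y`
proportional to `G a`. -/
def crossForm (G : Matrix (Fin 2) (Fin 2) K) : Module.Dual K (Matrix (Fin 2) (Fin 2) K) where
  toFun m := m 0 0 * G 1 0 + m 0 1 * G 1 1 - m 1 0 * G 0 0 - m 1 1 * G 0 1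
  map_add' m n := by simp only [Matrix.add_apply]; ring
  map_smul' a m := by simp only [Matrix.smul_apply, smul_eq_mul, RingHom.id_apply]; ring

theorem crossForm_vecMulVec (G : Matrix (Fin 2) (Fin 2) K) (y a : Fin 2 → K) :
    crossForm G (Matrix.vecMulVec y a) = y 0 * G.mulVec a 1 - y 1 * G.mulVec a 0 := by
  simp only [crossForm, LinearMap.coe_mk, AddHom.coe_mk, Matrix.vecMulVec_apply, Matrix.mulVec,
    dotProduct, Fin.sum_univ_two]
  ring

theorem crossForm_surjective (f : Module.Dual K (Matrix (Fin 2) (Fin 2) K)) :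
    ∃ G, crossForm G = f := by
  refine ⟨!![-f (Matrix.single 1 0 1), -f (Matrix.single 1 1 1);
    f (Matrix.single 0 0 1), f (Matrix.single 0 1 1)], ?_⟩
  refine Matrix.ext_linearMap _ fun i j => LinearMap.ext_ring ?_
  fin_cases i <;> fin_cases j <;> simp [crossForm]

variable {l₀ l₁ l₂ : Flat K} (Ψ : Matrix (Fin 2) (Fin 2) K ≃ₗ[K] (Fin 4 → K))

/-- The Segre embedding. -/
noncomputable def segre (z : ℙ K (Fin 2 → K) × ℙ K (Fin 2 → K)) : PG3 K :=
  Projectivization.mk K (Ψ (Matrix.vecMulVec z.2.rep z.1.rep))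
    ((map_ne_zero_iff Ψ Ψ.injective).2 (vecMulVec_ne_zero z.2.rep_nonzero z.1.rep_nonzero))

theorem segre_injective : Function.Injective (segre Ψ) := by
  rintro ⟨x, y⟩ ⟨x', y'⟩ h
  obtain ⟨c, hc⟩ := (Projectivization.mk_eq_mk_iff' _ _ _ _ _).1 h
  rw [← map_smul] at hc
  have hc := Ψ.injective hc
  have hij : ∀ i j, c * (y'.rep i * x'.rep j) = y.rep i * x.rep j := fun i j => by
    have := congrFun (congrFun hc i) j
    simpa [Matrix.vecMulVec_apply] using this
  obtain ⟨i, hi⟩ := Function.ne_iff.1 y.rep_nonzero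
  obtain ⟨j, hj⟩ := Function.ne_iff.1 x.rep_nonzero
  refine Prod.ext ?_ ?_
  · rw [← Projectivization.mk_rep x, ← Projectivization.mk_rep x', Projectivization.mk_eq_mk_iff']
    refine ⟨c * y'.rep i / y.rep i, ?_⟩
    ext k
    rw [Pi.smul_apply, smul_eq_mul, div_mul_eq_mul_div, mul_assoc, hij, mul_div_cancel_left₀ _ hi]
  · rw [← Projectivization.mk_rep y, ← Projectivization.mk_rep y', Projectivization.mk_eq_mk_iff']
    refine ⟨c * x'.rep j / x.rep j, ?_⟩
    ext k
    rw [Pi.smul_apply, smul_eq_mul, div_mul_eq_mul_div, mul_assoc, mul_comm (x'.rep j), hij,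
      mul_div_cancel_right₀ _ hj]

variable {Ψ}

theorem segre_mk {y a : Fin 2 → K} (hy : y ≠ 0) (ha : a ≠ 0) (h : Ψ (Matrix.vecMulVec y a) ≠ 0) :
    segre Ψ (Projectivization.mk K a ha, Projectivization.mk K y hy) =
      Projectivization.mk K (Ψ (Matrix.vecMulVec y a)) h := by
  rw [segre, Projectivization.mk_eq_mk_iff']
  obtain ⟨s, hs⟩ := Projectivization.exists_smul_eq_mk_rep K a ha
  obtain ⟨t, ht⟩ := Projectivization.exists_smul_eq_mk_rep K y hy
  refine ⟨t * s, ?_⟩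
  simp only
  rw [← hs, ← ht, ← map_smul]
  congr 1
  ext i j
  simp only [Matrix.smul_apply, Matrix.vecMulVec_apply, Pi.smul_apply, Units.smul_def, smul_eq_mul]
  ring

theorem range_segre (h0 : ∀ m, Ψ m ∈ l₀ ↔ m 1 = 0) (h1 : ∀ m, Ψ m ∈ l₁ ↔ m 0 = 0)
    (h2 : ∀ m, Ψ m ∈ l₂ ↔ m 0 = m 1) :
    Set.range (segre Ψ) = transversalUnion l₀ l₁ l₂ := by
  ext X
  rw [mem_transversalUnion_iff h0 h1 h2]
  constructor
  · rintro ⟨⟨x, y⟩, rfl⟩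
    obtain ⟨s, hs⟩ := Projectivization.exists_smul_eq_mk_rep K
      (Ψ (Matrix.vecMulVec y.rep x.rep))
      ((map_ne_zero_iff Ψ Ψ.injective).2 (vecMulVec_ne_zero y.rep_nonzero x.rep_nonzero))
    refine ⟨s • y.rep, x.rep, x.rep_nonzero, ?_⟩
    rw [segre, ← hs, Units.smul_def, ← map_smul]
    congr 1
    ext i j
    simp [Matrix.vecMulVec_apply, Units.smul_def, mul_assoc]
  · rintro ⟨y, a, ha, hX⟩
    have hX0 : Ψ (Matrix.vecMulVec y a) ≠ 0 := hX ▸ X.rep_nonzero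
    have hy : y ≠ 0 := by
      rintro rfl
      rw [Matrix.zero_vecMulVec, map_zero] at hX0
      exact hX0 rfl
    refine ⟨(Projectivization.mk K a ha, Projectivization.mk K y hy), ?_⟩
    rw [segre_mk hy ha hX0]
    simp only [← hX, Projectivization.mk_rep]

/-- The plane of `PG(3, K)` defined by a form on matrices. -/
noncomputable def formPlane (Ψ : Matrix (Fin 2) (Fin 2) K ≃ₗ[K] (Fin 4 → K))
    (G : Matrix (Fin 2) (Fin 2) K) : Flat K :=
  LinearMap.ker ((crossForm G).comp Ψ.symm.toLinearMap)

theorem mk_mem_formPlane {G : Matrix (Fin 2) (Fin 2) K} {m : Matrix (Fin 2) (Fin 2) K}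
    (h : Ψ m ≠ 0) : Projectivization.mk K (Ψ m) h ∈ pointsOf (formPlane Ψ G) ↔
      crossForm G m = 0 := by
  rw [mk_mem_pointsOf, formPlane, LinearMap.mem_ker]
  simp

theorem segre_mem_formPlane {g : GL (Fin 2) K} {z : ℙ K (Fin 2 → K) × ℙ K (Fin 2 → K)} :
    segre Ψ z ∈ pointsOf (formPlane Ψ g) ↔ z.2 = Matrix.ProjGenLinGroup.mk g • z.1 := by
  obtain ⟨x, y⟩ := z
  rw [segre, mk_mem_formPlane, crossForm_vecMulVec]
  conv_rhs => rw [← Projectivization.mk_rep y, ← Projectivization.mk_rep x]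
  rw [Projectivization.PGL.mk_smul_mk, mk_eq_mk_iff_cross]
  rfl

/-- In a collinearity of three points write x'' as a combination of x and x' and compare the
coefficients of x: M x'' is then proportional to M x, so x'' = x. -/
theorem noThreeCollinear_graph [Finite K] (M : PGL(2, K)) :
    NoThreeCollinear {X | ∃ x, segre Ψ (x, M • x) = X} := by
  rw [noThreeCollinear_iff]
  rintro _ ⟨x, rfl⟩ _ ⟨x', rfl⟩ _ ⟨x'', rfl⟩ h1 h2 h3 h4
  have hx1 : x ≠ x' := fun h => h1 (by rw [h])
  have hx2 : x ≠ x'' := fun h => h2 (by rw [h])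
  have hx3 : x' ≠ x'' := fun h => h3 (by rw [h])
  rw [segre, segre, segre, mk_mem_pointsOf, span₂_mk, Submodule.mem_span_pair] at h4
  obtain ⟨a, b, hab⟩ := h4
  rw [← map_smul, ← map_smul, ← map_add] at hab
  have hab := Ψ.injective hab
  simp only at hab
  have hli := Projectivization.linearIndependent_pair_iff_ne.2 hx1
  have hspan : x''.rep ∈ Submodule.span K {x.rep, x'.rep} := by
    have h1 := hli.span_eq_top_of_card_eq_finrank (by simp)
    rw [Matrix.range_cons, Matrix.range_cons, Matrix.range_empty, Set.union_empty,
      Set.singleton_union] at h1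
    rw [h1]; trivial
  obtain ⟨s, t, hst⟩ := Submodule.mem_span_pair.1 hspan
  rw [LinearIndependent.pair_iff] at hli
  have hs : s ≠ 0 := by
    rintro rfl
    refine hx3.symm ?_
    rw [← Projectivization.mk_rep x', ← Projectivization.mk_rep x'', Projectivization.mk_eq_mk_iff']
    exact ⟨t, by simpa using hst⟩
  have hrow : ∀ i, a * (M • x).rep i = (M • x'').rep i * s := by
    intro i
    refine sub_eq_zero.1 (hli _ (b * (M • x').rep i - (M • x'').rep i * t) ?_).1
    ext j
    have h5 := congrFun (congrFun hab i) j
    have h6 := congrFun hst j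
    simp only [Matrix.add_apply, Matrix.smul_apply, Matrix.vecMulVec_apply, Pi.add_apply,
      Pi.smul_apply, smul_eq_mul, Pi.zero_apply] at h5 h6 ⊢
    linear_combination h5 - (M • x'').rep i * h6
  refine hx2 (MulAction.injective M ?_)
  refine (?_ : M • x'' = M • x).symm
  rw [← Projectivization.mk_rep (M • x), ← Projectivization.mk_rep (M • x''),
    Projectivization.mk_eq_mk_iff']
  refine ⟨a / s, ?_⟩
  ext i
  rw [Pi.smul_apply, smul_eq_mul, div_mul_eq_mul_div, hrow, mul_div_cancel_right₀ _ hs]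

theorem isOvalPlane_formPlane [Finite K] (g : GL (Fin 2) K) :
    IsOvalPlane (Set.range (segre Ψ)) (formPlane Ψ g) := by
  have hset : pointsOf (formPlane Ψ g) ∩ Set.range (segre Ψ) =
      {X | ∃ x, segre Ψ (x, Matrix.ProjGenLinGroup.mk g • x) = X} := by
    ext X
    constructor
    · rintro ⟨hX, ⟨x, y⟩, rfl⟩
      rw [segre_mem_formPlane] at hX
      simp only at hX
      exact ⟨x, by rw [hX]⟩
    · rintro ⟨x, rfl⟩
      exact ⟨segre_mem_formPlane.2 rfl, _, rfl⟩
  refine ⟨isPlane_ker ?_, Set.inter_subset_left, ?_, ?_⟩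
  · intro h0
    have hdet := Matrix.GeneralLinearGroup.det_ne_zero g
    have hall : ∀ m, crossForm (g : Matrix (Fin 2) (Fin 2) K) m = 0 := fun m => by
      have := LinearMap.congr_fun h0 (Ψ m)
      simpa using this
    have e0 := hall (Matrix.single 0 0 1)
    have e1 := hall (Matrix.single 0 1 1)
    simp [crossForm] at e0 e1
    rw [Matrix.det_fin_two, e0, e1, mul_zero, mul_zero, sub_zero] at hdet
    exact hdet rfl
  · rw [hset, ← card_projectiveLine]
    have : {X | ∃ x, segre Ψ (x, Matrix.ProjGenLinGroup.mk g • x) = X} =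
      Set.range fun x => segre Ψ (x, Matrix.ProjGenLinGroup.mk g • x) := rfl
    rw [this, ← Nat.card_coe_set_eq]
    refine Nat.card_range_of_injective fun x x' h => ?_
    exact (Prod.mk.inj (segre_injective Ψ h)).1
  · rw [hset]
    exact noThreeCollinear_graph _

/-- If the matrix of the form annihilates a nonzero a, the plane contains all points `vecMulVec y
a`, which fill a line; three choices of y contradict ovality. -/
theorem exists_of_isOvalPlane [Finite K] {π : Flat K} (hπ : IsOvalPlane (Set.range (segre Ψ)) π) :
    ∃ g : GL (Fin 2) K, formPlane Ψ g = π := by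
  obtain ⟨f, -, hf⟩ := exists_isPlane_ker hπ.1
  obtain ⟨G, hG⟩ := crossForm_surjective (f.comp Ψ.toLinearMap)
  have hform : formPlane Ψ G = π := by
    have h1 : (f.comp Ψ.toLinearMap).comp Ψ.symm.toLinearMap = f := LinearMap.ext fun x => by simp
    rw [formPlane, hG, ← hf, h1]
  have hdet : G.det ≠ 0 := by
    intro hdet
    obtain ⟨a, ha, haG⟩ := Matrix.exists_mulVec_eq_zero_iff.2 hdet
    have hy0 : (![1, 0] : Fin 2 → K) ≠ 0 := fun h => one_ne_zero (congrFun h 0)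
    have hy1 : (![0, 1] : Fin 2 → K) ≠ 0 := fun h => one_ne_zero (congrFun h 1)
    have hy2 : (![1, 1] : Fin 2 → K) ≠ 0 := fun h => one_ne_zero (congrFun h 1)
    have hne : ∀ {y : Fin 2 → K}, y ≠ 0 → Ψ (Matrix.vecMulVec y a) ≠ 0 := fun hy =>
      (map_ne_zero_iff Ψ Ψ.injective).2 (vecMulVec_ne_zero hy ha)
    have hmem : ∀ {y : Fin 2 → K} (hy : y ≠ 0), segre Ψ (Projectivization.mk K a ha,
        Projectivization.mk K y hy) ∈ pointsOf π ∩ Set.range (segre Ψ) := by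
      intro y hy
      refine ⟨?_, _, rfl⟩
      rw [← hform, segre_mk hy ha (hne hy), mk_mem_formPlane, crossForm_vecMulVec, haG]
      simp
    have harc := noThreeCollinear_iff.1 hπ.2.2.2 _ (hmem hy0) _ (hmem hy1) _ (hmem hy2)
    refine harc ?_ ?_ ?_ ?_
    · refine fun h => ?_
      have := (Prod.mk.inj (segre_injective Ψ h)).2
      rw [mk_eq_mk_iff_cross] at this
      simp at this
    · refine fun h => ?_
      have := (Prod.mk.inj (segre_injective Ψ h)).2
      rw [mk_eq_mk_iff_cross] at this
      simp at this
    · refine fun h => ?_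
      have := (Prod.mk.inj (segre_injective Ψ h)).2
      rw [mk_eq_mk_iff_cross] at this
      simp at this
    · rw [segre_mk hy0 ha (hne hy0), segre_mk hy1 ha (hne hy1), segre_mk hy2 ha (hne hy2),
        mk_mem_pointsOf, span₂_mk, Submodule.mem_span_pair]
      refine ⟨1, 1, ?_⟩
      rw [one_smul, one_smul, ← map_add, ← Matrix.add_vecMulVec]
      congr 2
      ext i
      fin_cases i <;> simp
  exact ⟨Matrix.GeneralLinearGroup.mkOfDetNeZero G hdet, hform⟩

/-- Identifies the hyperbolic quadric with the Minkowski plane for the trivial automorphism. -/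
theorem twistedMap_refl (M : PGL(2, K)) (x : ℙ K (Fin 2 → K)) :
    twistedMap (RingEquiv.refl K) M x = M • x := by
  have h : autAct (RingEquiv.refl K) x = x := by
    induction x using Projectivization.ind with | h v hv => rfl
  rw [twistedMap, h, ite_self]

theorem bound_minkowski [Finite K] (hK : 2 < Nat.card K) {Q : Set (PG3 K)}
    (hQ : IsHyperbolicQuadric Q) {F : Set (Set Q)} (hF : IsIntersectingFamily (sections Q Q) F)
    (P : Q) (S T : Set (Set Q)) (hS : S = {c ∈ F | P ∈ c}) (hT : T = F \ S) {q : ℕ}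
    (hKq : Nat.card K = q) :
    (S.ncard : ℝ) * (T.ncard : ℝ) ≤
      ((q : ℝ) / ((q : ℝ) + ((2 : ℕ) : ℝ) - 2)) ^ 2 * lam q 2 *
        (1 - (S.ncard : ℝ) / ((q : ℝ) * ((q : ℝ) + 1 - ((2 : ℕ) : ℝ)))) *
        (1 - (T.ncard : ℝ) / ((q : ℝ) ^ 2 * ((q : ℝ) - 1))) := by
  subst hKq
  obtain ⟨l₀, l₁, l₂, h₀, h₁, h₂, h₀₁, h₀₂, h₁₂, rfl⟩ := hQ
  obtain ⟨Ψ, e0, e1, e2⟩ := exists_matrix_coordinates h₀ h₁ h₂ h₀₁ h₀₂ h₁₂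
  revert F P S T
  rw [← range_segre e0 e1 e2]
  intro F hF P S T hS hT
  have : Finite PGL(2, K) := Finite.of_surjective _ Matrix.ProjGenLinGroup.mk_surjective
  have := Fintype.ofFinite PGL(2, K)
  choose rep hrep using Matrix.ProjGenLinGroup.mk_surjective (n := Fin 2) (R := K)
  have hinc : ∀ (M : PGL(2, K)) (z : ℙ K (Fin 2 → K) × ℙ K (Fin 2 → K)),
      segre Ψ z ∈ pointsOf (formPlane Ψ (rep M)) ↔ z.2 = twistedMap (RingEquiv.refl K) M z.1 := by
    intro M z
    rw [segre_mem_formPlane, hrep, twistedMap_refl]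
  refine (familyBound_twistedMap hK (RingEquiv.refl K)).transfer
    (sections (Set.range (segre Ψ)) (Set.range (segre Ψ)))
    (Equiv.ofInjective (segre Ψ) (segre_injective Ψ))
    (fun M => {x : Set.range (segre Ψ) | (x : PG3 K) ∈ pointsOf (formPlane Ψ (rep M))}) ?_ ?_
    hinc F hF P S T hS hT
  · intro M N h
    refine twistedMap_eq_imp hK (RingEquiv.refl K) fun x => ?_
    have h1 := Set.ext_iff.1 h ⟨segre Ψ (x, twistedMap (RingEquiv.refl K) M x), _, rfl⟩
    exact (hinc N (x, _)).1 (h1.1 ((hinc M (x, _)).2 rfl))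
  · ext c
    constructor
    · rintro ⟨π, hπ, rfl⟩
      obtain ⟨g, rfl⟩ := exists_of_isOvalPlane hπ
      refine ⟨Matrix.ProjGenLinGroup.mk g, ?_⟩
      ext ⟨_, z, rfl⟩
      change segre Ψ z ∈ pointsOf (formPlane Ψ (rep (Matrix.ProjGenLinGroup.mk g))) ↔
        segre Ψ z ∈ pointsOf (formPlane Ψ g)
      rw [segre_mem_formPlane, segre_mem_formPlane, hrep]
    · rintro ⟨M, rfl⟩
      exact ⟨_, isOvalPlane_formPlane (rep M), rfl⟩

end Segre

end CircleGeometry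

namespace CircleGeometry

/-! ### Counting points of a set on pencils of lines and planes. -/

section Counting

open Finset Module
open scoped Classical

variable {K : Type u} [Field K]

theorem finrank_sup_submodule {W : Flat K} {X : PG3 K} (hX : X ∉ pointsOf W) :
    finrank K (W ⊔ X.submodule : Flat K) = finrank K W + 1 := by
  have h := Submodule.finrank_sup_add_finrank_inf_eq W X.submodule
  have hbot : W ⊓ X.submodule = ⊥ := by
    rw [Projectivization.submodule_eq, Submodule.eq_bot_iff]
    rintro v ⟨hv, hv'⟩
    obtain ⟨a, rfl⟩ := Submodule.mem_span_singleton.1 hv'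
    by_contra h0
    have ha : a ≠ 0 := by rintro rfl; exact h0 (zero_smul _ _)
    exact hX (mem_pointsOf.2 ((Submodule.smul_mem_iff W ha).1 hv))
  rw [hbot, finrank_bot, add_zero, Projectivization.finrank_submodule] at h
  exact h

theorem sup_submodule_eq {W M : Flat K} {X : PG3 K} (hX : X ∉ pointsOf W) (hWM : W ≤ M)
    (hXM : X ∈ pointsOf M) (hM : finrank K M = finrank K W + 1) : W ⊔ X.submodule = M :=
  Submodule.eq_of_le_of_finrank_eq (sup_le hWM hXM) (by rw [finrank_sup_submodule hX, hM])

/-- The number of points of `s` on a subspace. -/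
noncomputable def cnt (s : Finset (PG3 K)) (W : Flat K) : ℕ := #{X ∈ s | X ∈ pointsOf W}

theorem card_vectors [Fintype K] (W : Flat K) :
    #{v : Fin 4 → K | v ∈ W} = Nat.card K ^ finrank K W := by
  rw [← Module.natCard_eq_pow_finrank (K := K) (V := W), Nat.card_eq_fintype_card,
    Fintype.card_subtype]

theorem cnt_mono (s : Finset (PG3 K)) {W U : Flat K} (h : W ≤ U) : cnt s W ≤ cnt s U :=
  card_le_card fun X hX => by
    rw [mem_filter] at hX ⊢
    exact ⟨hX.1, pointsOf_mono h hX.2⟩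

theorem cnt_top (s : Finset (PG3 K)) : cnt s ⊤ = #s := by
  rw [cnt, filter_true_of_mem]
  exact fun X _ => show X.submodule ≤ ⊤ from le_top

theorem mem_pointsOf_submodule {X Y : PG3 K} : X ∈ pointsOf Y.submodule ↔ X = Y := by
  constructor
  · intro h
    have h : X.submodule ≤ Y.submodule := h
    exact Projectivization.submodule_injective (Submodule.eq_of_le_of_finrank_eq h (by
      rw [X.finrank_submodule, Y.finrank_submodule]))
  · rintro rfl
    exact le_refl X.submodule

theorem cnt_submodule (s : Finset (PG3 K)) (X : PG3 K) :
    cnt s X.submodule = if X ∈ s then 1 else 0 := by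
  rw [cnt, ← card_singleton X]
  split_ifs with h
  · congr 1
    ext Y
    rw [mem_filter, mem_pointsOf_submodule, mem_singleton]
    exact ⟨fun h1 => h1.2, fun h1 => ⟨h1 ▸ h, h1⟩⟩
  · rw [card_eq_zero, filter_eq_empty_iff]
    intro Y hY h1
    exact h (mem_pointsOf_submodule.1 h1 ▸ hY)

theorem cnt_pos_iff {s : Finset (PG3 K)} {W : Flat K} : 0 < cnt s W ↔ ∃ X ∈ s, X ∈ pointsOf W := by
  rw [cnt, card_pos, filter_nonempty_iff]

theorem one_lt_cnt_iff {s : Finset (PG3 K)} {W : Flat K} :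
    1 < cnt s W ↔ ∃ X ∈ s, ∃ Y ∈ s, X ∈ pointsOf W ∧ Y ∈ pointsOf W ∧ X ≠ Y := by
  rw [cnt, one_lt_card]
  simp only [mem_filter]
  constructor
  · rintro ⟨X, ⟨h1, h2⟩, Y, ⟨h3, h4⟩, h5⟩
    exact ⟨X, h1, Y, h3, h2, h4, h5⟩
  · rintro ⟨X, h1, Y, h3, h2, h4, h5⟩
    exact ⟨X, ⟨h1, h2⟩, Y, ⟨h3, h4⟩, h5⟩

theorem eq_of_cnt_le_one {s : Finset (PG3 K)} {W : Flat K} (h : cnt s W ≤ 1) {X Y : PG3 K}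
    (hX : X ∈ s) (hY : Y ∈ s) (hXW : X ∈ pointsOf W) (hYW : Y ∈ pointsOf W) : X = Y :=
  card_le_one.1 h X (mem_filter.2 ⟨hX, hXW⟩) Y (mem_filter.2 ⟨hY, hYW⟩)

theorem isLine_inf {p p' : Flat K} (hp : IsPlane p) (hp' : IsPlane p') (h : p ≠ p') :
    IsLine (p ⊓ p') := by
  have h1 := Submodule.finrank_sup_add_finrank_inf_eq p p'
  have h2 : finrank K (p ⊔ p' : Flat K) ≤ 4 := by
    have := Submodule.finrank_le (p ⊔ p' : Flat K)
    rwa [Module.finrank_fin_fun] at this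
  have h3 : finrank K p < finrank K (p ⊔ p' : Flat K) := by
    refine Submodule.finrank_lt_finrank_of_lt (lt_of_le_of_ne le_sup_left fun h3 => h ?_)
    have : p' ≤ p := h3 ▸ le_sup_right
    exact (Submodule.eq_of_le_of_finrank_eq this (by rw [hp, hp'])).symm
  rw [IsPlane] at hp hp'
  rw [IsLine]
  omega

theorem exists_point_inf {p l l' : Flat K} (hp : IsPlane p) (hl : IsLine l) (hl' : IsLine l')
    (hlp : l ≤ p) (hlp' : l' ≤ p) : ∃ X : PG3 K, X ∈ pointsOf l ∧ X ∈ pointsOf l' := by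
  have h1 := Submodule.finrank_sup_add_finrank_inf_eq l l'
  have h2 : finrank K (l ⊔ l' : Flat K) ≤ 3 := by
    rw [← hp]; exact Submodule.finrank_mono (sup_le hlp hlp')
  have h3 : l ⊓ l' ≠ ⊥ := by
    intro h
    rw [h, finrank_bot, hl, hl'] at h1
    omega
  obtain ⟨v, ⟨hv, hv'⟩, hv0⟩ := Submodule.exists_mem_ne_zero_of_ne_bot h3
  exact ⟨Projectivization.mk K v hv0, (mk_mem_pointsOf hv0).2 hv, (mk_mem_pointsOf hv0).2 hv'⟩

theorem line_eq_of_points {l l' : Flat K} (hl : IsLine l) (hl' : IsLine l') {X Y : PG3 K}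
    (h : X ≠ Y) (hX : X ∈ pointsOf l) (hY : Y ∈ pointsOf l) (hX' : X ∈ pointsOf l')
    (hY' : Y ∈ pointsOf l') : l = l' := by
  rw [← span₂_eq h hl hX hY, span₂_eq h hl' hX' hY']

/-- Two distinct lines through a point span a plane. -/
theorem isPlane_sup {l l' : Flat K} (hl : IsLine l) (hl' : IsLine l') (h : l ≠ l') {X : PG3 K}
    (hX : X ∈ pointsOf l) (hX' : X ∈ pointsOf l') : IsPlane (l ⊔ l') := by
  have h1 := Submodule.finrank_sup_add_finrank_inf_eq l l'
  have h2 : finrank K (l ⊓ l' : Flat K) = 1 := by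
    refine le_antisymm ?_ ?_
    · have h3 : finrank K (l ⊓ l' : Flat K) < finrank K l := by
        refine Submodule.finrank_lt_finrank_of_lt (lt_of_le_of_ne inf_le_left fun h3 => h ?_)
        exact Submodule.eq_of_le_of_finrank_eq (inf_eq_left.1 h3) (by rw [hl, hl'])
      rw [hl] at h3
      omega
    · rw [← X.finrank_submodule]
      exact Submodule.finrank_mono (le_inf hX hX')
  rw [hl, hl', h2] at h1
  rw [IsPlane]
  omega

variable [Finite K]

noncomputable instance : Fintype (PG3 K) := Fintype.ofFinite _

noncomputable instance : Fintype (Flat K) := Fintype.ofFinite _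

/-- The subspaces covering `W` inside `U`. -/
noncomputable def mid (W U : Flat K) : Finset (Flat K) :=
  {M | W ≤ M ∧ M ≤ U ∧ finrank K M = finrank K W + 1}

theorem mem_mid {W U M : Flat K} : M ∈ mid W U ↔ W ≤ M ∧ M ≤ U ∧ finrank K M = finrank K W + 1 := by
  simp [mid]

theorem card_mid_through {W U : Flat K} (hWU : W ≤ U) {X : PG3 K} (hX : X ∈ pointsOf U)
    (hXW : X ∉ pointsOf W) : #{M ∈ mid W U | X ∈ pointsOf M} = 1 := by
  rw [card_eq_one]
  refine ⟨W ⊔ X.submodule, ?_⟩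
  ext M
  rw [mem_filter, mem_mid, mem_singleton]
  constructor
  · rintro ⟨⟨h1, -, h3⟩, h4⟩
    exact (sup_submodule_eq hXW h1 h4 h3).symm
  · rintro rfl
    exact ⟨⟨le_sup_left, sup_le hWU hX, finrank_sup_submodule hXW⟩,
      show X.submodule ≤ _ from le_sup_right⟩

theorem card_mid {W U : Flat K} (hWU : W ≤ U) (hd : finrank K U = finrank K W + 2) :
    #(mid W U) = Nat.card K + 1 := by
  have := Fintype.ofFinite K
  have hq : 1 < Nat.card K := Finite.one_lt_card
  set q := Nat.card K with hqdef
  have hdiff : ∀ {M : Flat K}, W ≤ M → #{v : Fin 4 → K | v ∈ M ∧ v ∉ W} + q ^ finrank K W =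
      q ^ finrank K M := by
    intro M hM
    have h := card_filter_add_card_filter_not (s := ({v | v ∈ M} : Finset (Fin 4 → K))) (· ∈ W)
    rw [filter_filter, filter_filter, card_vectors] at h
    have h2 : #{v : Fin 4 → K | v ∈ M ∧ v ∈ W} = q ^ finrank K W := by
      rw [← card_vectors]
      congr 1
      ext v
      simp only [mem_filter, mem_univ, true_and, and_iff_right_iff_imp]
      exact fun h => hM h
    rw [h2] at h
    rw [hqdef, ← h, add_comm]
  -- Every vector of `U` outside `W` lies in exactly one intermediate subspace, so their number is
  -- the quotient of q^(d+2) - q^d by q^(d+1) - q^d, where d is the dimension of `W`.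
  have key := sum_card_bipartiteAbove_eq_sum_card_bipartiteBelow (s := mid W U)
    (t := ({v | v ∈ U ∧ v ∉ W} : Finset (Fin 4 → K))) (fun M v => v ∈ M)
  have h1 : ∀ v ∈ ({v | v ∈ U ∧ v ∉ W} : Finset (Fin 4 → K)),
      #(bipartiteBelow (fun (M : Flat K) v => v ∈ M) (mid W U) v) = 1 := by
    intro v hv
    simp only [mem_filter, mem_univ, true_and] at hv
    have hv0 : v ≠ 0 := by rintro rfl; exact hv.2 W.zero_mem
    rw [← card_mid_through hWU ((mk_mem_pointsOf hv0).2 hv.1)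
      (fun h => hv.2 ((mk_mem_pointsOf hv0).1 h)), bipartiteBelow]
    simp only [mk_mem_pointsOf]
  have h2 : ∀ M ∈ mid W U, #(bipartiteAbove (fun (M : Flat K) v => v ∈ M)
      ({v | v ∈ U ∧ v ∉ W} : Finset (Fin 4 → K)) M) = q ^ (finrank K W + 1) - q ^ finrank K W := by
    intro M hM
    rw [mem_mid] at hM
    rw [← hM.2.2, ← hdiff hM.1, Nat.add_sub_cancel, bipartiteAbove, filter_filter]
    congr 1
    ext v
    simp only [mem_filter, mem_univ, true_and]
    constructor
    · rintro ⟨⟨_, h2⟩, h3⟩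
      exact ⟨h3, h2⟩
    · rintro ⟨h2, h3⟩
      exact ⟨⟨hM.2.1 h2, h3⟩, h2⟩
  rw [sum_congr rfl h1, sum_congr rfl h2, sum_const, sum_const, smul_eq_mul, smul_eq_mul, mul_one]
    at key
  have h3 := hdiff hWU
  rw [hd, ← key] at h3
  have hpos : 0 < q ^ finrank K W := pow_pos (by omega) _
  obtain ⟨c, hc⟩ : ∃ c, q = c + 1 := ⟨q - 1, by omega⟩
  have h4 : q ^ (finrank K W + 1) - q ^ finrank K W = c * q ^ finrank K W := by
    rw [pow_succ, mul_comm, ← Nat.sub_one_mul]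
    congr 1
    omega
  rw [h4, pow_add] at h3
  have h5 : (#(mid W U) * c + 1) * q ^ finrank K W = q ^ 2 * q ^ finrank K W := by
    rw [add_mul, one_mul, mul_assoc, h3, mul_comm]
  have h6 := Nat.eq_of_mul_eq_mul_right hpos h5
  have h7 : #(mid W U) * c = (q + 1) * c := by
    have : q ^ 2 = (q + 1) * c + 1 := by rw [hc]; ring
    omega
  exact Nat.eq_of_mul_eq_mul_right (by omega) h7

/-- A point of `U` off `W` lies on one intermediate subspace, a point of `W` on all q + 1. This
serves both for the lines of a plane through a point and for the planes through a line. -/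
theorem sum_cnt_mid {W U : Flat K} (hWU : W ≤ U) (hd : finrank K U = finrank K W + 2)
    (s : Finset (PG3 K)) :
    ∑ M ∈ mid W U, cnt s M = cnt s U + Nat.card K * cnt s W := by
  have key := sum_card_bipartiteAbove_eq_sum_card_bipartiteBelow (s := mid W U)
    (t := ({X ∈ s | X ∈ pointsOf U} : Finset (PG3 K))) (fun M X => X ∈ pointsOf M)
  have h1 : ∀ M ∈ mid W U, #(bipartiteAbove (fun (M : Flat K) X => X ∈ pointsOf M)
      ({X ∈ s | X ∈ pointsOf U} : Finset (PG3 K)) M) = cnt s M := by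
    intro M hM
    rw [mem_mid] at hM
    rw [cnt, bipartiteAbove, filter_filter]
    congr 1
    ext X
    simp only [mem_filter]
    exact ⟨fun h => ⟨h.1, h.2.2⟩, fun h => ⟨h.1, pointsOf_mono hM.2.1 h.2, h.2⟩⟩
  have h2 : ∀ X ∈ ({X ∈ s | X ∈ pointsOf U} : Finset (PG3 K)),
      #(bipartiteBelow (fun (M : Flat K) X => X ∈ pointsOf M) (mid W U) X) =
      1 + if X ∈ pointsOf W then Nat.card K else 0 := by
    intro X hX
    rw [mem_filter] at hX
    split_ifs with hW
    · rw [add_comm, ← card_mid hWU hd, bipartiteBelow, filter_true_of_mem]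
      intro M hM
      exact pointsOf_mono (mem_mid.1 hM).1 hW
    · rw [add_zero, ← card_mid_through hWU hX.2 hW, bipartiteBelow]
  rw [sum_congr rfl h1, sum_congr rfl h2, sum_add_distrib, ← sum_filter, sum_const, sum_const,
    filter_filter, smul_eq_mul, smul_eq_mul, mul_one] at key
  rw [key, cnt, cnt, mul_comm (Nat.card K)]
  congr 3
  ext X
  simp only [mem_filter]
  exact ⟨fun h => ⟨h.1, h.2.2⟩, fun h => ⟨h.1, pointsOf_mono hWU h.2, h.2⟩⟩

/-- The lines through a point of a plane. -/
theorem sum_cnt_pencil (s : Finset (PG3 K)) {p : Flat K} (hp : IsPlane p) {X : PG3 K}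
    (hX : X ∈ pointsOf p) : ∑ l ∈ mid X.submodule p, cnt s l =
      cnt s p + Nat.card K * if X ∈ s then 1 else 0 := by
  rw [sum_cnt_mid hX (by rw [hp, X.finrank_submodule]), cnt_submodule]

theorem card_pencil {p : Flat K} (hp : IsPlane p) {X : PG3 K} (hX : X ∈ pointsOf p) :
    #(mid X.submodule p) = Nat.card K + 1 :=
  card_mid hX (by rw [hp, X.finrank_submodule])

theorem mem_pencil {p l : Flat K} {X : PG3 K} :
    l ∈ mid X.submodule p ↔ X ∈ pointsOf l ∧ l ≤ p ∧ IsLine l := by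
  rw [mem_mid, X.finrank_submodule]; rfl

/-- The planes through a line. -/
theorem sum_cnt_axis (s : Finset (PG3 K)) {l : Flat K} (hl : IsLine l) :
    ∑ p ∈ mid l ⊤, cnt s p = #s + Nat.card K * cnt s l := by
  rw [sum_cnt_mid le_top (by rw [hl, finrank_top, Module.finrank_fin_fun]), cnt_top]

theorem card_axis {l : Flat K} (hl : IsLine l) : #(mid l ⊤) = Nat.card K + 1 :=
  card_mid le_top (by rw [hl, finrank_top, Module.finrank_fin_fun])

theorem mem_axis {p l : Flat K} (hl : IsLine l) : p ∈ mid l ⊤ ↔ l ≤ p ∧ IsPlane p := by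
  rw [mem_mid, hl]
  exact ⟨fun h => ⟨h.1, h.2.2⟩, fun h => ⟨h.1, le_top, h.2⟩⟩

theorem card_points_line {l : Flat K} (hl : IsLine l) :
    #{X : PG3 K | X ∈ pointsOf l} = Nat.card K + 1 := by
  have h1 := card_mid (bot_le : ⊥ ≤ l) (by rw [hl, finrank_bot])
  rw [← h1]
  refine card_bij (fun X _ => X.submodule) ?_ ?_ ?_
  · intro X hX
    simp only [mem_filter, mem_univ, true_and] at hX
    exact mem_mid.2 ⟨bot_le, hX, by rw [X.finrank_submodule, finrank_bot]⟩
  · intro X _ Y _ h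
    exact Projectivization.submodule_injective h
  · intro M hM
    rw [mem_mid, finrank_bot] at hM
    refine ⟨Projectivization.mk'' M hM.2.2, ?_, Projectivization.submodule_mk'' M hM.2.2⟩
    simp only [mem_filter, mem_univ, true_and]
    change (Projectivization.mk'' M hM.2.2).submodule ≤ l
    rw [Projectivization.submodule_mk'']
    exact hM.2.1

end Counting

end CircleGeometry

namespace CircleGeometry

/-! ### Plane sections of caps, in particular in odd order. -/

section Caps

open Finset Module
open scoped Classical

variable {K : Type u} [Field K]

theorem mem_pointsOf_inf {X : PG3 K} {W U : Flat K} (h : X ∈ pointsOf W) (h' : X ∈ pointsOf U) :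
    X ∈ pointsOf (W ⊓ U) :=
  show X.submodule ≤ W ⊓ U from le_inf h h'

/-- A cap: no three of the points are collinear. -/
def IsCap (s : Finset (PG3 K)) : Prop := ∀ l : Flat K, IsLine l → cnt s l ≤ 2

theorem isCap_iff {s : Finset (PG3 K)} : IsCap s ↔ NoThreeCollinear (s : Set (PG3 K)) := by
  refine forall₂_congr fun l _ => ?_
  rw [cnt, ← Set.ncard_coe_finset]
  have : (({X ∈ s | X ∈ pointsOf l} : Finset (PG3 K)) : Set (PG3 K)) = ↑s ∩ pointsOf l := by
    ext X; simp
  rw [this]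

variable [Finite K] {s : Finset (PG3 K)}

/-- If `X` is a point of the cap in the plane `p`, the lines of `p` through `X` are tangents or
secants. -/
theorem cnt_pencil_pos {p l : Flat K} {X : PG3 K} (hX : X ∈ s) (hl : l ∈ mid X.submodule p) :
    0 < cnt s l :=
  cnt_pos_iff.2 ⟨X, hX, (mem_pencil.1 hl).1⟩

/-- Each of the q + 1 lines of the plane through a point of the cap carries at most one further
point. -/
theorem IsCap.cnt_plane_le (hs : IsCap s) {p : Flat K} (hp : IsPlane p) :
    cnt s p ≤ Nat.card K + 2 := by
  rcases Nat.eq_zero_or_pos (cnt s p) with h | h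
  · omega
  · obtain ⟨X, hX, hXp⟩ := cnt_pos_iff.1 h
    have h1 := sum_cnt_pencil s hp hXp
    rw [if_pos hX] at h1
    have h2 := sum_le_card_nsmul (mid X.submodule p) (cnt s) 2
      fun l hl => hs l (mem_pencil.1 hl).2.2
    rw [card_pencil hp hXp, h1, smul_eq_mul] at h2
    omega

theorem IsCap.cnt_plane_le_of_tangent (hs : IsCap s) {p l : Flat K} (hp : IsPlane p)
    (hl : IsLine l) (hlp : l ≤ p) (h : cnt s l = 1) : cnt s p ≤ Nat.card K + 1 := by
  obtain ⟨X, hX, hXl⟩ := cnt_pos_iff.1 (by rw [h]; exact one_pos : 0 < cnt s l)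
  have hXp := pointsOf_mono hlp hXl
  have h1 := sum_cnt_pencil s hp hXp
  have hmem : l ∈ mid X.submodule p := mem_pencil.2 ⟨hXl, hlp, hl⟩
  rw [if_pos hX, ← add_sum_erase _ _ hmem, h] at h1
  have h2 : ∑ m ∈ (mid X.submodule p).erase l, cnt s m ≤ _ := sum_le_card_nsmul _ _ 2
    fun l hl => hs l (mem_pencil.1 (mem_of_mem_erase hl)).2.2
  rw [card_erase_of_mem hmem, card_pencil hp hXp, smul_eq_mul] at h2
  omega

theorem IsCap.exists_tangent (hs : IsCap s) {p : Flat K} (hp : IsPlane p)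
    (hc : cnt s p ≤ Nat.card K + 1) {X : PG3 K} (hX : X ∈ s) (hXp : X ∈ pointsOf p) :
    ∃ l ∈ mid X.submodule p, cnt s l = 1 := by
  by_contra! h
  have h1 := sum_cnt_pencil s hp hXp
  rw [if_pos hX, sum_congr rfl (g := fun _ => 2) fun l hl => ?_, sum_const, card_pencil hp hXp,
    smul_eq_mul] at h1
  · omega
  · have h2 := hs l (mem_pencil.1 hl).2.2
    have h3 := cnt_pencil_pos hX hl
    have h4 := h l hl
    omega

theorem IsCap.cnt_plane_le_of_two_tangents (hs : IsCap s) {p l l' : Flat K} (hp : IsPlane p)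
    {X : PG3 K} (hX : X ∈ s) (hl : l ∈ mid X.submodule p) (hl' : l' ∈ mid X.submodule p)
    (hne : l ≠ l') (h : cnt s l = 1) (h' : cnt s l' = 1) : cnt s p ≤ Nat.card K := by
  have hXp := pointsOf_mono (mem_pencil.1 hl).2.1 (mem_pencil.1 hl).1
  have h1 := sum_cnt_pencil s hp hXp
  have hmem : l' ∈ (mid X.submodule p).erase l := mem_erase.2 ⟨hne.symm, hl'⟩
  rw [if_pos hX, ← add_sum_erase _ _ hl, ← add_sum_erase _ _ hmem, h, h'] at h1
  have h2 : ∑ m ∈ ((mid X.submodule p).erase l).erase l', cnt s m ≤ _ := sum_le_card_nsmul _ _ 2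
    fun l hl => hs l (mem_pencil.1 (mem_of_mem_erase (mem_of_mem_erase hl))).2.2
  rw [card_erase_of_mem hmem, card_erase_of_mem hl, card_pencil hp hXp, smul_eq_mul] at h2
  have hK : 1 < Nat.card K := Finite.one_lt_card
  omega

/-- The tangent of an oval in a given point is unique. -/
theorem IsCap.tangent_unique (hs : IsCap s) {p l l' : Flat K} (hp : IsPlane p)
    (hc : cnt s p = Nat.card K + 1) {X : PG3 K} (hX : X ∈ s) (hl : l ∈ mid X.submodule p)
    (hl' : l' ∈ mid X.submodule p) (h : cnt s l = 1) (h' : cnt s l' = 1) : l = l' := by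
  by_contra hne
  have := hs.cnt_plane_le_of_two_tangents hp hX hl hl' hne h h'
  omega

/-- The lines through `X` partition the section, so one of them carries an odd number of points,
which is one. -/
theorem IsCap.exists_tangent_of_odd (hs : IsCap s) {p : Flat K} (hp : IsPlane p)
    (hodd : Odd (cnt s p)) {X : PG3 K} (hX : X ∉ s) (hXp : X ∈ pointsOf p) :
    ∃ l ∈ mid X.submodule p, cnt s l = 1 := by
  by_contra! h
  have h1 := sum_cnt_pencil s hp hXp
  rw [if_neg hX, mul_zero, add_zero] at h1
  have h2 : Even (∑ l ∈ mid X.submodule p, cnt s l) := by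
    refine even_sum _ fun l hl => ?_
    have h2 := hs l (mem_pencil.1 hl).2.2
    have h4 := h l hl
    rw [Nat.even_iff]
    omega
  rw [h1] at h2
  exact (Nat.not_even_iff_odd.2 hodd) h2

theorem IsCap.exists_notMem (hs : IsCap s) {l : Flat K} (hl : IsLine l) :
    ∃ X ∈ pointsOf l, X ∉ s := by
  by_contra! h
  have h1 := card_points_line hl
  have h2 : ({X | X ∈ pointsOf l} : Finset (PG3 K)) = ({X ∈ s | X ∈ pointsOf l} :
      Finset (PG3 K)) := by
    ext X
    simp only [mem_filter, mem_univ, true_and]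
    exact ⟨fun h3 => ⟨h X h3, h3⟩, fun h3 => h3.2⟩
  rw [h2] at h1
  have h3 := hs l hl
  have h4 : 1 < Nat.card K := Finite.one_lt_card
  rw [cnt] at h3
  omega

/-- In odd order, a plane meets a cap in at most `q + 1` points. -/
theorem IsCap.cnt_plane_le_of_odd (hs : IsCap s) (hq : Odd (Nat.card K)) {p : Flat K}
    (hp : IsPlane p) : cnt s p ≤ Nat.card K + 1 := by
  by_contra! h
  have h1 : cnt s p = Nat.card K + 2 := le_antisymm (hs.cnt_plane_le hp) h
  obtain ⟨Y, hY, Z, hZ, hYp, hZp, hYZ⟩ := one_lt_cnt_iff.1 (by omega : 1 < cnt s p)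
  have hle := span₂_le hYp hZp
  obtain ⟨X, hX, hXs⟩ := hs.exists_notMem (isLine_span₂ hYZ)
  -- A section of q + 2 points is odd in number, hence has a tangent through a point off the cap;
  -- but a tangent limits the section to q + 1 points.
  obtain ⟨l, hl, hl1⟩ := hs.exists_tangent_of_odd hp
    (by rw [h1]; exact hq.add_even even_two) hXs (pointsOf_mono hle hX)
  have := hs.cnt_plane_le_of_tangent hp (mem_pencil.1 hl).2.2 (mem_pencil.1 hl).2.1 hl1
  omega

omit [Finite K] in
theorem cnt_span₂ (hs : IsCap s) {X Y : PG3 K} (hX : X ∈ s) (hY : Y ∈ s) (h : X ≠ Y) :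
    cnt s (span₂ X Y) = 2 :=
  le_antisymm (hs _ (isLine_span₂ h))
    (one_lt_cnt_iff.2 ⟨X, hX, Y, hY, left_mem_span₂ X Y, right_mem_span₂ X Y, h⟩)

/-- The q + 1 planes through the secant have #s + 2q ≥ (q + 1)² points counted with multiplicity and
at most q + 1 each, so equality holds throughout. -/
theorem cnt_eq_of_secant {l : Flat K} (hl : IsLine l) (hc : cnt s l = 2)
    (hcard : Nat.card K ^ 2 + 1 ≤ #s)
    (h : ∀ p : Flat K, IsPlane p → l ≤ p → cnt s p ≤ Nat.card K + 1) :
    #s = Nat.card K ^ 2 + 1 ∧ ∀ p : Flat K, IsPlane p → l ≤ p → cnt s p = Nat.card K + 1 := by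
  have h1 := sum_cnt_axis s hl
  have h3 : ∀ p ∈ mid l ⊤, cnt s p ≤ Nat.card K + 1 := fun p hp =>
    h p ((mem_axis hl).1 hp).2 ((mem_axis hl).1 hp).1
  have h2 := sum_le_card_nsmul _ _ _ h3
  rw [card_axis hl, smul_eq_mul, h1, hc] at h2
  have h4 : #s = Nat.card K ^ 2 + 1 := by nlinarith
  refine ⟨h4, fun p hp hlp => ?_⟩
  have h5 : ∑ p ∈ mid l ⊤, cnt s p = ∑ p ∈ mid l ⊤, (Nat.card K + 1) := by
    rw [h1, sum_const, card_axis hl, smul_eq_mul, hc, h4]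
    ring
  exact (sum_eq_sum_iff_of_le h3).1 h5 p ((mem_axis hl).2 ⟨hlp, hp⟩)

/-- A plane that meets an ovoid in at least two points meets it in an oval. -/
theorem cnt_eq_of_two_le (hcard : #s = Nat.card K ^ 2 + 1) (hs : IsCap s)
    (h : ∀ p : Flat K, IsPlane p → cnt s p ≤ Nat.card K + 1) {p : Flat K} (hp : IsPlane p)
    (h2 : 2 ≤ cnt s p) : cnt s p = Nat.card K + 1 := by
  obtain ⟨X, hX, Y, hY, hXp, hYp, hXY⟩ := one_lt_cnt_iff.1 h2
  exact (cnt_eq_of_secant (isLine_span₂ hXY) (cnt_span₂ hs hX hY hXY) hcard.ge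
    fun p hp _ => h p hp).2 p hp (span₂_le hXp hYp)

end Caps

/-! ### Plane sections of ovoids in even order. -/

section Nucleus

open Finset Module
open scoped Classical

variable {K : Type u} [Field K] [Finite K] {s : Finset (PG3 K)}

/-- In even order, all lines of the plane of an oval through the intersection of two tangents are
tangents. -/
theorem IsCap.cnt_eq_one_of_two_tangents (hs : IsCap s) (hq : Even (Nat.card K)) {p : Flat K}
    (hp : IsPlane p) (hc : cnt s p = Nat.card K + 1) {N : PG3 K} (hN : N ∉ s)
    (hNp : N ∈ pointsOf p) {l₁ l₂ : Flat K} (h₁ : l₁ ∈ mid N.submodule p)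
    (h₂ : l₂ ∈ mid N.submodule p) (hne : l₁ ≠ l₂) (hc₁ : cnt s l₁ = 1) (hc₂ : cnt s l₂ = 1) :
    ∀ l ∈ mid N.submodule p, cnt s l = 1 := by
  -- On a secant L through N every point X lies on some tangent, with contact point y(X). The map y
  -- is injective on the q + 1 points of L, hence onto the oval, so every tangent is the one chosen
  -- for its intersection with L. Then only one tangent passes through N, a contradiction.
  have hnosec : ∀ L ∈ mid N.submodule p, cnt s L ≠ 2 := by
    intro L hL hL2
    obtain ⟨hNL, hLp, hLl⟩ := mem_pencil.1 hL
    have hτ : ∀ X ∈ pointsOf L, ∃ l ∈ mid X.submodule p, cnt s l = 1 := by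
      intro X hX
      by_cases hXs : X ∈ s
      · exact hs.exists_tangent hp hc.le hXs (pointsOf_mono hLp hX)
      · exact hs.exists_tangent_of_odd hp (by rw [hc]; exact hq.add_one) hXs (pointsOf_mono hLp hX)
    choose! τ hτ1 hτ2 using hτ
    have hy : ∀ X ∈ pointsOf L, ∃ Y ∈ s, Y ∈ pointsOf (τ X) := fun X hX =>
      cnt_pos_iff.1 (by rw [hτ2 X hX]; exact one_pos)
    choose! y hy1 hy2 using hy
    have huniq : ∀ X ∈ pointsOf L, ∀ l : Flat K, IsLine l → l ≤ p → cnt s l = 1 →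
        y X ∈ pointsOf l → τ X = l := by
      intro X hX l hl hlp hl1 hyl
      obtain ⟨-, h4, h5⟩ := mem_pencil.1 (hτ1 X hX)
      exact hs.tangent_unique hp hc (hy1 X hX) (mem_pencil.2 ⟨hy2 X hX, h4, h5⟩)
        (mem_pencil.2 ⟨hyl, hlp, hl⟩) (hτ2 X hX) hl1
    have hpt : ∀ X ∈ pointsOf L, ∀ Y ∈ pointsOf L, Y ∈ pointsOf (τ X) → X = Y := by
      intro X hX Y hY hYτ
      by_contra h
      obtain ⟨h3, -, h5⟩ := mem_pencil.1 (hτ1 X hX)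
      have := line_eq_of_points hLl h5 h hX hY h3 hYτ
      rw [this, hτ2 X hX] at hL2
      omega
    have hinj : Set.InjOn y ({X | X ∈ pointsOf L} : Finset (PG3 K)) := by
      intro X hX X' hX' h
      simp only [coe_filter, mem_univ, true_and] at hX hX'
      obtain ⟨h3, h4, h5⟩ := mem_pencil.1 (hτ1 X' hX')
      have h6 := huniq X hX _ h5 h4 (hτ2 X' hX') (h ▸ hy2 X' hX')
      exact hpt X hX X' hX' (h6 ▸ h3)
    have himg : image y ({X | X ∈ pointsOf L} : Finset (PG3 K)) = {X ∈ s | X ∈ pointsOf p} := by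
      refine eq_of_subset_of_card_le ?_ ?_
      · intro Y hY
        obtain ⟨X, hX, rfl⟩ := mem_image.1 hY
        simp only [mem_filter, mem_univ, true_and] at hX
        exact mem_filter.2 ⟨hy1 X hX,
          pointsOf_mono (mem_pencil.1 (hτ1 X hX)).2.1 (hy2 X hX)⟩
      · rw [card_image_of_injOn hinj, card_points_line hLl]
        exact hc.le
    have hfin : ∀ l ∈ mid N.submodule p, cnt s l = 1 → τ N = l := by
      intro l hl hl1
      obtain ⟨h3, h4, h5⟩ := mem_pencil.1 hl
      obtain ⟨Y, hY, hYl⟩ := cnt_pos_iff.1 (by rw [hl1]; exact one_pos : 0 < cnt s l)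
      have h6 : Y ∈ image y ({X | X ∈ pointsOf L} : Finset (PG3 K)) := by
        rw [himg]
        exact mem_filter.2 ⟨hY, pointsOf_mono h4 hYl⟩
      obtain ⟨X, hX, rfl⟩ := mem_image.1 h6
      simp only [mem_filter, mem_univ, true_and] at hX
      have h7 := huniq X hX l h5 h4 hl1 hYl
      have h8 := hpt X hX N hNL (h7 ▸ h3)
      rw [← h8, h7]
    exact hne ((hfin l₁ h₁ hc₁).symm.trans (hfin l₂ h₂ hc₂))
  have h1 := sum_cnt_pencil s hp hNp
  rw [if_neg hN, mul_zero, add_zero, hc, ← card_pencil hp hNp, card_eq_sum_ones] at h1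
  refine (sum_eq_sum_iff_of_le fun l hl => ?_).1 h1
  have h2 := hnosec l hl
  have h3 := hs l (mem_pencil.1 hl).2.2
  omega

/-- The tangent in a second point of the oval meets `l` in a point with two tangents. -/
theorem IsCap.exists_nucleus (hs : IsCap s) (hq : Even (Nat.card K)) {p : Flat K}
    (hp : IsPlane p) (hc : cnt s p = Nat.card K + 1) {l : Flat K} (hl : IsLine l) (hlp : l ≤ p)
    (hl1 : cnt s l = 1) : ∃ N ∈ pointsOf l, N ∉ s ∧ ∀ m ∈ mid N.submodule p, cnt s m = 1 := by
  have hq1 : 1 < Nat.card K := Finite.one_lt_card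
  obtain ⟨P, hP, hPl⟩ := cnt_pos_iff.1 (by rw [hl1]; exact one_pos : 0 < cnt s l)
  obtain ⟨Y, hYs, hYp, hYP⟩ : ∃ Y ∈ s, Y ∈ pointsOf p ∧ Y ≠ P := by
    obtain ⟨X, hX, Y, hY, hXp, hYp, hXY⟩ := one_lt_cnt_iff.1 (by omega : 1 < cnt s p)
    by_cases h : X = P
    · exact ⟨Y, hY, hYp, fun h' => hXY (h.trans h'.symm)⟩
    · exact ⟨X, hX, hXp, h⟩
  obtain ⟨m, hm, hm1⟩ := hs.exists_tangent hp hc.le hYs hYp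
  obtain ⟨hYm, hmp, hml⟩ := mem_pencil.1 hm
  obtain ⟨N, hNl, hNm⟩ := exists_point_inf hp hl hml hlp hmp
  have hlm : l ≠ m := by
    rintro rfl
    exact hYP (eq_of_cnt_le_one hl1.le hYs hP hYm hPl)
  have hN : N ∉ s := fun h => hYP ((eq_of_cnt_le_one hm1.le hYs h hYm hNm).trans
    (eq_of_cnt_le_one hl1.le h hP hNl hPl))
  exact ⟨N, hNl, hN, hs.cnt_eq_one_of_two_tangents hq hp hc hN (pointsOf_mono hlp hNl)
    (mem_pencil.2 ⟨hNl, hlp, hl⟩) (mem_pencil.2 ⟨hNm, hmp, hml⟩) hlm hl1 hm1⟩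

/-- A plane through a secant that contains the nucleus of an oval section. -/
theorem IsCap.cnt_plane_le_of_nucleus (hs : IsCap s) {p : Flat K} (hp : IsPlane p) {N : PG3 K}
    (hNp : N ∈ pointsOf p) (hN : ∀ m ∈ mid N.submodule p, cnt s m = 1) {L : Flat K}
    (hL : IsLine L) (hNL : N ∈ pointsOf L) (hL2 : cnt s L = 2) {M : Flat K} (hM : IsPlane M)
    (hLM : L ≤ M) : IsLine (M ⊓ p) ∧ cnt s (M ⊓ p) = 1 ∧ cnt s M ≤ Nat.card K + 1 := by
  have hMp : M ≠ p := by
    rintro rfl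
    have := hN L (mem_pencil.2 ⟨hNL, hLM, hL⟩)
    omega
  have h1 := isLine_inf hM hp hMp
  have h2 := hN (M ⊓ p) (mem_pencil.2 ⟨mem_pointsOf_inf (pointsOf_mono hLM hNL) hNp, inf_le_right, h1⟩)
  exact ⟨h1, h2, hs.cnt_plane_le_of_tangent hM h1 inf_le_left h2⟩

theorem IsCap.exists_secant (hs : IsCap s) {N : PG3 K}
    (hmax : ¬ IsCap (insert N s)) : ∃ L : Flat K, IsLine L ∧ N ∈ pointsOf L ∧ cnt s L = 2 := by
  unfold IsCap at hmax
  push Not at hmax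
  obtain ⟨L, hL, hcnt⟩ := hmax
  have h2 := hs L hL
  rw [cnt, filter_insert] at hcnt
  split_ifs at hcnt with hNL
  · refine ⟨L, hL, hNL, ?_⟩
    have := card_insert_le N ({X ∈ s | X ∈ pointsOf L} : Finset (PG3 K))
    rw [cnt] at h2 ⊢
    omega
  · rw [cnt] at h2
    omega

/-- Some plane p through the tangent l is oval, and its nucleus N lies on l. By maximality N is on a
secant; planes through such a secant have at most q + 1 points, which fixes #s and makes all of them
oval. Tangents through N stay in p, so a plane through l other than p without a secant through N
meets the cap only on l. -/
theorem IsCap.exists_tangent_plane_of_maximal (hs : IsCap s) (hq : Even (Nat.card K))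
    (hmax : ∀ N ∉ s, ¬ IsCap (insert N s)) (hcard : Nat.card K ^ 2 + 1 ≤ #s) {l : Flat K}
    (hl : IsLine l) (hl1 : cnt s l = 1) : #s = Nat.card K ^ 2 + 1 ∧
      ∃ σ : Flat K, IsPlane σ ∧ l ≤ σ ∧ cnt s σ = 1 := by
  have hq1 : 1 < Nat.card K := Finite.one_lt_card
  have hsum := sum_cnt_axis s hl
  rw [hl1, mul_one] at hsum
  obtain ⟨p, hp, hlp, hpc⟩ : ∃ p : Flat K, IsPlane p ∧ l ≤ p ∧ cnt s p = Nat.card K + 1 := by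
    by_contra! h
    have h1 := sum_le_card_nsmul (mid l ⊤) (cnt s) (Nat.card K) fun p hp => by
      obtain ⟨hlp, hp⟩ := (mem_axis hl).1 hp
      have h2 := hs.cnt_plane_le_of_tangent hp hl hlp hl1
      have h3 := h p hp hlp
      omega
    rw [hsum, card_axis hl, smul_eq_mul] at h1
    nlinarith
  obtain ⟨N, hNl, hNs, hN⟩ := hs.exists_nucleus hq hp hpc hl hlp hl1
  have hNp := pointsOf_mono hlp hNl
  have hsec : ∀ L : Flat K, IsLine L → N ∈ pointsOf L → cnt s L = 2 →
      #s = Nat.card K ^ 2 + 1 ∧ ∀ M : Flat K, IsPlane M → L ≤ M → cnt s M = Nat.card K + 1 :=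
    fun L hL hNL hL2 => cnt_eq_of_secant hL hL2 hcard fun M hM hLM =>
      (hs.cnt_plane_le_of_nucleus hp hNp hN hL hNL hL2 hM hLM).2.2
  obtain ⟨L, hL, hNL, hL2⟩ := hs.exists_secant (hmax N hNs)
  obtain ⟨hcard', hLM⟩ := hsec L hL hNL hL2
  refine ⟨hcard', ?_⟩
  -- A tangent m outside p would span with the secant L an oval plane in which N lies on two
  -- tangents, m and the intersection with p; then L would be a tangent as well.
  have htan : ∀ m : Flat K, IsLine m → N ∈ pointsOf m → cnt s m = 1 → m ≤ p := by
    intro m hm hNm hm1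
    by_contra hmp
    have hLm : L ≠ m := by rintro rfl; omega
    have hM := isPlane_sup hL hm hLm hNL hNm
    obtain ⟨h1, h2, -⟩ := hs.cnt_plane_le_of_nucleus hp hNp hN hL hNL hL2 hM le_sup_left
    have hne : (L ⊔ m) ⊓ p ≠ m := fun h => hmp (h ▸ inf_le_right)
    have h3 := hs.cnt_eq_one_of_two_tangents hq hM (hLM _ hM le_sup_left) hNs
      (pointsOf_mono le_sup_left hNL)
      (mem_pencil.2 ⟨mem_pointsOf_inf (pointsOf_mono le_sup_left hNL) hNp, inf_le_left, h1⟩)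
      (mem_pencil.2 ⟨hNm, le_sup_right, hm⟩) hne h2 hm1 L (mem_pencil.2 ⟨hNL, le_sup_left, hL⟩)
    omega
  by_contra! h
  -- Otherwise all q + 1 planes through l are oval, too many for q² + 1 points.
  have hall : ∀ σ ∈ mid l ⊤, cnt s σ = Nat.card K + 1 := by
    intro σ hσ
    obtain ⟨hlσ, hσp⟩ := (mem_axis hl).1 hσ
    by_cases hsecσ : ∃ L' ∈ mid N.submodule σ, cnt s L' = 2
    · obtain ⟨L', hL', hL'2⟩ := hsecσ
      obtain ⟨h1, h2, h3⟩ := mem_pencil.1 hL'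
      exact (hsec L' h3 h1 hL'2).2 σ hσp h2
    · push Not at hsecσ
      by_cases hσeq : σ = p
      · rw [hσeq, hpc]
      exfalso
      refine h σ hσp hlσ ?_
      have hNσ := pointsOf_mono hlσ hNl
      have h1 := sum_cnt_pencil s hσp hNσ
      rw [if_neg hNs, mul_zero, add_zero] at h1
      rw [← h1, sum_eq_single l]
      · exact hl1
      · intro m hm hml
        obtain ⟨h2, h3, h4⟩ := mem_pencil.1 hm
        have h5 := hs m h4
        have h6 := hsecσ m hm
        have h7 : cnt s m ≠ 1 := by
          intro h7
          have h8 := htan m h4 h2 h7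
          have h9 := isLine_inf hσp hp hσeq
          refine hml ?_
          rw [Submodule.eq_of_le_of_finrank_eq (le_inf h3 h8) (by rw [h4, h9]),
            Submodule.eq_of_le_of_finrank_eq (le_inf hlσ hlp) (by rw [hl, h9])]
        omega
      · exact fun h2 => (h2 (mem_pencil.2 ⟨hNl, hlσ, hl⟩)).elim
  rw [sum_congr rfl hall, sum_const, card_axis hl, smul_eq_mul, hcard'] at hsum
  nlinarith

/-- If no line through the point `P` of the cap `s` is tangent, then every plane through `P` meets
`s` in `q + 2` points. -/
theorem IsCap.cnt_plane_of_no_tangent (hs : IsCap s) {P : PG3 K} (hP : P ∈ s)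
    (h : ∀ l : Flat K, IsLine l → P ∈ pointsOf l → cnt s l ≠ 1) {p : Flat K} (hp : IsPlane p)
    (hPp : P ∈ pointsOf p) : cnt s p = Nat.card K + 2 := by
  have h1 := sum_cnt_pencil s hp hPp
  rw [if_pos hP, sum_congr rfl (g := fun _ => 2) fun l hl => ?_, sum_const, card_pencil hp hPp,
    smul_eq_mul] at h1
  · omega
  · obtain ⟨h2, h3, h4⟩ := mem_pencil.1 hl
    have h5 := hs l h4
    have h6 := cnt_pencil_pos hP hl
    have h7 := h l h4 h2
    omega

theorem IsCap.card_of_no_tangent (hs : IsCap s) {P : PG3 K} (hP : P ∈ s) (h1 : 1 < #s)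
    (h : ∀ l : Flat K, IsLine l → P ∈ pointsOf l → cnt s l ≠ 1) :
    #s = Nat.card K ^ 2 + Nat.card K + 2 := by
  obtain ⟨Y, hY, hYP⟩ := exists_mem_ne h1 P
  have hL := isLine_span₂ hYP.symm
  have h2 := sum_cnt_axis s hL
  rw [cnt_span₂ hs hP hY hYP.symm, sum_congr rfl (g := fun _ => Nat.card K + 2) fun p hp => ?_,
    sum_const, card_axis hL, smul_eq_mul] at h2
  · linarith
  · obtain ⟨h3, h4⟩ := (mem_axis hL).1 hp
    exact hs.cnt_plane_of_no_tangent hP h h4 (pointsOf_mono h3 (left_mem_span₂ P Y))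

/-- Without tangents every plane has 0 or q + 2 points, and the cap has q² + q + 2 points. Summing
over the planes through an exterior line shows that q + 2 divides this number, hence divides 4. -/
theorem IsCap.exists_line_tangent (hs : IsCap s) (hq : 2 < Nat.card K) (h1 : 1 < #s) :
    ∃ l : Flat K, IsLine l ∧ cnt s l = 1 := by
  by_contra! h
  obtain ⟨P, hP, Y, hY, hPY⟩ := one_lt_card.1 h1
  have hcard := hs.card_of_no_tangent hP h1 fun l hl _ => h l hl
  have hplane : ∀ p : Flat K, IsPlane p → cnt s p = 0 ∨ cnt s p = Nat.card K + 2 := by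
    intro p hp
    rcases Nat.eq_zero_or_pos (cnt s p) with h2 | h2
    · exact Or.inl h2
    · obtain ⟨X, hX, hXp⟩ := cnt_pos_iff.1 h2
      exact Or.inr (hs.cnt_plane_of_no_tangent hX (fun l hl _ => h l hl) hp hXp)
  have hL := isLine_span₂ hPY
  obtain ⟨N, hNL, hN⟩ := hs.exists_notMem hL
  obtain ⟨M, hM⟩ : (mid (span₂ P Y) ⊤).Nonempty := by
    rw [← card_pos, card_axis hL]
    omega
  obtain ⟨hLM, hMp⟩ := (mem_axis hL).1 hM
  have hNM := pointsOf_mono hLM hNL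
  obtain ⟨e, he, he0⟩ : ∃ e ∈ mid N.submodule M, cnt s e = 0 := by
    by_contra! h2
    have h3 := sum_cnt_pencil s hMp hNM
    rw [if_neg hN, sum_congr rfl (g := fun _ => 2) fun l hl => ?_, sum_const, card_pencil hMp hNM,
      smul_eq_mul, hs.cnt_plane_of_no_tangent hP (fun l hl _ => h l hl) hMp
      (pointsOf_mono hLM (left_mem_span₂ P Y))] at h3
    · omega
    · have h4 := hs l (mem_pencil.1 hl).2.2
      have h5 := h2 l hl
      have h6 := h l (mem_pencil.1 hl).2.2
      omega
  have hel := (mem_pencil.1 he).2.2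
  have h2 := sum_cnt_axis s hel
  rw [he0, mul_zero, add_zero, hcard] at h2
  have h3 : Nat.card K + 2 ∣ ∑ p ∈ mid e ⊤, cnt s p := dvd_sum fun p hp => by
    rcases hplane p ((mem_axis hel).1 hp).2 with h4 | h4 <;> rw [h4]
    exact dvd_zero _
  rw [h2] at h3
  have h4 : Nat.card K + 2 ∣ 4 := by
    obtain ⟨q, hqq⟩ : ∃ q, Nat.card K = q + 1 := ⟨Nat.card K - 1, by omega⟩
    rw [hqq] at h3 ⊢
    have h5 : (q + 1) ^ 2 + (q + 1) + 2 = (q + 1 + 2) * q + 4 := by ring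
    rw [h5] at h3
    exact (Nat.dvd_add_right (dvd_mul_right _ _)).1 h3
  have := Nat.le_of_dvd (by norm_num) h4
  omega

/-- In even order greater than two, an ovoid is maximal among caps. -/
theorem maximal_of_card (hq : Even (Nat.card K)) (hq2 : 2 < Nat.card K)
    (hcard : #s = Nat.card K ^ 2 + 1) : ∀ N ∉ s, ¬ IsCap (insert N s) := by
  intro N hN hcap
  -- A maximal cap containing the larger cap has a tangent line, hence exactly q² + 1 points, which
  -- is too few.
  obtain ⟨t, hst, ht⟩ := Finite.exists_le_maximal hcap
  have hlt : #s < #t := by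
    have h1 := card_le_card hst
    rw [card_insert_of_notMem hN] at h1
    omega
  have h1 : 1 < #t := by
    have : 0 < Nat.card K ^ 2 := by positivity
    omega
  obtain ⟨l, hl, hl1⟩ := ht.1.exists_line_tangent hq2 h1
  have h2 := (ht.1.exists_tangent_plane_of_maximal hq (fun X hX hcapX =>
    hX (ht.2 hcapX (subset_insert X t) (mem_insert_self X t))) (by omega) hl hl1).1
  omega

/-- In even order greater than two, a plane meets an ovoid in at most `q + 1` points. -/
theorem IsCap.cnt_plane_le_of_even (hs : IsCap s) (hq : Even (Nat.card K)) (hq2 : 2 < Nat.card K)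
    (hcard : #s = Nat.card K ^ 2 + 1) {p : Flat K} (hp : IsPlane p) :
    cnt s p ≤ Nat.card K + 1 := by
  rcases Nat.eq_zero_or_pos (cnt s p) with h | h
  · omega
  obtain ⟨P, hP, hPp⟩ := cnt_pos_iff.1 h
  obtain ⟨l, hl, hPl, hl1⟩ : ∃ l : Flat K, IsLine l ∧ P ∈ pointsOf l ∧ cnt s l = 1 := by
    by_contra! h
    have h1 : 0 < Nat.card K ^ 2 := by positivity
    have := hs.card_of_no_tangent hP (by omega) h
    omega
  obtain ⟨-, σ, hσ, hlσ, hσ1⟩ := hs.exists_tangent_plane_of_maximal hq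
    (maximal_of_card hq hq2 hcard) hcard.ge hl hl1
  by_cases hσp : σ = p
  · rw [← hσp, hσ1]
    omega
  -- The tangent plane at `P` meets `p` in a line whose only cap point is `P`, a tangent.
  have h1 := isLine_inf hσ hp hσp
  refine hs.cnt_plane_le_of_tangent hp h1 inf_le_right (le_antisymm ?_ ?_)
  · rw [← hσ1]
    exact cnt_mono s inf_le_left
  · exact cnt_pos_iff.2 ⟨P, hP, mem_pointsOf_inf (pointsOf_mono hlσ hPl) hPp⟩

theorem IsCap.cnt_plane_eq (hs : IsCap s) (hq2 : 2 < Nat.card K)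
    (hcard : #s = Nat.card K ^ 2 + 1) {p : Flat K} (hp : IsPlane p) (h2 : 2 ≤ cnt s p) :
    cnt s p = Nat.card K + 1 := by
  refine cnt_eq_of_two_le hcard hs (fun p hp => ?_) hp h2
  rcases Nat.even_or_odd (Nat.card K) with hq | hq
  · exact hs.cnt_plane_le_of_even hq hq2 hcard hp
  · exact hs.cnt_plane_le_of_odd hq hp

end Nucleus

end CircleGeometry

namespace CircleGeometry

/-! ### Ovoids as circle planes with trivial parallelism. -/

section Ovoid

open Finset Module
open scoped Classical

variable {K : Type u} [Field K] [Finite K] {s : Finset (PG3 K)}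

/-- The planes that meet `s` in `q + 1` points. -/
abbrev OvalPlanes (s : Finset (PG3 K)) : Type u :=
  {p : Flat K // IsPlane p ∧ cnt s p = Nat.card K + 1}

omit [Finite K] in
theorem card_filter_coe [Fintype (s : Set (PG3 K))] (P : PG3 K → Prop) :
    #{x : (s : Set (PG3 K)) | P x} = #{X ∈ s | P X} := by
  refine card_bij (fun x _ => (x : PG3 K)) ?_ (fun x _ y _ h => Subtype.ext h) ?_
  · intro x hx
    exact mem_filter.2 ⟨mem_coe.1 x.2, (mem_filter.1 hx).2⟩
  · intro X hX
    exact ⟨⟨X, mem_coe.2 (mem_filter.1 hX).1⟩, mem_filter.2 ⟨mem_univ _, (mem_filter.1 hX).2⟩, rfl⟩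

/-- Three points of a cap span a plane. -/
theorem IsCap.exists_plane (hs : IsCap s) {X Y Z : PG3 K} (hX : X ∈ s) (hY : Y ∈ s) (hZ : Z ∈ s)
    (hXY : X ≠ Y) (hXZ : X ≠ Z) (hYZ : Y ≠ Z) :
    IsPlane (span₂ X Y ⊔ span₂ X Z) ∧ Z ∉ pointsOf (span₂ X Y) := by
  have hZ' := noThreeCollinear_iff.1 (isCap_iff.1 hs) X (mem_coe.2 hX) Y (mem_coe.2 hY) Z
    (mem_coe.2 hZ) hXY hXZ hYZ
  exact ⟨isPlane_sup (isLine_span₂ hXY) (isLine_span₂ hXZ)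
    (fun h => hZ' (h ▸ right_mem_span₂ X Z)) (left_mem_span₂ X Y) (left_mem_span₂ X Z), hZ'⟩

theorem isCirclePlane_ovoid (hs : IsCap s) (hq2 : 2 < Nat.card K)
    (hcard : #s = Nat.card K ^ 2 + 1) [Fintype (s : Set (PG3 K))] [Fintype (OvalPlanes s)] :
    IsCirclePlane (Nat.card K) 0
      (fun (p : OvalPlanes s) (x : (s : Set (PG3 K))) => (x : PG3 K) ∈ pointsOf p.1) Eq := by
  have hα : Fintype.card (s : Set (PG3 K)) = Nat.card K ^ 2 + 1 := by
    rw [← hcard]; simp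
  refine ⟨hq2, by omega, fun _ => rfl, Eq.symm, ?_, fun _ _ h => h, ?_, ?_, ?_, ?_, ?_⟩
  · intro p
    rw [card_filter_coe (fun X => X ∈ pointsOf p.1)]
    exact p.2.2
  · intro x y z hxy hxz hyz
    obtain ⟨h1, -⟩ := hs.exists_plane (mem_coe.1 x.2) (mem_coe.1 y.2) (mem_coe.1 z.2)
      (fun h => hxy (Subtype.ext h)) (fun h => hxz (Subtype.ext h)) (fun h => hyz (Subtype.ext h))
    have hx := pointsOf_mono (le_sup_left : span₂ x.1 y.1 ≤ span₂ x.1 y.1 ⊔ span₂ x.1 z.1)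
      (left_mem_span₂ x.1 y.1)
    have hy := pointsOf_mono (le_sup_left : span₂ x.1 y.1 ≤ span₂ x.1 y.1 ⊔ span₂ x.1 z.1)
      (right_mem_span₂ x.1 y.1)
    refine ⟨⟨_, h1, hs.cnt_plane_eq hq2 hcard h1 ?_⟩, hx, hy, ?_⟩
    · exact one_lt_cnt_iff.2 ⟨x, mem_coe.1 x.2, y, mem_coe.1 y.2, hx, hy,
        fun h => hxy (Subtype.ext h)⟩
    · exact pointsOf_mono le_sup_right (right_mem_span₂ x.1 z.1)
  · intro c d x y z hxy hxz hyz hcx hcy hcz hdx hdy hdz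
    obtain ⟨h1, -⟩ := hs.exists_plane (mem_coe.1 x.2) (mem_coe.1 y.2) (mem_coe.1 z.2)
      (fun h => hxy (Subtype.ext h)) (fun h => hxz (Subtype.ext h)) (fun h => hyz (Subtype.ext h))
    refine Subtype.ext ?_
    rw [← Submodule.eq_of_le_of_finrank_eq (sup_le (span₂_le hcx hcy) (span₂_le hcx hcz))
      (h1.trans c.2.1.symm)]
    exact Submodule.eq_of_le_of_finrank_eq (sup_le (span₂_le hdx hdy) (span₂_le hdx hdz))
      (h1.trans d.2.1.symm)
  · intro c x hx
    refine (congrArg Finset.card (?_ : _ = ∅)).trans card_empty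
    ext y
    simp only [mem_filter, mem_univ, true_and, notMem_empty, iff_false, not_and]
    rintro hy rfl
    exact hx hy
  · intro x
    have h1 : ({y | ¬ x = y} : Finset (s : Set (PG3 K))) = univ.erase x := by
      ext y; simp [eq_comm]
    refine (congrArg Finset.card (?_ : _ = univ.erase x)).trans ?_
    · convert h1
    · rw [card_erase_of_mem (mem_univ x), card_univ, hα, Nat.add_sub_cancel]
  · intro x y hxy
    refine (congrArg Finset.card (?_ : _ = (univ.erase x).erase y)).trans ?_
    · ext z
      simp only [mem_filter, mem_univ, true_and, mem_erase, and_true]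
      rw [eq_comm, and_comm, eq_comm (a := y)]
    · rw [card_erase_of_mem (mem_erase.2 ⟨fun h => hxy h.symm, mem_univ y⟩),
        card_erase_of_mem (mem_univ x), card_univ, hα]
      obtain ⟨k, hk⟩ : ∃ k, Nat.card K = k + 1 := ⟨Nat.card K - 1, by omega⟩
      rw [hk, Nat.add_sub_cancel, Nat.sub_zero, Nat.add_sub_cancel]
      exact Nat.sub_eq_of_eq_add (by ring)

end Ovoid

end CircleGeometry

namespace CircleGeometry

/-! ### Tangent planes and Segre's lemma of tangents. -/

section Tangents

open Finset Module
open scoped Classical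

variable {K : Type u} [Field K] [Finite K] {s : Finset (PG3 K)}

/-- `f` is an equation of the tangent plane of `s` in `X`. -/
structure IsTangentForm (s : Finset (PG3 K)) (X : PG3 K) (f : Dual K (Fin 4 → K)) : Prop where
  apply_self : f X.rep = 0
  apply_ne : ∀ Y ∈ s, Y ≠ X → f Y.rep ≠ 0
  tangent : ∀ l : Flat K, IsLine l → X ∈ pointsOf l → cnt s l = 1 → l ≤ LinearMap.ker f

omit [Finite K] in
theorem IsTangentForm.smul {X : PG3 K} {f : Dual K (Fin 4 → K)} (h : IsTangentForm s X f) {a : K}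
    (ha : a ≠ 0) : IsTangentForm s X (a • f) where
  apply_self := by rw [LinearMap.smul_apply, h.apply_self, smul_zero]
  apply_ne Y hY hYX := by
    rw [LinearMap.smul_apply]
    exact smul_ne_zero ha (h.apply_ne Y hY hYX)
  tangent l hl hX hl1 := by
    rw [LinearMap.ker_smul _ _ ha]
    exact h.tangent l hl hX hl1

/-- An ovoid has a tangent plane in each of its points. -/
theorem IsCap.exists_isTangentForm (hs : IsCap s) (hq2 : 2 < Nat.card K)
    (hcard : #s = Nat.card K ^ 2 + 1) {X : PG3 K} (hX : X ∈ s) : ∃ f, IsTangentForm s X f := by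
  have h1 : 0 < Nat.card K ^ 2 := by positivity
  obtain ⟨Y, hY, hYX⟩ := exists_mem_ne (by omega : 1 < #s) X
  have hL := isLine_span₂ hYX.symm
  have hXL := left_mem_span₂ X Y
  have hYL := right_mem_span₂ X Y
  have hc : ∀ p : Flat K, IsPlane p → span₂ X Y ≤ p → cnt s p = Nat.card K + 1 := fun p hp hLp =>
    hs.cnt_plane_eq hq2 hcard hp (one_lt_cnt_iff.2 ⟨X, hX, Y, hY, pointsOf_mono hLp hXL,
      pointsOf_mono hLp hYL, hYX.symm⟩)
  obtain ⟨p, hp, p', hp', hpp⟩ := one_lt_card.1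
    (by rw [card_axis hL]; omega : 1 < #(mid (span₂ X Y) ⊤))
  obtain ⟨hLp, hp⟩ := (mem_axis hL).1 hp
  obtain ⟨hLp', hp'⟩ := (mem_axis hL).1 hp'
  obtain ⟨t, ht, ht1⟩ := hs.exists_tangent hp (hc p hp hLp).le hX (pointsOf_mono hLp hXL)
  obtain ⟨t', ht', ht1'⟩ := hs.exists_tangent hp' (hc p' hp' hLp').le hX (pointsOf_mono hLp' hXL)
  obtain ⟨hXt, htp, htl⟩ := mem_pencil.1 ht
  obtain ⟨hXt', htp', htl'⟩ := mem_pencil.1 ht'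
  have htt : t ≠ t' := by
    rintro rfl
    have h2 := isLine_inf hp hp' hpp
    have h3 : t = span₂ X Y := by
      rw [Submodule.eq_of_le_of_finrank_eq (le_inf htp htp') (by rw [htl, h2]),
        Submodule.eq_of_le_of_finrank_eq (le_inf hLp hLp') (by rw [hL, h2])]
    rw [h3, cnt_span₂ hs hX hY hYX.symm] at ht1
    omega
  have hT := isPlane_sup htl htl' htt hXt hXt'
  have hXT : X ∈ pointsOf (t ⊔ t') := pointsOf_mono le_sup_left hXt
  have hT1 : cnt s (t ⊔ t') ≤ 1 := by
    by_contra! h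
    have h2 := hs.cnt_plane_le_of_two_tangents hT hX (mem_pencil.2 ⟨hXt, le_sup_left, htl⟩)
      (mem_pencil.2 ⟨hXt', le_sup_right, htl'⟩) htt ht1 ht1'
    have h3 := hs.cnt_plane_eq hq2 hcard hT h
    omega
  obtain ⟨f, -, hf⟩ := exists_isPlane_ker hT
  refine ⟨f, LinearMap.mem_ker.1 (hf ▸ mem_pointsOf.1 hXT), fun Z hZ hZX hfZ => hZX ?_, ?_⟩
  · exact eq_of_cnt_le_one hT1 hZ hX (mem_pointsOf.2 (hf ▸ LinearMap.mem_ker.2 hfZ)) hXT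
  · intro l hl hXl hl1
    have hne : span₂ X Y ≠ l := by
      rintro rfl
      rw [cnt_span₂ hs hX hY hYX.symm] at hl1
      omega
    -- In the oval plane of the secant and `l`, the intersection with the tangent plane is a tangent
    -- in `X`; by uniqueness it is `l`.
    have hM := isPlane_sup hL hl hne hXL hXl
    have hMc := hc _ hM le_sup_left
    have hMT : span₂ X Y ⊔ l ≠ t ⊔ t' := by
      intro h
      rw [h] at hMc
      omega
    have h2 := isLine_inf hM hT hMT
    have hX2 := mem_pointsOf_inf (pointsOf_mono (le_sup_right : l ≤ span₂ X Y ⊔ l) hXl) hXT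
    rw [hf, hs.tangent_unique hM hMc hX (mem_pencil.2 ⟨hXl, le_sup_right, hl⟩)
      (mem_pencil.2 ⟨hX2, inf_le_left, h2⟩) hl1
      (le_antisymm ((cnt_mono s inf_le_right).trans hT1) (cnt_pos_iff.2 ⟨X, hX, hX2⟩))]
    exact inf_le_right

omit [Finite K] in
theorem mem_plane_iff {X Y Z : PG3 K} {v : Fin 4 → K} : v ∈ span₂ X Y ⊔ span₂ X Z ↔
    ∃ a b c : K, v = a • X.rep + b • Y.rep + c • Z.rep := by
  constructor
  · intro h
    obtain ⟨u, hu, w, hw, rfl⟩ := Submodule.mem_sup.1 h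
    obtain ⟨a, b, rfl⟩ := mem_span₂.1 hu
    obtain ⟨a', c, rfl⟩ := mem_span₂.1 hw
    exact ⟨a + a', b, c, by module⟩
  · rintro ⟨a, b, c, rfl⟩
    exact Submodule.add_mem_sup (mem_span₂.2 ⟨a, b, rfl⟩) (mem_span₂.2 ⟨0, c, by simp⟩)

theorem IsCap.notMem_span₂ (hs : IsCap s) {X Y Z : PG3 K} (hX : X ∈ s) (hY : Y ∈ s) (hZ : Z ∈ s)
    (hXY : X ≠ Y) (hXZ : X ≠ Z) (hYZ : Y ≠ Z) : Z ∉ pointsOf (span₂ X Y) :=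
  (hs.exists_plane hX hY hZ hXY hXZ hYZ).2

omit [Finite K] in
-- Wilson's theorem for finite fields, with one factor split off.
theorem prod_erase_zero [Fintype K] {t : K} (ht : t ≠ 0) :
    t * ∏ a ∈ (univ.erase (0 : K)).erase t, a = -1 := by
  rw [mul_prod_erase (univ.erase (0 : K)) (fun a => a) (mem_erase.2 ⟨ht, mem_univ t⟩)]
  have h1 := congrArg (Units.val (α := K)) (FiniteField.prod_univ_units_id_eq_neg_one (K := K))
  rw [Units.coe_prod, Units.val_neg, Units.val_one] at h1
  rw [← h1]
  symm
  refine prod_bij (fun a _ => (a : K)) (fun a _ => mem_erase.2 ⟨a.ne_zero, mem_univ _⟩)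
    (fun a _ b _ h => Units.ext h) (fun a ha => ⟨Units.mk0 a (mem_erase.1 ha).1, mem_univ _, rfl⟩)
    (fun a _ => rfl)

/-- The ratios of the coordinates of the remaining points of an oval with respect to three of its
points. -/
theorem IsCap.prod_ratio (hs : IsCap s) {X Y Z : PG3 K} (hX : X ∈ s) (hY : Y ∈ s) (hZ : Z ∈ s)
    (hXY : X ≠ Y) (hXZ : X ≠ Z) {S : Finset (PG3 K)} (hS : S ⊆ s)
    (hXS : X ∉ S) (hYS : Y ∉ S) (hZS : Z ∉ S) (hcard : #S + 2 = Nat.card K) {a b c : PG3 K → K}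
    (habc : ∀ W ∈ S, W.rep = a W • X.rep + b W • Y.rep + c W • Z.rep) {f : Dual K (Fin 4 → K)}
    (hf : IsTangentForm s X f) : (∏ W ∈ S, b W / c W) * f Z.rep = f Y.rep := by
  have := Fintype.ofFinite K
  have hne : ∀ W ∈ S, W ≠ X ∧ W ≠ Y ∧ W ≠ Z := fun W hW =>
    ⟨fun h => hXS (h ▸ hW), fun h => hYS (h ▸ hW), fun h => hZS (h ▸ hW)⟩
  have hb : ∀ W ∈ S, b W ≠ 0 := by
    intro W hW h
    obtain ⟨h1, h2, h3⟩ := hne W hW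
    refine hs.notMem_span₂ hX hZ (hS hW) hXZ h1.symm h3.symm (mem_pointsOf.2 (mem_span₂.2 ?_))
    exact ⟨a W, c W, by rw [habc W hW, h]; module⟩
  have hc : ∀ W ∈ S, c W ≠ 0 := by
    intro W hW h
    obtain ⟨h1, h2, h3⟩ := hne W hW
    refine hs.notMem_span₂ hX hY (hS hW) hXY h1.symm h2.symm (mem_pointsOf.2 (mem_span₂.2 ?_))
    exact ⟨a W, b W, by rw [habc W hW, h]; module⟩
  have hfY := hf.apply_ne Y hY hXY.symm
  have hfZ := hf.apply_ne Z hZ hXZ.symm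
  -- The ratios are distinct, nonzero, and avoid this value, since `f` is nonzero off `X`. There are
  -- q - 2 of them, so they exhaust the remaining elements of the field.
  set t : K := -(f Z.rep / f Y.rep) with ht
  have ht0 : t ≠ 0 := neg_ne_zero.2 (div_ne_zero hfZ hfY)
  have hinj : Set.InjOn (fun W => b W / c W) (S : Set (PG3 K)) := by
    intro W hW W' hW' h
    rw [mem_coe] at hW hW'
    by_contra hWW
    refine hs.notMem_span₂ hX (hS hW) (hS hW') (hne W hW).1.symm (hne W' hW').1.symm hWW
      (mem_pointsOf.2 (mem_span₂.2 ⟨a W' - c W' / c W * a W, c W' / c W, ?_⟩))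
    have h1 : c W' / c W * b W = b W' := by
      have h2 : b W / c W = b W' / c W' := h
      have h3 := hc W hW
      have h4 := hc W' hW'
      field_simp at h2 ⊢
      linear_combination h2
    have h2 : c W' / c W * c W = c W' := div_mul_cancel₀ _ (hc W hW)
    rw [habc W hW, habc W' hW', smul_add, smul_add, smul_smul, smul_smul, smul_smul, h1, h2]
    module
  have himg : S.image (fun W => b W / c W) = (univ.erase (0 : K)).erase t := by
    refine eq_of_subset_of_card_le ?_ ?_
    · intro r hr
      obtain ⟨W, hW, rfl⟩ := mem_image.1 hr
      refine mem_erase.2 ⟨fun h => ?_, mem_erase.2 ⟨div_ne_zero (hb W hW) (hc W hW), mem_univ _⟩⟩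
      refine hf.apply_ne W (hS hW) (hne W hW).1 ?_
      have h3 := hc W hW
      rw [habc W hW, map_add, map_add, map_smul, map_smul, map_smul, hf.apply_self, smul_eq_mul,
        smul_eq_mul, smul_eq_mul]
      rw [ht] at h
      field_simp at h
      linear_combination h
    · rw [card_image_of_injOn hinj, card_erase_of_mem (mem_erase.2 ⟨ht0, mem_univ _⟩),
        card_erase_of_mem (mem_univ _), card_univ, ← Nat.card_eq_fintype_card]
      omega
  have h1 := prod_erase_zero ht0
  rw [← himg, prod_image hinj, ht] at h1
  field_simp at h1
  linear_combination -h1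

/-- Segre's lemma of tangents. -/
theorem IsCap.lemma_of_tangents (hs : IsCap s) (hq2 : 2 < Nat.card K)
    (hcard : #s = Nat.card K ^ 2 + 1) {X Y Z : PG3 K} (hX : X ∈ s) (hY : Y ∈ s) (hZ : Z ∈ s)
    (hXY : X ≠ Y) (hXZ : X ≠ Z) (hYZ : Y ≠ Z) {f g h : Dual K (Fin 4 → K)}
    (hf : IsTangentForm s X f) (hg : IsTangentForm s Y g) (hh : IsTangentForm s Z h) :
    f Y.rep * g Z.rep * h X.rep = f Z.rep * g X.rep * h Y.rep := by
  obtain ⟨hp, -⟩ := hs.exists_plane hX hY hZ hXY hXZ hYZ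
  set p := span₂ X Y ⊔ span₂ X Z with hpdef
  have hXp : X ∈ pointsOf p := pointsOf_mono le_sup_left (left_mem_span₂ X Y)
  have hYp : Y ∈ pointsOf p := pointsOf_mono le_sup_left (right_mem_span₂ X Y)
  have hZp : Z ∈ pointsOf p := pointsOf_mono le_sup_right (right_mem_span₂ X Z)
  have hc := hs.cnt_plane_eq hq2 hcard hp (one_lt_cnt_iff.2 ⟨X, hX, Y, hY, hXp, hYp, hXY⟩)
  set S : Finset (PG3 K) := ((({W ∈ s | W ∈ pointsOf p} : Finset (PG3 K)).erase X).erase Y).erase Z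
    with hSdef
  have hS : ∀ W ∈ S, W ∈ s ∧ W ∈ pointsOf p := fun W hW =>
    mem_filter.1 (mem_of_mem_erase (mem_of_mem_erase (mem_of_mem_erase hW)))
  have hScard : #S + 2 = Nat.card K := by
    rw [cnt] at hc
    rw [hSdef, card_erase_of_mem (by simp [hZ, hZp, hXZ.symm, hYZ.symm]),
      card_erase_of_mem (by simp [hY, hYp, hXY.symm]), card_erase_of_mem (by simp [hX, hXp]), hc]
    omega
  have hXS : X ∉ S := by simp [hSdef]
  have hYS : Y ∉ S := by simp [hSdef]
  have hZS : Z ∉ S := by simp [hSdef]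
  have habc : ∀ W ∈ S, ∃ a b c : K, W.rep = a • X.rep + b • Y.rep + c • Z.rep := fun W hW =>
    mem_plane_iff.1 (mem_pointsOf.1 (hS W hW).2)
  choose! a b c habc using habc
  have hsub : S ⊆ s := fun W hW => (hS W hW).1
  have h1 := hs.prod_ratio hX hY hZ hXY hXZ hsub hXS hYS hZS hScard habc hf
  have h2 := hs.prod_ratio hY hZ hX hYZ hXY.symm hsub hYS hZS hXS hScard (a := b) (b := c) (c := a)
    (fun W hW => by rw [habc W hW]; abel) hg
  have h3 := hs.prod_ratio hZ hX hY hXZ.symm hYZ.symm hsub hZS hXS hYS hScard (a := c) (b := a)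
    (c := b) (fun W hW => by rw [habc W hW]; abel) hh
  have h0 : (∏ W ∈ S, b W / c W) ≠ 0 := fun h0 => by
    rw [h0, zero_mul] at h1
    exact hf.apply_ne Y hY hXY.symm h1.symm
  have h0' : (∏ W ∈ S, c W / a W) ≠ 0 := fun h0 => by
    rw [h0, zero_mul] at h2
    exact hg.apply_ne Z hZ hYZ.symm h2.symm
  have h0'' : (∏ W ∈ S, a W / b W) ≠ 0 := fun h0 => by
    rw [h0, zero_mul] at h3
    exact hh.apply_ne X hX hXZ h3.symm
  -- The three ratios of coordinates cancel cyclically at every point, which relates the three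
  -- tangent planes.
  have h4 : (∏ W ∈ S, b W / c W) * (∏ W ∈ S, c W / a W) * (∏ W ∈ S, a W / b W) = 1 := by
    rw [← prod_mul_distrib, ← prod_mul_distrib]
    refine prod_eq_one fun W hW => ?_
    have hb := div_ne_zero_iff.1 (prod_ne_zero_iff.1 h0 W hW)
    have ha := div_ne_zero_iff.1 (prod_ne_zero_iff.1 h0' W hW)
    obtain ⟨hb, hc⟩ := hb
    obtain ⟨-, ha⟩ := ha
    field_simp
  rw [← h1, ← h2, ← h3]
  linear_combination (f Z.rep * g X.rep * h Y.rep) * h4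

/-- The tangent planes can be normalized so that they become symmetric. -/
theorem IsCap.exists_symm_tangentForm (hs : IsCap s) (hq2 : 2 < Nat.card K)
    (hcard : #s = Nat.card K ^ 2 + 1) : ∃ f : PG3 K → Dual K (Fin 4 → K),
      (∀ X ∈ s, IsTangentForm s X (f X)) ∧ ∀ X ∈ s, ∀ Y ∈ s, f X Y.rep = f Y X.rep := by
  choose! f hf using fun X (hX : X ∈ s) => hs.exists_isTangentForm hq2 hcard hX
  obtain ⟨E, hE⟩ : s.Nonempty := by
    rw [← card_pos, hcard]
    omega
  -- The scaling makes each form symmetric with that of the reference point `E`; the lemma of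
  -- tangents for `E`, `X`, `Y` then gives symmetry in general.
  set k : PG3 K → K := fun X => if X = E then 1 else f E X.rep / f X E.rep with hk
  have hkE : k E = 1 := if_pos rfl
  have hk' : ∀ X, X ≠ E → k X = f E X.rep / f X E.rep := fun X hX => if_neg hX
  have hk0 : ∀ X ∈ s, k X ≠ 0 := by
    intro X hX
    by_cases h : X = E
    · rw [h, hkE]; exact one_ne_zero
    · rw [hk' X h]
      exact div_ne_zero ((hf E hE).apply_ne X hX h) ((hf X hX).apply_ne E hE (Ne.symm h))
  have hg : ∀ X ∈ s, IsTangentForm s X (k X • f X) := fun X hX => (hf X hX).smul (hk0 X hX)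
  have hgE : ∀ X ∈ s, (k X • f X) E.rep = (k E • f E) X.rep := by
    intro X hX
    by_cases h : X = E
    · rw [h]
    · rw [hkE, one_smul, hk' X h, LinearMap.smul_apply, smul_eq_mul,
        div_mul_cancel₀ _ ((hf X hX).apply_ne E hE (Ne.symm h))]
  refine ⟨fun X => k X • f X, hg, fun X hX Y hY => ?_⟩
  by_cases hXE : X = E
  · rw [hXE]; exact (hgE Y hY).symm
  by_cases hYE : Y = E
  · rw [hYE]; exact hgE X hX
  by_cases hXY : X = Y
  · rw [hXY]
  have h1 := hs.lemma_of_tangents hq2 hcard hE hX hY (Ne.symm hXE) (Ne.symm hYE) hXY (hg E hE)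
    (hg X hX) (hg Y hY)
  rw [hgE X hX, hgE Y hY] at h1
  have h2 := (hg E hE).apply_ne X hX hXE
  have h3 := (hg E hE).apply_ne Y hY hYE
  refine mul_left_cancel₀ (mul_ne_zero h2 h3) ?_
  linear_combination h1

end Tangents

end CircleGeometry

namespace CircleGeometry

/-! ### The polarity of an ovoid and the two types of its oval planes. -/

section Polarity

open Finset Module
open scoped Classical

variable {K : Type u} [Field K] [Finite K] {s : Finset (PG3 K)}

/-- Otherwise one plane contains all q² + 1 points, more than an oval section has. -/
theorem IsCap.span_eq_top (hs : IsCap s) (hq2 : 2 < Nat.card K)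
    (hcard : #s = Nat.card K ^ 2 + 1) :
    Submodule.span K (Projectivization.rep '' (s : Set (PG3 K))) = ⊤ := by
  by_contra h
  obtain ⟨f, hf, hle⟩ := Submodule.exists_le_ker_of_lt_top _ (lt_top_iff_ne_top.2 h)
  have h1 : cnt s (LinearMap.ker f) = #s := by
    rw [cnt, filter_true_of_mem]
    exact fun X hX => mem_pointsOf.2 (hle (Submodule.subset_span ⟨X, mem_coe.2 hX, rfl⟩))
  have h2 := hs.cnt_plane_eq hq2 hcard (isPlane_ker hf) (by rw [h1, hcard]; nlinarith)
  rw [h1, hcard] at h2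
  nlinarith

theorem IsCap.exists_basis (hs : IsCap s) (hq2 : 2 < Nat.card K)
    (hcard : #s = Nat.card K ^ 2 + 1) : ∃ (ι : Type u) (_ : Finite ι)
      (b : Basis ι K (Fin 4 → K)) (X : ι → PG3 K), ∀ i, X i ∈ s ∧ b i = (X i).rep := by
  have h := (hs.span_eq_top hq2 hcard).ge
  have h1 : ∀ i, ∃ X ∈ s, X.rep = Basis.ofSpan h i := fun i =>
    Basis.ofSpan_subset h ⟨i, rfl⟩
  choose X hX using h1
  exact ⟨_, Module.Finite.finite_basis (Basis.ofSpan h), Basis.ofSpan h, X,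
    fun i => ⟨(hX i).1, (hX i).2.symm⟩⟩

/-- The polarity of an ovoid of odd order. -/
theorem IsCap.exists_polarity (hs : IsCap s) (hq2 : 2 < Nat.card K)
    (hcard : #s = Nat.card K ^ 2 + 1) : ∃ B : (Fin 4 → K) →ₗ[K] Dual K (Fin 4 → K),
      (∀ X ∈ s, IsTangentForm s X (B X.rep)) ∧ ∀ u v, B u v = B v u := by
  obtain ⟨f, hf, hsymm⟩ := hs.exists_symm_tangentForm hq2 hcard
  obtain ⟨ι, _, b, X, hX⟩ := hs.exists_basis hq2 hcard
  -- The form is prescribed on a basis consisting of points of the ovoid; symmetry forces it to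
  -- agree with the tangent forms at all other points.
  set B := b.constr K fun i => f (X i) with hB
  have hBb : ∀ i, B (b i) = f (X i) := fun i => b.constr_basis K _ i
  have hBs : ∀ Y ∈ s, B Y.rep = f Y := by
    intro Y hY
    refine b.ext fun j => ?_
    have h2 : B.flip (b j) = f (X j) := by
      refine b.ext fun i => ?_
      rw [LinearMap.flip_apply, hBb, (hX i).2, (hX j).2]
      exact hsymm _ (hX i).1 _ (hX j).1
    rw [← LinearMap.flip_apply, h2, (hX j).2]
    exact hsymm _ (hX j).1 _ hY
  have hflip : B.flip = B := by
    refine b.ext fun j => b.ext fun i => ?_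
    rw [LinearMap.flip_apply, hBb, hBb, (hX i).2, (hX j).2]
    exact hsymm _ (hX i).1 _ (hX j).1
  refine ⟨B, fun Y hY => (hBs Y hY).symm ▸ hf Y hY, fun u v => ?_⟩
  conv_lhs => rw [← hflip, LinearMap.flip_apply]

/-- The point lies in a plane with two points of the ovoid; this plane is oval, so it has a third,
and the three span it. -/
theorem IsCap.exists_coordinates (hs : IsCap s) (hq2 : 2 < Nat.card K)
    (hcard : #s = Nat.card K ^ 2 + 1) (V : PG3 K) : ∃ X ∈ s, ∃ Y ∈ s, ∃ Z ∈ s,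
      X ≠ Y ∧ X ≠ Z ∧ Y ≠ Z ∧ ∃ a b c : K, V.rep = a • X.rep + b • Y.rep + c • Z.rep := by
  obtain ⟨X, hX, hXV⟩ := exists_mem_ne (by rw [hcard]; nlinarith : 1 < #s) V
  have hL := isLine_span₂ hXV
  obtain ⟨Y, hY, hYL⟩ : ∃ Y ∈ s, Y ∉ pointsOf (span₂ X V) := by
    by_contra! h
    have h1 := hs _ hL
    rw [cnt, filter_true_of_mem h, hcard] at h1
    nlinarith
  have hXY : X ≠ Y := fun h => hYL (h ▸ left_mem_span₂ X V)
  have hM := isPlane_sup hL (isLine_span₂ hXY) (fun h => hYL (h ▸ right_mem_span₂ X Y))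
    (left_mem_span₂ X V) (left_mem_span₂ X Y)
  set M := span₂ X V ⊔ span₂ X Y
  have hXM : X ∈ pointsOf M := pointsOf_mono le_sup_left (left_mem_span₂ X V)
  have hVM : V ∈ pointsOf M := pointsOf_mono le_sup_left (right_mem_span₂ X V)
  have hYM : Y ∈ pointsOf M := pointsOf_mono le_sup_right (right_mem_span₂ X Y)
  have hc := hs.cnt_plane_eq hq2 hcard hM (one_lt_cnt_iff.2 ⟨X, hX, Y, hY, hXM, hYM, hXY⟩)
  obtain ⟨Z, hZ⟩ : ((({W ∈ s | W ∈ pointsOf M} : Finset (PG3 K)).erase X).erase Y).Nonempty := by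
    rw [cnt] at hc
    rw [← card_pos, card_erase_of_mem (by simp [hY, hYM, hXY.symm]),
      card_erase_of_mem (by simp [hX, hXM]), hc]
    omega
  simp only [mem_erase, mem_filter] at hZ
  obtain ⟨hZY, hZX, hZ, hZM⟩ := hZ
  refine ⟨X, hX, Y, hY, Z, hZ, hXY, Ne.symm hZX, Ne.symm hZY, mem_plane_iff.1 ?_⟩
  rw [Submodule.eq_of_le_of_finrank_eq (sup_le (span₂_le hXM hYM) (span₂_le hXM hZM))
    ((hs.exists_plane hX hY hZ hXY (Ne.symm hZX) (Ne.symm hZY)).1.trans hM.symm)]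
  exact mem_pointsOf.1 hVM

omit [Finite K] in
-- The symmetric matrix of order three with zero diagonal and entries p, r, t has determinant 2prt.
theorem eq_zero_of_gram {p r t a b c : K} (h2 : (2 : K) ≠ 0) (hp : p ≠ 0) (hr : r ≠ 0) (ht : t ≠ 0)
    (h₁ : b * p + c * r = 0) (h₂ : a * p + c * t = 0) (h₃ : a * r + b * t = 0) :
    a = 0 ∧ b = 0 ∧ c = 0 := by
  have hc : c = 0 := by
    have : 2 * r * t * c = 0 := by linear_combination t * h₁ + r * h₂ - p * h₃
    exact (mul_eq_zero.1 this).resolve_left (mul_ne_zero (mul_ne_zero h2 hr) ht)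
  rw [hc, zero_mul, add_zero] at h₁ h₂
  exact ⟨(mul_eq_zero.1 h₂).resolve_right hp, (mul_eq_zero.1 h₁).resolve_right hp, hc⟩

/-- A vector of the radical is a combination of three points of the ovoid, whose Gram matrix has
zero diagonal, nonzero entries elsewhere, and so is regular in odd characteristic. -/
theorem IsCap.polarity_injective (hs : IsCap s) (hq2 : 2 < Nat.card K)
    (hcard : #s = Nat.card K ^ 2 + 1) (h2 : (2 : K) ≠ 0)
    {B : (Fin 4 → K) →ₗ[K] Dual K (Fin 4 → K)} (hB : ∀ X ∈ s, IsTangentForm s X (B X.rep))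
    (hsymm : ∀ u v, B u v = B v u) : Function.Injective B := by
  rw [injective_iff_map_eq_zero]
  intro v hv
  by_contra hv0
  obtain ⟨X, hX, Y, hY, Z, hZ, hXY, hXZ, hYZ, a, b, c, habc⟩ :=
    hs.exists_coordinates hq2 hcard (Projectivization.mk K v hv0)
  obtain ⟨k, hk⟩ := Projectivization.exists_smul_eq_mk_rep K v hv0
  have hBV : ∀ w, B (Projectivization.mk K v hv0).rep w = 0 := fun w => by
    rw [← hk, Units.smul_def, map_smul, hv, smul_zero, LinearMap.zero_apply]
  have hexp : ∀ w, a * B X.rep w + b * B Y.rep w + c * B Z.rep w = 0 := fun w => by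
    rw [← hBV w, habc]
    simp
  have h1 := hexp X.rep
  have h2' := hexp Y.rep
  have h3 := hexp Z.rep
  rw [(hB X hX).apply_self, hsymm Y.rep, hsymm Z.rep] at h1
  rw [(hB Y hY).apply_self, hsymm Z.rep] at h2'
  rw [(hB Z hZ).apply_self] at h3
  obtain ⟨rfl, rfl, rfl⟩ := eq_zero_of_gram (a := a) (b := b) (c := c) h2
    ((hB X hX).apply_ne Y hY hXY.symm)
    ((hB X hX).apply_ne Z hZ hXZ.symm) ((hB Y hY).apply_ne Z hZ hYZ.symm)
    (by linear_combination h1) (by linear_combination h2') (by linear_combination h3)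
  refine (Projectivization.mk K v hv0).rep_nonzero ?_
  rw [habc]
  simp

omit [Finite K] in
theorem exists_eq_add_of_ker_inf_le {f g h : Dual K (Fin 4 → K)}
    (hle : LinearMap.ker f ⊓ LinearMap.ker g ≤ LinearMap.ker h) : ∃ a b : K, h = a • f + b • g := by
  have h1 := mem_span_of_iInf_ker_le_ker (L := ![f, g]) (K := h) 
    (le_trans (le_inf (iInf_le _ 0) (iInf_le _ 1)) hle)
  rw [Matrix.range_cons, Matrix.range_cons, Matrix.range_empty, Set.union_empty,
      Set.singleton_union, Submodule.mem_span_pair] at h1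
  obtain ⟨a, b, hab⟩ := h1
  exact ⟨a, b, hab.symm⟩

omit [Finite K] in
theorem isSquare_iff_of_mul_sq {a b k : K} (hk : k ≠ 0) (h : a = k ^ 2 * b) :
    IsSquare a ↔ IsSquare b := by
  constructor
  · rintro ⟨r, hr⟩
    refine ⟨r / k, ?_⟩
    field_simp
    linear_combination hr - h
  · rintro ⟨r, hr⟩
    exact ⟨k * r, by rw [h, hr]; ring⟩

omit [Finite K] in
/-- Two oval planes of an ovoid that meet in a tangent line. -/
theorem IsCap.exists_sq_of_tangent {B : (Fin 4 → K) →ₗ[K] Dual K (Fin 4 → K)}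
    (hinj : Function.Injective B) (hB : ∀ X ∈ s, IsTangentForm s X (B X.rep))
    (hsymm : ∀ u v, B u v = B v u) {u v : Fin 4 → K} (hu : IsPlane (LinearMap.ker (B u)))
    (hv : IsPlane (LinearMap.ker (B v))) (hu1 : 1 < cnt s (LinearMap.ker (B u)))
    (hv1 : 1 < cnt s (LinearMap.ker (B v)))
    (huv : cnt s (LinearMap.ker (B u) ⊓ LinearMap.ker (B v)) = 1) :
    ∃ k : K, k ≠ 0 ∧ B u u = k ^ 2 * B v v := by
  obtain ⟨Y, hY, hYuv⟩ := cnt_pos_iff.1 (by rw [huv]; exact one_pos :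
    0 < cnt s (LinearMap.ker (B u) ⊓ LinearMap.ker (B v)))
  have hne : LinearMap.ker (B u) ≠ LinearMap.ker (B v) := by
    intro h
    rw [h, inf_idem] at huv
    omega
  obtain ⟨a, b, hab⟩ := exists_eq_add_of_ker_inf_le
    ((hB Y hY).tangent _ (isLine_inf hu hv hne) hYuv huv)
  have hYu : B u Y.rep = 0 := (mem_pointsOf.1 hYuv).1
  have hYv : B v Y.rep = 0 := (mem_pointsOf.1 hYuv).2
  -- The tangent plane at `Y` contains the common tangent line, so `Y` is a combination of `u` and
  -- `v`. As `Y` is orthogonal to both, eliminating B(u, v) yields a² B(u, u) = b² B(v, v).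
  have hYr : Y.rep = a • u + b • v := hinj (by rw [hab, map_add, map_smul, map_smul])
  have hpt : ∀ (w : Fin 4 → K) (k : K), 1 < cnt s (LinearMap.ker (B w)) → B Y.rep ≠ k • B w := by
    intro w k hw h
    obtain ⟨Z, hZ, Z', hZ', hZw, hZw', hZZ⟩ := one_lt_cnt_iff.1 hw
    have h1 : ∀ W ∈ s, W ∈ pointsOf (LinearMap.ker (B w)) → W = Y := by
      intro W hW hWw
      by_contra hWY
      refine (hB Y hY).apply_ne W hW hWY ?_
      have h2 : B w W.rep = 0 := mem_pointsOf.1 hWw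
      rw [h, LinearMap.smul_apply, h2, smul_zero]
    exact hZZ ((h1 Z hZ hZw).trans (h1 Z' hZ' hZw').symm)
  have ha : a ≠ 0 := by
    rintro rfl
    exact hpt v b hv1 (by rw [hab, zero_smul, zero_add])
  have hb : b ≠ 0 := by
    rintro rfl
    exact hpt u a hu1 (by rw [hab, zero_smul, add_zero])
  rw [hYr, map_add, map_smul, map_smul, smul_eq_mul, smul_eq_mul] at hYu hYv
  rw [hsymm v u] at hYv
  refine ⟨b / a, div_ne_zero hb ha, ?_⟩
  field_simp
  linear_combination a * hYu - b * hYv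

/-- The planes conjugate to the points of a secant off the ovoid are oval. -/
theorem IsCap.cnt_ker_polarity (hs : IsCap s) (hq : Odd (Nat.card K))
    (hcard : #s = Nat.card K ^ 2 + 1)
    {B : (Fin 4 → K) →ₗ[K] Dual K (Fin 4 → K)} (hB : ∀ X ∈ s, IsTangentForm s X (B X.rep))
    {X Y : PG3 K} (hX : X ∈ s) (hY : Y ∈ s) (hXY : X ≠ Y) {c : K}
    (hc : c ≠ 0) : IsPlane (LinearMap.ker (B (X.rep + c • Y.rep))) ∧
      cnt s (LinearMap.ker (B (X.rep + c • Y.rep))) = Nat.card K + 1 := by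
  have := Fintype.ofFinite K
  have hK : 1 < Nat.card K := Finite.one_lt_card
  have hBX := (hB X hX).apply_ne Y hY hXY.symm
  have happ : ∀ (k : K) (w : Fin 4 → K), B (X.rep + k • Y.rep) w = B X.rep w + k * B Y.rep w := by
    intro k w
    rw [map_add, map_smul, LinearMap.add_apply, LinearMap.smul_apply, smul_eq_mul]
  have hp : ∀ k : K, IsPlane (LinearMap.ker (B (X.rep + k • Y.rep))) := by
    intro k
    refine isPlane_ker fun h => hBX ?_
    have h1 := happ k Y.rep
    rw [h, (hB Y hY).apply_self, mul_zero, add_zero] at h1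
    exact h1.symm
  refine ⟨hp c, ?_⟩
  have hle : ∀ k ∈ univ.erase (0 : K), cnt s (LinearMap.ker (B (X.rep + k • Y.rep))) ≤
      Nat.card K + 1 := fun k _ => hs.cnt_plane_le_of_odd hq (hp k)
  refine (sum_eq_sum_iff_of_le hle).1 (le_antisymm (sum_le_sum hle) ?_) c
    (mem_erase.2 ⟨hc, mem_univ c⟩)
  -- The q - 1 planes cover the other q² - 1 points and have at most q + 1 points each, so each has
  -- exactly q + 1.
  have hcover : (s.erase X).erase Y ⊆ (univ.erase (0 : K)).biUnion fun k =>
      {W ∈ s | W ∈ pointsOf (LinearMap.ker (B (X.rep + k • Y.rep)))} := by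
    intro W hW
    obtain ⟨hWY, hW⟩ := mem_erase.1 hW
    obtain ⟨hWX, hW⟩ := mem_erase.1 hW
    have h1 := (hB X hX).apply_ne W hW hWX
    have h2 := (hB Y hY).apply_ne W hW hWY
    refine mem_biUnion.2 ⟨-(B X.rep W.rep / B Y.rep W.rep), mem_erase.2
      ⟨neg_ne_zero.2 (div_ne_zero h1 h2), mem_univ _⟩, mem_filter.2 ⟨hW, mem_pointsOf.2 ?_⟩⟩
    rw [LinearMap.mem_ker, happ]
    field_simp
    ring
  have h1 := (card_le_card hcover).trans card_biUnion_le
  rw [card_erase_of_mem (mem_erase.2 ⟨hXY.symm, hY⟩), card_erase_of_mem hX, hcard] at h1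
  refine le_trans (le_of_eq ?_) h1
  rw [sum_const, card_erase_of_mem (mem_univ _), card_univ, ← Nat.card_eq_fintype_card, smul_eq_mul]
  obtain ⟨k, hk⟩ : ∃ k, Nat.card K = k + 1 := ⟨Nat.card K - 1, by omega⟩
  rw [hk, Nat.add_sub_cancel, Nat.add_sub_cancel]
  exact (Nat.sub_eq_of_eq_add (by ring)).symm

omit [Finite K] in
theorem exists_smul_of_ker_eq {f g : Dual K (Fin 4 → K)} (h : LinearMap.ker f = LinearMap.ker g) :
    ∃ a : K, f = a • g := by
  have h1 := mem_span_of_iInf_ker_le_ker (L := fun _ : Unit => g) (K := f) (by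
    rw [iInf_const, h])
  rw [Set.range_const, Submodule.mem_span_singleton] at h1
  obtain ⟨a, ha⟩ := h1
  exact ⟨a, ha.symm⟩

/-- The type of the plane conjugate to u is the square class of B(u, u), which
`exists_sq_of_tangent` shows to agree for tangent circles. Both classes occur: for w = X + cY on a
secant, B(w, w) = 2c B(X, Y) takes every nonzero value. -/
theorem exists_isTyping_ovoid (hs : IsCap s) (hq2 : 2 < Nat.card K) (hq : Odd (Nat.card K))
    (hcard : #s = Nat.card K ^ 2 + 1) [Fintype (s : Set (PG3 K))] : ∃ ty, IsTyping
      (fun (p : OvalPlanes s) (x : (s : Set (PG3 K))) => (x : PG3 K) ∈ pointsOf p.1) ty := by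
  have := Fintype.ofFinite K
  have hK2 : ringChar K ≠ 2 := by
    intro h2
    have := FiniteField.even_card_iff_char_two.1 h2
    rw [← Nat.card_eq_fintype_card] at this
    rw [Nat.odd_iff] at hq
    omega
  have h2 : (2 : K) ≠ 0 := Ring.two_ne_zero hK2
  obtain ⟨B, hB, hsymm⟩ := hs.exists_polarity hq2 hcard
  have hinj := hs.polarity_injective hq2 hcard h2 hB hsymm
  have hsurj : Function.Surjective B := by
    refine (LinearMap.injective_iff_surjective_of_finrank_eq_finrank ?_).1 hinj
    exact (Subspace.dual_finrank_eq).symm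
  have hu : ∀ p : OvalPlanes s, ∃ u, LinearMap.ker (B u) = p.1 := by
    intro p
    obtain ⟨f, -, hf⟩ := exists_isPlane_ker p.2.1
    obtain ⟨u, rfl⟩ := hsurj f
    exact ⟨u, hf⟩
  choose u hu using hu
  obtain ⟨X, hX, Y, hY, hXY⟩ := one_lt_card.1 (by rw [hcard]; nlinarith : 1 < #s)
  have hXYB := (hB X hX).apply_ne Y hY hXY.symm
  have hval : ∀ d : K, d ≠ 0 → ∃ p : OvalPlanes s, IsSquare (B (u p) (u p)) ↔ IsSquare d := by
    intro d hd
    have hc0 : d / (2 * B X.rep Y.rep) ≠ 0 := div_ne_zero hd (mul_ne_zero h2 hXYB)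
    set w := X.rep + (d / (2 * B X.rep Y.rep)) • Y.rep with hw
    have hBw : B w w = d := by
      rw [hw]
      simp only [map_add, map_smul, LinearMap.add_apply, LinearMap.smul_apply, smul_eq_mul,
        (hB X hX).apply_self, (hB Y hY).apply_self, hsymm Y.rep X.rep]
      field_simp
      ring
    have hp := IsCap.cnt_ker_polarity hs hq hcard hB hX hY hXY hc0
    obtain ⟨a, ha⟩ := exists_smul_of_ker_eq (hu ⟨_, hp⟩)
    have ha0 : a ≠ 0 := by
      rintro rfl
      have h3 : LinearMap.ker (B (u ⟨_, hp⟩)) = LinearMap.ker (B w) := hu ⟨_, hp⟩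
      have h4 : IsPlane (LinearMap.ker (B w)) := hp.1
      rw [← h3, ha, zero_smul, LinearMap.ker_zero, IsPlane, finrank_top, Module.finrank_fin_fun] at h4
      omega
    refine ⟨⟨_, hp⟩, isSquare_iff_of_mul_sq ha0 ?_⟩
    have h3 : u ⟨_, hp⟩ = a • w := hinj (by rw [ha, map_smul])
    rw [h3, map_smul, map_smul, LinearMap.smul_apply, hBw, smul_eq_mul, smul_eq_mul]
    ring
  refine ⟨fun p => IsSquare (B (u p) (u p)), ?_, ?_, ?_⟩
  · intro c d hcd
    have hc : IsPlane (LinearMap.ker (B (u c))) := (hu c).symm ▸ c.2.1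
    have hd : IsPlane (LinearMap.ker (B (u d))) := (hu d).symm ▸ d.2.1
    have hcd' : cnt s (LinearMap.ker (B (u c)) ⊓ LinearMap.ker (B (u d))) = 1 := by
      rw [← hcd, hu, hu, common, cnt]
      have h3 := card_filter_coe (s := s) fun X => X ∈ pointsOf c.1 ∧ X ∈ pointsOf d.1
      refine Eq.trans ?_ (h3.symm.trans ?_)
      · congr 1
        ext X
        simp only [mem_filter]
        refine and_congr_right fun _ => ⟨fun h => ⟨pointsOf_mono inf_le_left h,
          pointsOf_mono inf_le_right h⟩, fun h => mem_pointsOf_inf h.1 h.2⟩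
      · congr!
    obtain ⟨k, hk, h3⟩ := IsCap.exists_sq_of_tangent hinj hB hsymm hc hd
      (by rw [hu, c.2.2]; omega) (by rw [hu, d.2.2]; omega) hcd'
    exact isSquare_iff_of_mul_sq hk h3
  · obtain ⟨p, hp⟩ := hval 1 one_ne_zero
    exact ⟨p, hp.2 IsSquare.one⟩
  · obtain ⟨a, ha⟩ := FiniteField.exists_nonsquare hK2
    have ha0 : a ≠ 0 := by rintro rfl; exact ha (IsSquare.zero)
    obtain ⟨p, hp⟩ := hval a ha0
    exact ⟨p, fun h => ha (hp.1 h)⟩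

end Polarity

/-! ### The bound for ovoidal Möbius planes. -/

section Moebius

open Finset Module
open scoped Classical

variable {K : Type u} [Field K]

theorem familyBound_ovoid [Finite K] {s : Finset (PG3 K)} (hs : IsCap s) (hq2 : 2 < Nat.card K)
    (hcard : #s = Nat.card K ^ 2 + 1) [Fintype (OvalPlanes s)] : FamilyBound (Nat.card K) 0
      (fun (p : OvalPlanes s) (x : (s : Set (PG3 K))) => (x : PG3 K) ∈ pointsOf p.1) := by
  have := Fintype.ofFinite (s : Set (PG3 K))
  rcases Nat.even_or_odd (Nat.card K) with h | h
  · exact (isCirclePlane_ovoid hs hq2 hcard).familyBound_of_odd (by rw [Nat.sub_zero]; exact h.add_one)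
  · obtain ⟨ty, hty⟩ := exists_isTyping_ovoid hs hq2 h hcard
    exact (isCirclePlane_ovoid hs hq2 hcard).familyBound_of_type h (by simp) hty

theorem isOvalPlane_iff [Finite K] {s : Finset (PG3 K)} (hs : IsCap s) {p : Flat K} :
    IsOvalPlane (s : Set (PG3 K)) p ↔ IsPlane p ∧ cnt s p = Nat.card K + 1 := by
  have h1 : (pointsOf p ∩ (s : Set (PG3 K))).ncard = cnt s p := by
    rw [cnt, ← Set.ncard_coe_finset]
    congr 1
    ext X
    simp [and_comm]
  rw [IsOvalPlane, IsOvalIn, h1]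
  exact ⟨fun h => ⟨h.1, h.2.2.1⟩, fun h => ⟨h.1, Set.inter_subset_left, h.2,
    (isCap_iff.1 hs).mono Set.inter_subset_right⟩⟩

theorem bound_moebius [Finite K] (hK : 2 < Nat.card K) {Q : Set (PG3 K)}
    (hQ : IsOvoid Q) {F : Set (Set Q)} (hF : IsIntersectingFamily (sections Q Q) F)
    (P : Q) (S T : Set (Set Q)) (hS : S = {c ∈ F | P ∈ c}) (hT : T = F \ S) {q : ℕ}
    (hKq : Nat.card K = q) :
    (S.ncard : ℝ) * (T.ncard : ℝ) ≤
      ((q : ℝ) / ((q : ℝ) + ((0 : ℕ) : ℝ) - 2)) ^ 2 * lam q 0 *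
        (1 - (S.ncard : ℝ) / ((q : ℝ) * ((q : ℝ) + 1 - ((0 : ℕ) : ℝ)))) *
        (1 - (T.ncard : ℝ) / ((q : ℝ) ^ 2 * ((q : ℝ) - 1))) := by
  subst hKq
  obtain ⟨s, rfl⟩ : ∃ s : Finset (PG3 K), Q = s := ⟨(Set.toFinite Q).toFinset, by simp⟩
  have hs : IsCap s := isCap_iff.2 hQ.2
  have hcard : #s = Nat.card K ^ 2 + 1 := by rw [← hQ.1, Set.ncard_coe_finset]
  have := Fintype.ofFinite (OvalPlanes s)
  have := Fintype.ofFinite (s : Set (PG3 K))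
  refine (familyBound_ovoid hs hK hcard).transfer (sections (s : Set (PG3 K)) s)
    (Equiv.refl _) (fun p => {x : (s : Set (PG3 K)) | (x : PG3 K) ∈ pointsOf p.1}) ?_ ?_
    (fun _ _ => Iff.rfl) F hF P S T hS hT
  · exact fun p p' h => (isCirclePlane_ovoid hs hK hcard).injective fun x => Set.ext_iff.1 h x
  · ext c
    constructor
    · rintro ⟨p, hp, rfl⟩
      exact ⟨⟨p, (isOvalPlane_iff hs).1 hp⟩, rfl⟩
    · rintro ⟨p, rfl⟩
      exact ⟨p.1, (isOvalPlane_iff hs).2 p.2, rfl⟩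

end Moebius

end CircleGeometry

/-! ### The theorem, by type of geometry. -/

open CircleGeometry in
theorem proposition5p8 {K : Type u} [Field K] [Finite K] (q : ℕ) (hq : Nat.card K = q)
    (hq2 : 2 < q) (ρ : ℕ) (D : CircleGeometry.IncidenceStructure.{u})
    (hD : CircleGeometry.KnownGeometry K ρ D)
    (F : Set (Set D.Point)) (hF : CircleGeometry.IsIntersectingFamily D F) (P : D.Point)
    (S T : Set (Set D.Point)) (hS : S = {c ∈ F | P ∈ c}) (hT : T = F \ S) :
    (S.ncard : ℝ) * (T.ncard : ℝ) ≤
      ((q : ℝ) / ((q : ℝ) + (ρ : ℝ) - 2)) ^ 2 * CircleGeometry.lam q ρ *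
        (1 - (S.ncard : ℝ) / ((q : ℝ) * ((q : ℝ) + 1 - (ρ : ℝ)))) *
        (1 - (T.ncard : ℝ) / ((q : ℝ) ^ 2 * ((q : ℝ) - 1))) := by
  cases hD with
  | moebius Q hQ => exact bound_moebius (hq ▸ hq2) hQ hF P S T hS hT hq
  | laguerre h p O hO R hR => exact bound_laguerre (hq ▸ hq2) h hO hR hF P S T hS hT hq
  | extendedLaguerre h p O hO R hR N hN =>
    exact bound_extendedLaguerre (hq ▸ hq2) h hO hR hN hF P S T hS hT hq
  | minkowski Q hQ => exact bound_minkowski (hq ▸ hq2) hQ hF P S T hS hT hq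
  | twistedMinkowski φ => exact bound_twistedMinkowski (hq ▸ hq2) φ hF P S T hS hT hq
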